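/- **Setting.** $M\ge1$ agents minimize $\Phi(x)=\max_{y\in\mathbb R^m} f(x,y)$ over $x\in\mathbb R^d$, where $m\ge 1$ and $f=\frac1M\sum_{i=1}^M f_i$. Assume: every $f_i:\mathbb R^{d+m}\to\mathbb R$ is differentiable with $L$-Lipschitz gradient ($L>0$) and $\mu$-strongly concave in $y$ ($\mu>0$); $\inf\Phi>-\infty$; agent $i$ has a stochastic gradient $\tilde\nabla f_i(z;\xi)$, jointly measurable in $(z,\xi)$, $\xi\sim P_i$, with $\mathbf E\tilde\nabla f_i(z;\xi)=\nabla f_i(z)$, $\mathbf E\|\tilde\nabla f_i(z;\xi)-\nabla f_i(z)\|^2\le\sigma^2$ ($\sigma>0$) and $\mathbf E\|\tilde\nabla f_i(z;\xi)-\tilde\nabla f_i(z';\xi)\|^2\le L^2\|z-z'\|^2$ for all $z,z'$; $W\in\mathbb R^{M\times M}$ is doubly stochastic with non-negative entries and $\rho=\|W-\frac1M\mathbf 1\mathbf 1^\top\|_2<1$. Put $\kappa=L/\mu$ and $r=\min\{(1-\rho)^2,1/\kappa\}$. **Method (DGDA-VR).** Start from $z_i^0=(x_i^0,y_i^0)$;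 $v_i^0$ is the average of $S_1$ independent stochastic gradients of agent $i$ at $z_i^0$, and $D^0=(d_i^0)_i$ is any measurable function of $V^0=(v_i^0)_i$ with finite second moments and $\frac1M\sum_i d^0_i=\frac1M\sum_i v^0_i$ (for example $D^0=V^0$). For $t=0,1,2,\dots$: $x_i^{t+1}=\sum_j w_{ij}x_j^t-\eta_x d_{x,i}^t$, $y_i^{t+1}=\sum_j w_{ij}y_j^t+\eta_y d_{y,i}^t$; if $q\mid t$, then $v_i^{t+1}$ is the average of $S_1$ fresh stochastic gradients at $z_i^{t+1}$; otherwise $v_i^{t+1}=v_i^t+\frac1{S_2}\sum_{k\le S_2}\big(\tilde\nabla f_i(z_i^{t+1};\xi_k)-\tilde\nabla f_i(z_i^t;\xi_k)\big)$ with $S_2$ fresh samples; finally $d_i^{t+1}=\sum_j w_{ij}(d_j^t+v_j^{t+1}-v_j^t)$. All samples are independent. Bars denote averages over the agents, $U_\perp$ the deviation of $U$ from its average over the agents, $y^*(x)=\arg\max_y f(x,y)$. Put $$\Delta_\Phi=\Phi(\bar x^0)-\inf\Phi,\quad \delta_0=\|y^*(\bar x^0)-\bar y^0\|^2,\quad \Lambda_0=\max\{\|Z^0_\perp\|_F^2,\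 \mathbf E\|D^0_\perp\|_F^2/L^2\}.$$ **Theorem.** There are universal constants $c_y,c_x,c_S,C>0$, and for every $b\ge1$ a constant $C'>0$ depending only on $b$, such that the following holds for all data as above, all $\epsilon>0$ and all parameters (real $\eta_x,\eta_y>0$, integers $S_1,S_2,q\geq 1$) with $$\eta_y\le c_y\frac rL,\qquad \eta_x\le c_x\frac{\eta_y}{\kappa^2},\qquad S_1\ge c_S\frac{\kappa^2\sigma^2}{\epsilon^2},\qquad S_2\ge q .$$ The function $\Phi$ is differentiable, every $\|\nabla\Phi(\bar x^t)\|^2$ is integrable, and there is $T_\epsilon\in\mathbb N$ with $$T_\epsilon\le\Big\lceil C\max\Big\{\frac{\Delta_\Phi}{\eta_x},\frac{L\kappa\,\delta_0}{\eta_y},\frac{L^2\kappa^2\Lambda_0}{(1-\rho)M}\Big\}\epsilon^{-2}\Big\rceil$$ such that: 1. For all $T\ge T_\epsilon$, $\ \frac1T\sum_{t=0}^{T-1}\mathbf E\|\nabla\Phi(\bar x^t)\|^2\le\epsilon^2$ and $\frac1T\sum_{t=0}^{T-1}\mathbf E\|\nabla\Phi(\bar x^t)\|\le\epsilon$ (an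 empty average being $0$). 2. Suppose moreover that $\epsilon\le1$ and that the choices are tight up to the factor $b$: $\eta_y\ge\frac{r}{bL}$, $\eta_x\ge\frac{\eta_y}{b\kappa^2}$, $S_1\le b\max\{1,\frac{\kappa^2\sigma^2}{\epsilon^2}\}$, $\frac{\kappa\sigma}{b\epsilon}\le q\le b\max\{1,\frac{\kappa\sigma}{\epsilon}\}$, $S_2\le bq$. With $$A=1+\max\Big\{\frac{L\kappa^2\Delta_\Phi}{r},\frac{L^2\kappa\,\delta_0}{r},\frac{L^2\kappa^2\Lambda_0}{(1-\rho)M}\Big\},\qquad B=\max\{1,\kappa\sigma\}\big(\max\{1,\kappa\sigma\}+A\big),$$ $T_\epsilon\le C'A\,\epsilon^{-2}$ communication rounds suffice (one per iteration), and the number of stochastic gradient evaluations of each agent, initialization included, as well as the number $\lceil T_\epsilon/q\rceil S_1+T_\epsilon S_2$, are at most $C'B\,\epsilon^{-3}$. If $\|D^0_\perp\|_F\le\|V^0_\perp\|_F$ for every value of $V^0$ (for example if $D^0=V^0$), then $\Lambda_0\le\max\{\|Z^0_\perp\|_F^2,\ (\|G_\perp\|_F^2+M\sigma^2)/L^2\}$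 with $G=(\nabla f_i(z_i^0))_i$, so that $A$ and $B$ are bounded independently of $\epsilon$. -/

import Mathlib

open MeasureTheory ProbabilityTheory
open scoped Gradient

noncomputable section

namespace DGDAVR

/-- The space `ℝ^d × ℝ^m ≅ ℝ^(d+m)` of pairs `z = (x, y)`, with the Euclidean norm. -/
abbrev Pt (d m : ℕ) : Type :=
  WithLp 2 (EuclideanSpace ℝ (Fin d) × EuclideanSpace ℝ (Fin m))

/-- The pair `(x, y)` as a point of `ℝ^(d+m)`. -/
def pair {d m : ℕ} (x : EuclideanSpace ℝ (Fin d)) (y : EuclideanSpace ℝ (Fin m)) : Pt d m :=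
  WithLp.toLp 2 (x, y)

/-- The average `(1/M) ∑ i, u i` of the local vectors of the `M` agents. -/
def avg {M : ℕ} {E : Type*} [AddCommGroup E] [Module ℝ E] (u : Fin M → E) : E :=
  (M : ℝ)⁻¹ • ∑ i, u i

/-- One communication round: row `i` of `W U` is `∑ j, w_ij u_j`. -/
def mix {M : ℕ} {E : Type*} [AddCommGroup E] [Module ℝ E]
    (W : Matrix (Fin M) (Fin M) ℝ) (u : Fin M → E) : Fin M → E :=
  fun i => ∑ j, W i j • u j

/-- The squared Frobenius norm `‖U_⊥‖_F²` of the deviation of `U` from its average. -/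
def consensusError {M : ℕ} {E : Type*} [NormedAddCommGroup E] [NormedSpace ℝ E]
    (u : Fin M → E) : ℝ :=
  ∑ i, ‖u i - avg u‖ ^ 2

/-- `ρ = ‖W - Π‖₂`, where `Π = (1/M) 𝟏 𝟏ᵀ` and `‖·‖₂` is the spectral norm. -/
def rho {M : ℕ} (W : Matrix (Fin M) (Fin M) ℝ) : ℝ :=
  ‖Matrix.toEuclideanCLM (n := Fin M) (𝕜 := ℝ) (W - Matrix.of fun _ _ => (M : ℝ)⁻¹)‖

/-- The global objective `f = (1/M) ∑ i, f_i`. -/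
def globalObj {d m M : ℕ} (f : Fin M → Pt d m → ℝ) (z : Pt d m) : ℝ :=
  (M : ℝ)⁻¹ * ∑ i, f i z

/-- The primal function `Φ(x) = max_y f(x, y)`. -/
def primal {d m M : ℕ} (f : Fin M → Pt d m → ℝ) (x : EuclideanSpace ℝ (Fin d)) : ℝ :=
  ⨆ y, globalObj f (pair x y)

/-- The best response `y*(x) = argmax_y f(x, y)`. -/
def bestResponse {d m M : ℕ} (f : Fin M → Pt d m → ℝ) (x : EuclideanSpace ℝ (Fin d)) :
    EuclideanSpace ℝ (Fin m) :=
  Classical.epsilon fun y => ∀ y', globalObj f (pair x y') ≤ globalObj f (pair x y)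

/-- The standing assumptions on the local functions `f i`: they are `L`-smooth, `μ`-strongly
concave in `y`, and the primal function is bounded below. -/
structure ObjectiveAssumptions {d m M : ℕ} (f : Fin M → Pt d m → ℝ) (L μ : ℝ) : Prop where
  L_pos : 0 < L
  mu_pos : 0 < μ
  differentiable : ∀ i, Differentiable ℝ (f i)
  smooth : ∀ i z z', ‖∇ (f i) z - ∇ (f i) z'‖ ≤ L * ‖z - z'‖
  strongConcave : ∀ i x, StrongConcaveOn Set.univ μ fun y => f i (pair x y)
  primal_bddBelow : BddBelow (Set.range (primal f))

/-- The standing assumptions on the stochastic gradient oracles `g i z ξ`, where agent `i` draws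
its samples `ξ` from `P i`: unbiasedness, variance at most `σ²`, mean-squared smoothness. -/
structure OracleAssumptions {d m M : ℕ} {Ξ : Type*} [MeasurableSpace Ξ]
    (f : Fin M → Pt d m → ℝ) (g : Fin M → Pt d m → Ξ → Pt d m) (P : Fin M → Measure Ξ)
    (L σ : ℝ) : Prop where
  sigma_pos : 0 < σ
  measurable : ∀ i, Measurable (Function.uncurry (g i))
  memLp : ∀ i z, MemLp (g i z) 2 (P i)
  unbiased : ∀ i z, ∫ s, g i z s ∂(P i) = ∇ (f i) z
  variance : ∀ i z, ∫ s, ‖g i z s - ∇ (f i) z‖ ^ 2 ∂(P i) ≤ σ ^ 2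
  meanSquaredSmooth : ∀ i z z',
    ∫ s, ‖g i z s - g i z' s‖ ^ 2 ∂(P i) ≤ L ^ 2 * ‖z - z'‖ ^ 2

/-- The samples `ξ i t k` (the `k`-th sample that agent `i` draws for iterate `t`) are independent,
and agent `i` draws from the law `P i`. -/
structure SampleAssumptions {M : ℕ} {Ω Ξ : Type*} [MeasurableSpace Ω] [MeasurableSpace Ξ]
    (Pr : Measure Ω) (P : Fin M → Measure Ξ) (ξ : Fin M → ℕ → ℕ → Ω → Ξ) : Prop where
  law : ∀ i t k, MeasurePreserving (ξ i t k) Pr (P i)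
  indep : iIndepFun (fun (a : Fin M × ℕ × ℕ) => ξ a.1 a.2.1 a.2.2) Pr

/-- The mini-batch estimator `G_i` at `z` formed from the first `S` samples in the list `s`. -/
def batchGrad {d m : ℕ} {Ξ : Type*} (gi : Pt d m → Ξ → Pt d m) (S : ℕ) (s : ℕ → Ξ)
    (z : Pt d m) : Pt d m :=
  (S : ℝ)⁻¹ • ∑ k ∈ Finset.range S, gi z (s k)

/-- The parameters of the method: step sizes, batch sizes and restart period. -/
structure Params where
  ηx : ℝ
  ηy : ℝ
  S₁ : ℕ
  S₂ : ℕ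
  q : ℕ

/-- The variables of all agents at one iteration: iterates `z i = (x i, y i)`, gradient
estimates `v i` and gradient trackers `d i`. -/
structure State (d m M : ℕ) where
  z : Fin M → Pt d m
  v : Fin M → Pt d m
  dir : Fin M → Pt d m

/-- The initial state. The gradient estimates `v i` are averages of `S₁` samples at `z⁰_i`;
the trackers are obtained from them by a map `D₀`. -/
def initState {d m M : ℕ} {Ξ : Type*} (g : Fin M → Pt d m → Ξ → Pt d m) (p : Params)
    (z₀ : Fin M → Pt d m) (D₀ : (Fin M → Pt d m) → (Fin M → Pt d m)) (s : Fin M → ℕ → Ξ) :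
    State d m M where
  z := z₀
  v := fun i => batchGrad (g i) p.S₁ (s i) (z₀ i)
  dir := D₀ fun i => batchGrad (g i) p.S₁ (s i) (z₀ i)

/-- Iteration `t` of the method, from the state at `t` to the state at `t + 1`; the list `s` holds
the fresh samples of this iteration. -/
def step {d m M : ℕ} {Ξ : Type*} (g : Fin M → Pt d m → Ξ → Pt d m)
    (W : Matrix (Fin M) (Fin M) ℝ) (p : Params) (t : ℕ) (s : Fin M → ℕ → Ξ)
    (S : State d m M) : State d m M :=
  let z' : Fin M → Pt d m := fun i =>
    pair ((mix W S.z i).fst - p.ηx • (S.dir i).fst) ((mix W S.z i).snd + p.ηy • (S.dir i).snd)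
  let v' : Fin M → Pt d m := fun i =>
    if t % p.q = 0 then batchGrad (g i) p.S₁ (s i) (z' i)
    else batchGrad (g i) p.S₂ (s i) (z' i) - batchGrad (g i) p.S₂ (s i) (S.z i) + S.v i
  { z := z', v := v', dir := mix W fun i => S.dir i + v' i - S.v i }

/-- The run of the method on the samples `s i t k`; those with `t = 0` are used for the initial
estimates, those with index `t + 1` in iteration `t`. -/
def run {d m M : ℕ} {Ξ : Type*} (g : Fin M → Pt d m → Ξ → Pt d m)
    (W : Matrix (Fin M) (Fin M) ℝ) (p : Params) (z₀ : Fin M → Pt d m)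
    (D₀ : (Fin M → Pt d m) → (Fin M → Pt d m)) (s : Fin M → ℕ → ℕ → Ξ) : ℕ → State d m M
  | 0 => initState g p z₀ D₀ fun i => s i 0
  | t + 1 => step g W p t (fun i => s i (t + 1)) (run g W p z₀ D₀ s t)

/-- The averaged primal iterate `x̄^t` of a run. -/
def xbar {d m M : ℕ} {Ξ : Type*} (g : Fin M → Pt d m → Ξ → Pt d m)
    (W : Matrix (Fin M) (Fin M) ℝ) (p : Params) (z₀ : Fin M → Pt d m)
    (D₀ : (Fin M → Pt d m) → (Fin M → Pt d m)) (s : Fin M → ℕ → ℕ → Ξ) (t : ℕ) :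
    EuclideanSpace ℝ (Fin d) :=
  (avg (run g W p z₀ D₀ s t).z).fst

/-- The number of evaluations of its stochastic gradient that each agent makes in the
initialization and in the iterations `0, …, T - 1`. In an iteration without restart, each
of the `S₂` samples is used at two points. -/
def oracleCalls (p : Params) (T : ℕ) : ℕ :=
  p.S₁ + ∑ t ∈ Finset.range T, if t % p.q = 0 then p.S₁ else 2 * p.S₂

/-- The usual sample count `⌈T / q⌉ S₁ + T S₂` for `T` iterations. -/
def sampleCount (p : Params) (T : ℕ) : ℕ :=
  ⌈(T : ℝ) / p.q⌉₊ * p.S₁ + T * p.S₂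

/-- `Δ_Φ = Φ(x̄⁰) - inf Φ`. -/
def primalGap {d m M : ℕ} (f : Fin M → Pt d m → ℝ) (z₀ : Fin M → Pt d m) : ℝ :=
  primal f (avg z₀).fst - ⨅ x, primal f x

/-- `δ₀ = ‖y*(x̄⁰) - ȳ⁰‖²`. -/
def dualGap {d m M : ℕ} (f : Fin M → Pt d m → ℝ) (z₀ : Fin M → Pt d m) : ℝ :=
  ‖bestResponse f (avg z₀).fst - (avg z₀).snd‖ ^ 2

/-- The initial consensus error `Λ₀ = max {‖Z⁰_⊥‖_F², E‖D⁰_⊥‖_F² / L²}`. -/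
def initConsensus {d m M : ℕ} {Ω Ξ : Type*} [MeasurableSpace Ω] (Pr : Measure Ω)
    (g : Fin M → Pt d m → Ξ → Pt d m) (p : Params) (L : ℝ) (z₀ : Fin M → Pt d m)
    (D₀ : (Fin M → Pt d m) → (Fin M → Pt d m)) (ξ : Fin M → ℕ → ℕ → Ω → Ξ) : ℝ :=
  max (consensusError z₀)
    ((∫ ω, consensusError (initState g p z₀ D₀ fun i k => ξ i 0 k ω).dir ∂Pr) / L ^ 2)

end DGDAVR

end

/-! Averaging over the agents removes the network. Since `W` is doubly stochastic and the trackers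
keep `avg d = avg v` (`avg_dir`), the averaged iterate performs exact gradient descent ascent along
`v̄ = avg v`. Its only defect is the error `e_t = ‖v̄ - ∇f(z̄)‖²`.

Along every path two inequalities hold. `primal_descent`: a step decreases `Φ` by `ηx/2 ‖∇Φ‖² + ηx/4
‖v̄_x‖²`, up to `ηx (L² δ_t + e_t)` with `δ_t = ‖y*(x̄) - ȳ‖²`. `dual_contraction`: `δ_t` contracts
by `1 - ηy μ/4`, with a further gain proportional to `‖∇_y f‖²`, up to multiples of `e_t` and of the
drift `ηx² ‖v̄_x‖²` of the best response. As `ηx ≲ ηy/κ²`, the drift is paid by part of the term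
`‖v̄_x‖²`. Summation (`pathwise_bounds`) bounds `∑ ‖∇Φ‖² + 2/5 ∑ ‖v̄_x‖²` by the initial gaps and
`42 κ² ∑ e_t`.

It remains to bound `κ² ∑ E e_t`. By Jensen, `e_t` is at most `2/M` times the estimation error plus
`L²` times the consensus error of `Z`. The estimation error grows by centred increments of variance
`L²/S₂ ‖z' - z‖²` and is reset every `q` steps, so with `S₂ ≥ q` its total is at most the restart
variance plus `L² ∑ ‖z' - z‖²` (`sum_le_of_restart`, `sum_integral_estError_le`). The consensus
errors of `Z` and `D` contract with factor `ρ` and are driven by `ηy² ‖D_⊥‖²` and by the increments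
of `V`. The increments of `Z` consist of consensus errors and the motion of the average, which leads
back to `‖v̄_x‖²`, `‖∇_y f‖²` and `e_t`.

This loop closes for small `ηy L`. Two successive contractions cost `(ηy L)²/(1-ρ)⁴`
(`error_sum_le_of_consensus`), and `κ² (ηy L)²` must be small for the motion of the average
(`error_sum_bound`): hence `r = min ((1-ρ)²) (1/κ)`. The remaining `2/5 ∑ ‖v̄_x‖²` cancels against
the primal descent. The batch size `S₁` makes the restart variance at most half of the target `ε²`,
and the iteration count does the same for the initial gaps. -/

namespace DGDAVR

/-! ### Averages, mixing and consensus errors -/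

section Consensus

variable {M : ℕ} {E : Type*} [NormedAddCommGroup E] [InnerProductSpace ℝ E]

lemma avg_add (u v : Fin M → E) : avg (fun i => u i + v i) = avg u + avg v := by
  simp [avg, Finset.sum_add_distrib]

lemma avg_sub (u v : Fin M → E) : avg (fun i => u i - v i) = avg u - avg v := by
  simp [avg, Finset.sum_sub_distrib, smul_sub]

lemma sum_eq_smul_avg (hM : 0 < M) (u : Fin M → E) : ∑ i, u i = (M : ℝ) • avg u := by
  have : (M : ℝ) ≠ 0 := by positivity
  simp [avg, smul_smul, this]

lemma consensusError_nonneg (u : Fin M → E) : 0 ≤ consensusError u :=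
  Finset.sum_nonneg fun _ _ => by positivity

lemma sum_sub_avg (hM : 0 < M) (u : Fin M → E) : ∑ i, (u i - avg u) = 0 := by
  rw [Finset.sum_sub_distrib, sum_eq_smul_avg hM u]
  simp [← Nat.cast_smul_eq_nsmul ℝ]

/-- The bias-variance decomposition of a sum of squared distances. -/
lemma sum_norm_sq_eq (hM : 0 < M) (u : Fin M → E) (c : E) :
    ∑ i, ‖u i - c‖ ^ 2 = consensusError u + M * ‖avg u - c‖ ^ 2 := by
  have h : ∀ i, ‖u i - c‖ ^ 2 =
      ‖u i - avg u‖ ^ 2 + 2 * inner ℝ (u i - avg u) (avg u - c) + ‖avg u - c‖ ^ 2 := by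
    intro i
    rw [← norm_add_sq_real]
    congr 2
    abel
  simp only [h, Finset.sum_add_distrib, ← Finset.mul_sum, ← sum_inner, sum_sub_avg hM]
  simp [consensusError]

lemma consensusError_le_sum (hM : 0 < M) (u : Fin M → E) (c : E) :
    consensusError u ≤ ∑ i, ‖u i - c‖ ^ 2 := by
  rw [sum_norm_sq_eq hM]
  have : 0 ≤ (M : ℝ) * ‖avg u - c‖ ^ 2 := by positivity
  linarith

lemma consensusError_le_sum_norm_sq (hM : 0 < M) (u : Fin M → E) :
    consensusError u ≤ ∑ i, ‖u i‖ ^ 2 := by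
  simpa using consensusError_le_sum hM u 0

lemma norm_avg_sq_le (hM : 0 < M) (u : Fin M → E) :
    ‖avg u‖ ^ 2 ≤ (M : ℝ)⁻¹ * ∑ i, ‖u i‖ ^ 2 := by
  have h := sum_norm_sq_eq hM u 0
  have h1 := consensusError_nonneg u
  have hM' : (0 : ℝ) < M := by exact_mod_cast hM
  simp only [sub_zero] at h
  rw [h, inv_mul_eq_div, le_div_iff₀ hM']
  linarith

lemma avg_mix {W : Matrix (Fin M) (Fin M) ℝ} (hW : W ∈ doublyStochastic ℝ (Fin M))
    (u : Fin M → E) : avg (mix W u) = avg u := by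
  have h := (mem_doublyStochastic_iff_sum.1 hW).2.2
  simp only [avg, mix]
  rw [Finset.sum_comm]
  simp [← Finset.sum_smul, h]

lemma norm_add_sq_le_young (p s : E) {β : ℝ} (hβ : 0 < β) :
    ‖p + s‖ ^ 2 ≤ (1 + β) * ‖p‖ ^ 2 + (1 + β⁻¹) * ‖s‖ ^ 2 := by
  rw [norm_add_sq_real]
  have h1 := real_inner_le_norm p s
  have h2 : 2 * (‖p‖ * ‖s‖) ≤ β * ‖p‖ ^ 2 + β⁻¹ * ‖s‖ ^ 2 := by
    have h3 : 0 ≤ β⁻¹ * (β * ‖p‖ - ‖s‖) ^ 2 := by positivity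
    have h4 : β⁻¹ * (β * ‖p‖ - ‖s‖) ^ 2 =
        β * ‖p‖ ^ 2 + β⁻¹ * ‖s‖ ^ 2 - 2 * (‖p‖ * ‖s‖) := by
      field_simp
      ring
    linarith
  nlinarith

/-- The matrix acts only on the agent index. In an orthonormal basis of `E` the claim splits into
one operator norm bound on `ℝ^M` per coordinate. -/
lemma sum_norm_sum_smul_sq_le [FiniteDimensional ℝ E] (A : Matrix (Fin M) (Fin M) ℝ)
    (w : Fin M → E) :
    ∑ i, ‖∑ j, A i j • w j‖ ^ 2 ≤
      ‖Matrix.toEuclideanCLM (n := Fin M) (𝕜 := ℝ) A‖ ^ 2 * ∑ i, ‖w i‖ ^ 2 := by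
  let e := stdOrthonormalBasis ℝ E
  have key : ∀ c, ∑ i, (∑ j, A i j * inner ℝ (e c) (w j)) ^ 2 ≤
      ‖Matrix.toEuclideanCLM (n := Fin M) (𝕜 := ℝ) A‖ ^ 2 * ∑ i, inner ℝ (e c) (w i) ^ 2 := by
    intro c
    have h := (Matrix.toEuclideanCLM (n := Fin M) (𝕜 := ℝ) A).le_opNorm
      (WithLp.toLp 2 fun j => inner ℝ (e c) (w j))
    have h2 := pow_le_pow_left₀ (norm_nonneg _) h 2
    rw [mul_pow, EuclideanSpace.norm_sq_eq, EuclideanSpace.norm_sq_eq] at h2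
    simpa [Matrix.ofLp_toEuclideanCLM, Matrix.mulVec, dotProduct] using h2
  simp only [← e.sum_sq_norm_inner_right, inner_sum, inner_smul_right, Real.norm_eq_abs, sq_abs]
  rw [Finset.sum_comm, Finset.sum_comm (s := Finset.univ (α := Fin M))
    (f := fun i c => inner ℝ (e c) (w i) ^ 2), Finset.mul_sum]
  exact Finset.sum_le_sum fun c _ => key c

/-- On deviations from the average the matrix `Π` vanishes, so `W - Π` sends the deviations of `u`
to those of `mix W u`. -/
lemma sum_norm_mix_sub_avg_sq_le [FiniteDimensional ℝ E] (hM : 0 < M)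
    {W : Matrix (Fin M) (Fin M) ℝ} (hW : W ∈ doublyStochastic ℝ (Fin M)) (u : Fin M → E) :
    consensusError (mix W u) ≤ rho W ^ 2 * consensusError u := by
  have hrow := (mem_doublyStochastic_iff_sum.1 hW).2.1
  have h := sum_norm_sum_smul_sq_le (W - Matrix.of fun _ _ => (M : ℝ)⁻¹) fun i => u i - avg u
  have h2 : ∀ i, ∑ j, (W - Matrix.of fun _ _ => (M : ℝ)⁻¹ : Matrix (Fin M) (Fin M) ℝ) i j • (u j - avg u) =
      mix W u i - avg (mix W u) := by
    intro i
    rw [avg_mix hW]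
    simp only [Matrix.sub_apply, Matrix.of_apply, sub_smul, Finset.sum_sub_distrib,
      ← Finset.smul_sum, smul_sub, ← Finset.sum_smul, hrow]
    have := sum_sub_avg hM u
    rw [Finset.sum_sub_distrib, sub_eq_zero] at this
    rw [this, one_smul, mix]
    abel
  simp only [h2] at h
  exact h

lemma consensusError_add_le {β : ℝ} (hβ : 0 < β) (u v : Fin M → E) :
    consensusError (fun i => u i + v i) ≤
      (1 + β) * consensusError u + (1 + β⁻¹) * consensusError v := by
  unfold consensusError
  rw [avg_add, Finset.mul_sum, Finset.mul_sum, ← Finset.sum_add_distrib]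
  refine Finset.sum_le_sum fun i _ => ?_
  rw [add_sub_add_comm]
  exact norm_add_sq_le_young _ _ hβ

/-- Young's inequality with parameter `1 - ρ` turns the factor `ρ²` into at most `ρ`, because `ρ -
(2 - ρ) ρ² = ρ (1 - ρ)²`. -/
lemma contraction_coeff {ρ : ℝ} (h0 : 0 ≤ ρ) (h1 : ρ < 1) :
    (1 + (1 - ρ)) * ρ ^ 2 ≤ ρ ∧ 1 + (1 - ρ)⁻¹ ≤ 2 / (1 - ρ) := by
  constructor
  · nlinarith [mul_nonneg h0 (sq_nonneg (ρ - 1))]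
  · have : 0 < 1 - ρ := by linarith
    rw [← sub_nonneg]
    have e : 2 / (1 - ρ) - (1 + (1 - ρ)⁻¹) = ρ / (1 - ρ) := by field_simp; ring
    rw [e]; positivity

lemma consensusError_mix_add_le [FiniteDimensional ℝ E] (hM : 0 < M)
    {W : Matrix (Fin M) (Fin M) ℝ} (hW : W ∈ doublyStochastic ℝ (Fin M)) (hρ : rho W < 1)
    (u v : Fin M → E) :
    consensusError (fun i => mix W u i + v i) ≤
      rho W * consensusError u + 2 / (1 - rho W) * consensusError v := by
  have h0 : 0 ≤ rho W := norm_nonneg _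
  obtain ⟨c1, c2⟩ := contraction_coeff h0 hρ
  have hb : 0 < 1 - rho W := by linarith
  have h := consensusError_add_le hb (mix W u) v
  have h2 := sum_norm_mix_sub_avg_sq_le hM hW u
  have hu := consensusError_nonneg u
  have hv := consensusError_nonneg v
  calc _ ≤ _ := h
    _ ≤ (1 + (1 - rho W)) * (rho W ^ 2 * consensusError u) + 2 / (1 - rho W) * consensusError v := by
      gcongr
    _ = ((1 + (1 - rho W)) * rho W ^ 2) * consensusError u + 2 / (1 - rho W) * consensusError v := by
      ring
    _ ≤ _ := by gcongr

/-- The form needed for the trackers, where the increment is added before mixing. The consensus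
error of the mixed increment is bounded by its full norm. -/
lemma consensusError_mix_of_add_le [FiniteDimensional ℝ E] (hM : 0 < M)
    {W : Matrix (Fin M) (Fin M) ℝ} (hW : W ∈ doublyStochastic ℝ (Fin M)) (hρ : rho W < 1)
    (u v : Fin M → E) :
    consensusError (mix W fun i => u i + v i) ≤
      rho W * consensusError u + 2 / (1 - rho W) * ∑ i, ‖v i‖ ^ 2 := by
  have h0 : 0 ≤ rho W := norm_nonneg _
  have e : mix W (fun i => u i + v i) = fun i => mix W u i + mix W v i := by
    ext1 i; simp [mix, Finset.sum_add_distrib]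
  rw [e]
  refine (consensusError_mix_add_le hM hW hρ u _).trans ?_
  have h2 := sum_norm_mix_sub_avg_sq_le hM hW v
  have h3 := consensusError_le_sum_norm_sq hM v
  have hv := consensusError_nonneg v
  have h4 : consensusError (mix W v) ≤ ∑ i, ‖v i‖ ^ 2 :=
    h2.trans ((mul_le_of_le_one_left hv (pow_le_one₀ h0 hρ.le)).trans h3)
  have : 0 < 1 - rho W := by linarith
  gcongr

/-- Consecutive iterates move by their consensus errors and by the motion of the average. -/
lemma sum_norm_sub_sq_le (hM : 0 < M) (u v : Fin M → E) :
    ∑ i, ‖u i - v i‖ ^ 2 ≤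
      2 * consensusError u + 2 * consensusError v + M * ‖avg u - avg v‖ ^ 2 := by
  have h := sum_norm_sq_eq hM (fun i => u i - v i) 0
  simp only [sub_zero, avg_sub] at h
  rw [h]
  have h2 : consensusError (fun i => u i - v i) ≤ 2 * consensusError u + 2 * consensusError v := by
    unfold consensusError
    rw [avg_sub, Finset.mul_sum, Finset.mul_sum, ← Finset.sum_add_distrib]
    refine Finset.sum_le_sum fun i _ => ?_
    rw [sub_sub_sub_comm]
    have := parallelogram_law_with_norm ℝ (u i - avg u) (v i - avg v)
    nlinarith [norm_nonneg (u i - avg u + (v i - avg v))]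
  linarith

end Consensus

/-! ### Quadratic bounds from Lipschitz gradients -/

section Descent

/- `Differentiable.continuous` restated over a normed space: elaborating it directly over the
product `WithLp` space is expensive. -/
lemma continuous_of_differentiable {E : Type*} [NormedAddCommGroup E] [NormedSpace ℝ E]
    {F : E → ℝ} (h : Differentiable ℝ F) : Continuous F := h.continuous

variable {E : Type*} [NormedAddCommGroup E] [InnerProductSpace ℝ E] [CompleteSpace E]

/-- The quadratic upper bound for a function with Lipschitz gradient. -/
lemma le_quadratic_of_gradient_lipschitz {F : E → ℝ} {L : ℝ} (hd : Differentiable ℝ F)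
    (hL : ∀ z z', ‖∇ F z - ∇ F z'‖ ≤ L * ‖z - z'‖) (z w : E) :
    F (z + w) ≤ F z + inner ℝ (∇ F z) w + L / 2 * ‖w‖ ^ 2 := by
  -- The gap in the bound along the segment. Its derivative is nonpositive by the Lipschitz bound,
  -- and `φ 1 ≤ φ 0` is the claim.
  let φ : ℝ → ℝ := fun s => F (z + s • w) - s * inner ℝ (∇ F z) w - L / 2 * ‖w‖ ^ 2 * s ^ 2
  have hφ : ∀ s, HasDerivAt φ
      (inner ℝ (∇ F (z + s • w)) w - inner ℝ (∇ F z) w - L / 2 * ‖w‖ ^ 2 * (2 * s)) s := by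
    intro s
    have h1 : HasDerivAt (fun s : ℝ => z + s • w) w s := by
      simpa using ((hasDerivAt_id s).smul_const w).const_add z
    have h2 := (hd (z + s • w)).hasGradientAt.hasFDerivAt.comp_hasDerivAt s h1
    have h3 := (hasDerivAt_id s).mul_const (inner ℝ (∇ F z) w)
    have h4 := ((hasDerivAt_pow 2 s)).const_mul (L / 2 * ‖w‖ ^ 2)
    have h5 : HasDerivAt φ _ s := (h2.sub h3).sub h4
    convert h5 using 1
    simp
  have hanti : AntitoneOn φ (Set.Icc 0 1) := by
    refine antitoneOn_of_deriv_nonpos (convex_Icc 0 1)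
      (fun s _ => (hφ s).continuousAt.continuousWithinAt)
      (fun s _ => (hφ s).differentiableAt.differentiableWithinAt) fun s hs => ?_
    rw [interior_Icc] at hs
    rw [(hφ s).deriv, ← inner_sub_left]
    have h1 := real_inner_le_norm (∇ F (z + s • w) - ∇ F z) w
    have h2 := hL (z + s • w) z
    rw [add_sub_cancel_left, norm_smul, Real.norm_of_nonneg hs.1.le] at h2
    have h3 := mul_le_mul_of_nonneg_right h2 (norm_nonneg w)
    nlinarith
  have h := hanti (Set.left_mem_Icc.2 zero_le_one) (Set.right_mem_Icc.2 zero_le_one) zero_le_one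
  simp only [φ, one_smul, zero_smul, add_zero] at h
  linarith

lemma quadratic_le_of_gradient_lipschitz {F : E → ℝ} {L : ℝ} (hd : Differentiable ℝ F)
    (hL : ∀ z z', ‖∇ F z - ∇ F z'‖ ≤ L * ‖z - z'‖) (z w : E) :
    F z + inner ℝ (∇ F z) w - L / 2 * ‖w‖ ^ 2 ≤ F (z + w) := by
  have hg : ∀ z, HasGradientAt (fun z => -F z) (-∇ F z) z := fun z => by
    have := (hd z).hasGradientAt.hasFDerivAt.neg
    rw [hasGradientAt_iff_hasFDerivAt, map_neg]
    exact this
  have h := le_quadratic_of_gradient_lipschitz (F := fun z => -F z) (L := L)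
    (fun z => (hg z).differentiableAt)
    (fun z z' => by
      rw [(hg z).gradient, (hg z').gradient, neg_sub_neg, norm_sub_rev]; exact hL z z') z w
  rw [(hg z).gradient, inner_neg_left] at h
  linarith

/-- Provides differentiability of `Φ` without differentiating the maximiser `y*`. -/
lemma hasGradientAt_of_quadratic_bounds {Φ : E → ℝ} {G x : E} {K : ℝ}
    (h1 : ∀ w, Φ (x + w) ≤ Φ x + inner ℝ G w + K * ‖w‖ ^ 2)
    (h2 : ∀ w, Φ x + inner ℝ G w - K * ‖w‖ ^ 2 ≤ Φ (x + w)) : HasGradientAt Φ G x := by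
  rw [hasGradientAt_iff_isLittleO_nhds_zero]
  have hb : (fun w => Φ (x + w) - Φ x - inner ℝ G w) =O[nhds 0] fun w => ‖w‖ ^ 2 := by
    refine Asymptotics.IsBigO.of_bound K (Filter.Eventually.of_forall fun w => ?_)
    rw [Real.norm_eq_abs, Real.norm_eq_abs, abs_of_nonneg (by positivity : 0 ≤ ‖w‖ ^ 2), abs_le]
    constructor <;> linarith [h1 w, h2 w]
  refine hb.trans_isLittleO ?_
  have := (Asymptotics.isLittleO_pow_id (𝕜 := ℝ) one_lt_two).comp_tendsto
    (tendsto_norm_zero (E := E))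
  exact this.of_norm_right.trans_isBigO (by simpa [Function.comp_def] using Asymptotics.isBigO_refl _ _)

end Descent

/-! ### Smooth functions that are strongly concave in the second variable -/

section Slices

variable {d m : ℕ}

@[simp] lemma pair_fst (x : EuclideanSpace ℝ (Fin d)) (y : EuclideanSpace ℝ (Fin m)) :
    (pair x y).fst = x := rfl

@[simp] lemma pair_snd (x : EuclideanSpace ℝ (Fin d)) (y : EuclideanSpace ℝ (Fin m)) :
    (pair x y).snd = y := rfl

lemma norm_sq_eq_fst_add_snd (z : Pt d m) : ‖z‖ ^ 2 = ‖z.fst‖ ^ 2 + ‖z.snd‖ ^ 2 :=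
  WithLp.prod_norm_sq_eq_of_L2 z

lemma pair_add_pair (x x' : EuclideanSpace ℝ (Fin d)) (y y' : EuclideanSpace ℝ (Fin m)) :
    pair x y + pair x' y' = pair (x + x') (y + y') := rfl

lemma pair_sub_pair (x x' : EuclideanSpace ℝ (Fin d)) (y y' : EuclideanSpace ℝ (Fin m)) :
    pair x y - pair x' y' = pair (x - x') (y - y') := rfl

lemma norm_pair_zero_left (y : EuclideanSpace ℝ (Fin m)) :
    ‖(pair 0 y : Pt d m)‖ = ‖y‖ := by
  have := norm_sq_eq_fst_add_snd (pair 0 y : Pt d m)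
  rw [← sq_eq_sq₀ (norm_nonneg _) (norm_nonneg _), this]
  simp

lemma norm_pair_zero_right (x : EuclideanSpace ℝ (Fin d)) :
    ‖(pair x 0 : Pt d m)‖ = ‖x‖ := by
  have := norm_sq_eq_fst_add_snd (pair x 0 : Pt d m)
  rw [← sq_eq_sq₀ (norm_nonneg _) (norm_nonneg _), this]
  simp

lemma norm_fst_le (z : Pt d m) : ‖z.fst‖ ≤ ‖z‖ := by
  rw [← sq_le_sq₀ (norm_nonneg _) (norm_nonneg _), norm_sq_eq_fst_add_snd]
  nlinarith [sq_nonneg ‖z.snd‖]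

lemma norm_snd_le (z : Pt d m) : ‖z.snd‖ ≤ ‖z‖ := by
  rw [← sq_le_sq₀ (norm_nonneg _) (norm_nonneg _), norm_sq_eq_fst_add_snd]
  nlinarith [sq_nonneg ‖z.fst‖]

lemma inner_pair_right (z : Pt d m) (x : EuclideanSpace ℝ (Fin d))
    (y : EuclideanSpace ℝ (Fin m)) :
    inner ℝ z (pair x y) = inner ℝ z.fst x + inner ℝ z.snd y :=
  WithLp.prod_inner_apply z (pair x y)

/-- `F` has an `L`-Lipschitz gradient and is `μ`-strongly concave in the second variable. -/
structure SmoothConcave (F : Pt d m → ℝ) (L μ : ℝ) : Prop where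
  L_pos : 0 < L
  mu_pos : 0 < μ
  differentiable : Differentiable ℝ F
  smooth : ∀ z z', ‖∇ F z - ∇ F z'‖ ≤ L * ‖z - z'‖
  strongConcave : ∀ x, StrongConcaveOn Set.univ μ fun y => F (pair x y)

namespace SmoothConcave

variable {F : Pt d m → ℝ} {L μ : ℝ} (h : SmoothConcave F L μ)
include h

lemma upper_right (x : EuclideanSpace ℝ (Fin d)) (y w : EuclideanSpace ℝ (Fin m)) :
    F (pair x (y + w)) ≤
      F (pair x y) + inner ℝ (∇ F (pair x y)).snd w + L / 2 * ‖w‖ ^ 2 := by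
  have := le_quadratic_of_gradient_lipschitz h.differentiable h.smooth (pair x y) (pair 0 w)
  rwa [pair_add_pair, add_zero, inner_pair_right, inner_zero_right, zero_add,
    norm_pair_zero_left] at this

lemma lower_right (x : EuclideanSpace ℝ (Fin d)) (y w : EuclideanSpace ℝ (Fin m)) :
    F (pair x y) + inner ℝ (∇ F (pair x y)).snd w - L / 2 * ‖w‖ ^ 2 ≤ F (pair x (y + w)) := by
  have := quadratic_le_of_gradient_lipschitz h.differentiable h.smooth (pair x y) (pair 0 w)
  rwa [pair_add_pair, add_zero, inner_pair_right, inner_zero_right, zero_add,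
    norm_pair_zero_left] at this

lemma upper_left (x w : EuclideanSpace ℝ (Fin d)) (y : EuclideanSpace ℝ (Fin m)) :
    F (pair (x + w) y) ≤
      F (pair x y) + inner ℝ (∇ F (pair x y)).fst w + L / 2 * ‖w‖ ^ 2 := by
  have := le_quadratic_of_gradient_lipschitz h.differentiable h.smooth (pair x y) (pair w 0)
  rwa [pair_add_pair, add_zero, inner_pair_right, inner_zero_right, add_zero,
    norm_pair_zero_right] at this

lemma lower_left (x w : EuclideanSpace ℝ (Fin d)) (y : EuclideanSpace ℝ (Fin m)) :
    F (pair x y) + inner ℝ (∇ F (pair x y)).fst w - L / 2 * ‖w‖ ^ 2 ≤ F (pair (x + w) y) := by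
  have := quadratic_le_of_gradient_lipschitz h.differentiable h.smooth (pair x y) (pair w 0)
  rwa [pair_add_pair, add_zero, inner_pair_right, inner_zero_right, add_zero,
    norm_pair_zero_right] at this

/-- The first-order form of strong concavity. -/
lemma le_first_order (x : EuclideanSpace ℝ (Fin d)) (y w : EuclideanSpace ℝ (Fin m)) :
    F (pair x (y + w)) ≤
      F (pair x y) + inner ℝ (∇ F (pair x y)).snd w - μ / 2 * ‖w‖ ^ 2 := by
  have hL := h.L_pos
  have hμ := h.mu_pos
  -- Strong concavity bounds `F` at `y + s w` from below, smoothness from above. Division by `s`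
  -- leaves an error linear in `s`, and `s → 0` gives the claim.
  have key : ∀ s : ℝ, 0 < s → s < 1 →
      F (pair x (y + w)) - F (pair x y) + μ / 2 * ‖w‖ ^ 2 - inner ℝ (∇ F (pair x y)).snd w ≤
        s * ((L + μ) / 2 * ‖w‖ ^ 2) := by
    intro s hs hs1
    have hu := h.lower_right x y (s • w)
    have hu' := h.upper_right x y (s • w)
    have hc := (h.strongConcave x).2 (Set.mem_univ y) (Set.mem_univ (y + w))
      (by linarith : (0 : ℝ) ≤ 1 - s) hs.le (by ring)
    have e : (1 - s) • y + s • (y + w) = y + s • w := by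
      rw [sub_smul, one_smul, smul_add]; abel
    rw [e] at hc
    simp only [smul_eq_mul, sub_add_cancel_left, norm_neg] at hc
    rw [inner_smul_right, norm_smul, Real.norm_of_nonneg hs.le, mul_pow] at hu'
    refine le_of_mul_le_mul_left ?_ hs
    linarith
  by_contra hcon
  push Not at hcon
  set a := F (pair x (y + w)) - F (pair x y) + μ / 2 * ‖w‖ ^ 2 - inner ℝ (∇ F (pair x y)).snd w
    with ha
  have ha0 : 0 < a := by rw [ha]; linarith
  set K := (L + μ) / 2 * ‖w‖ ^ 2 with hK
  have hK0 : 0 ≤ K := by positivity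
  -- A value of `s` in `(0, 1)` with `s K < a`, which contradicts `key`.
  have := key (a / (a + K + a + 1) ) (by positivity) (by rw [div_lt_one (by positivity)]; linarith)
  rw [div_mul_eq_mul_div, le_div_iff₀ (by positivity)] at this
  nlinarith

lemma continuous : Continuous F := continuous_of_differentiable h.differentiable

/-- Outside the ball of radius `2 ‖g‖ / μ` the strong concavity term outweighs the linear one, so
values there do not exceed the value at `0`. Inside, compactness applies. -/
lemma exists_max (x : EuclideanSpace ℝ (Fin d)) : ∃ y, ∀ y', F (pair x y') ≤ F (pair x y) := by
  have hμ := h.mu_pos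
  set g := (∇ F (pair x 0)).snd with hg
  have hc : ContinuousOn (fun y => F (pair x y)) (Metric.closedBall 0 (2 * ‖g‖ / μ)) := by
    refine Continuous.continuousOn ?_
    have : Continuous fun y : EuclideanSpace ℝ (Fin m) => pair x y :=
      (WithLp.prod_continuous_toLp 2 _ _).comp (by fun_prop)
    exact h.continuous.comp this
  obtain ⟨y, hy, hmax⟩ := (isCompact_closedBall (0 : EuclideanSpace ℝ (Fin m))
    (2 * ‖g‖ / μ)).exists_isMaxOn ⟨0, Metric.mem_closedBall_self (by positivity)⟩ hc
  refine ⟨y, fun y' => ?_⟩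
  by_cases hy' : y' ∈ Metric.closedBall (0 : EuclideanSpace ℝ (Fin m)) (2 * ‖g‖ / μ)
  · exact hmax hy'
  · have h0 := hmax (Metric.mem_closedBall_self (by positivity : 0 ≤ 2 * ‖g‖ / μ))
    refine le_trans ?_ h0
    rw [mem_closedBall_zero_iff, not_le, div_lt_iff₀ hμ] at hy'
    have h1 := h.le_first_order x 0 y'
    rw [zero_add] at h1
    have h2 := real_inner_le_norm g y'
    have h3 : 0 ≤ ‖y'‖ := norm_nonneg _
    have h4 : 2 * ‖g‖ * ‖y'‖ ≤ ‖y'‖ * μ * ‖y'‖ := mul_le_mul_of_nonneg_right hy'.le h3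
    have h5 : F (pair x y') ≤ F (pair x 0) := by linarith
    exact h5

/-- An ascent step of length `1/L` would otherwise raise the value by `‖g‖² / (2 L)`. -/
lemma gradient_snd_eq_zero_of_max {x : EuclideanSpace ℝ (Fin d)} {y : EuclideanSpace ℝ (Fin m)}
    (hy : ∀ y', F (pair x y') ≤ F (pair x y)) : (∇ F (pair x y)).snd = 0 := by
  have hL := h.L_pos
  set g := (∇ F (pair x y)).snd with hg
  have h1 := h.lower_right x y (L⁻¹ • g)
  have h2 := hy (y + L⁻¹ • g)
  rw [inner_smul_right, real_inner_self_eq_norm_sq, norm_smul, mul_pow, Real.norm_eq_abs,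
    sq_abs] at h1
  have e : L / 2 * (L⁻¹ ^ 2 * ‖g‖ ^ 2) = L⁻¹ * ‖g‖ ^ 2 / 2 := by field_simp
  rw [e] at h1
  have h3 : 0 < L⁻¹ := by positivity
  have h4 : ‖g‖ ^ 2 ≤ 0 := by nlinarith
  have : ‖g‖ = 0 := by nlinarith [norm_nonneg g]
  exact norm_eq_zero.1 this

/-- The partial gradient at a point controls its distance to a maximiser and points towards it. -/
lemma inner_gradient_sub_le {x : EuclideanSpace ℝ (Fin d)} {ys : EuclideanSpace ℝ (Fin m)}
    (hy : ∀ y', F (pair x y') ≤ F (pair x ys)) (y : EuclideanSpace ℝ (Fin m)) :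
    ‖(∇ F (pair x y)).snd‖ ^ 2 / (2 * L) + μ / 2 * ‖ys - y‖ ^ 2 ≤
      inner ℝ (∇ F (pair x y)).snd (ys - y) := by
  have hL := h.L_pos
  set g := (∇ F (pair x y)).snd with hg
  -- The value after an ascent step of length `1/L` is at most the maximum, which the first-order
  -- strong concavity at `y` bounds in turn.
  have h1 := h.lower_right x y (L⁻¹ • g)
  have h2 := hy (y + L⁻¹ • g)
  rw [inner_smul_right, real_inner_self_eq_norm_sq, norm_smul, mul_pow, Real.norm_eq_abs,
    sq_abs] at h1
  have e : L / 2 * (L⁻¹ ^ 2 * ‖g‖ ^ 2) = L⁻¹ * ‖g‖ ^ 2 / 2 := by field_simp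
  have e' : ‖g‖ ^ 2 / (2 * L) = L⁻¹ * ‖g‖ ^ 2 / 2 := by field_simp
  rw [e] at h1
  rw [e']
  have h3 := h.le_first_order x y (ys - y)
  rw [add_sub_cancel] at h3
  linarith

/-- Maximisers in the second variable depend on the first one in a Lipschitz way. -/
lemma mul_norm_sub_max_le {x x' : EuclideanSpace ℝ (Fin d)} {y y' : EuclideanSpace ℝ (Fin m)}
    (hy : ∀ w, F (pair x w) ≤ F (pair x y)) (hy' : ∀ w, F (pair x' w) ≤ F (pair x' y')) :
    μ * ‖y - y'‖ ≤ L * ‖x - x'‖ := by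
  -- Adding strong concavity at `y` and at `y'` gives `μ ‖y - y'‖² ≤ ⟨∇_y F(x, y'), y - y'⟩`. The
  -- gradient vanishes at `(x', y')`, so at `(x, y')` it is at most `L ‖x - x'‖`.
  have h1 := h.le_first_order x y' (y - y')
  have h2 := h.le_first_order x y (y' - y)
  rw [add_sub_cancel] at h1 h2
  rw [h.gradient_snd_eq_zero_of_max hy, inner_zero_left, norm_sub_rev] at h2
  have h3 := h.gradient_snd_eq_zero_of_max hy'
  have h4 := h.smooth (pair x y') (pair x' y')
  rw [pair_sub_pair, sub_self, norm_pair_zero_right] at h4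
  have h5 := real_inner_le_norm (∇ F (pair x y')).snd (y - y')
  have h6 : ‖(∇ F (pair x y')).snd‖ ≤ L * ‖x - x'‖ := by
    have e : (∇ F (pair x y')).snd = (∇ F (pair x y') - ∇ F (pair x' y')).snd := by
      rw [WithLp.sub_snd, h3, sub_zero]
    rw [e]
    exact (norm_snd_le _).trans h4
  have h7 : μ * ‖y - y'‖ ^ 2 ≤ L * ‖x - x'‖ * ‖y - y'‖ := by
    have := mul_le_mul_of_nonneg_right h6 (norm_nonneg (y - y'))
    linarith
  by_cases h0 : ‖y - y'‖ = 0
  · rw [h0, mul_zero]; have := h.L_pos; positivity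
  · have : 0 < ‖y - y'‖ := lt_of_le_of_ne (norm_nonneg _) (Ne.symm h0)
    nlinarith

/-- The two quadratic bounds are compared along a unit vector in `y`, which exists because `m > 0`.
This is the source of `κ ≥ 1`. -/
lemma mu_le_L (hm : 0 < m) : μ ≤ L := by
  have h1 := h.le_first_order 0 0 (EuclideanSpace.single ⟨0, hm⟩ 1)
  have h2 := h.lower_right 0 0 (EuclideanSpace.single ⟨0, hm⟩ 1)
  simp at h1 h2
  linarith

end SmoothConcave

end Slices

/-! ### The primal function, its descent, and the contraction towards the best response -/

section Objective

variable {d m M : ℕ} {f : Fin M → Pt d m → ℝ} {L μ : ℝ}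

lemma hasGradientAt_average {E : Type*} [NormedAddCommGroup E] [InnerProductSpace ℝ E]
    [CompleteSpace E] {f : Fin M → E → ℝ} (hf : ∀ i, Differentiable ℝ (f i)) (z : E) :
    HasGradientAt (fun z => (M : ℝ)⁻¹ * ∑ i, f i z) (avg fun i => ∇ (f i) z) z := by
  have h : HasFDerivAt (fun z => (M : ℝ)⁻¹ * ∑ i, f i z)
      ((M : ℝ)⁻¹ • ∑ i, InnerProductSpace.toDual ℝ E (∇ (f i) z)) z :=
    (HasFDerivAt.fun_sum fun i _ => (hf i z).hasGradientAt.hasFDerivAt).const_mul _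
  rw [hasGradientAt_iff_hasFDerivAt]
  rwa [avg, map_smul, map_sum]

lemma norm_avg_le_of_forall {E : Type*} [NormedAddCommGroup E] [InnerProductSpace ℝ E]
    (hM : 0 < M) {u : Fin M → E} {c : ℝ} (h : ∀ i, ‖u i‖ ≤ c) : ‖avg u‖ ≤ c := by
  have hM' : (0 : ℝ) < M := by exact_mod_cast hM
  rw [avg, norm_smul, norm_inv, Real.norm_of_nonneg hM'.le, inv_mul_le_iff₀ hM']
  calc ‖∑ i, u i‖ ≤ ∑ _i : Fin M, c := norm_sum_le_of_le _ fun i _ => h i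
    _ = M * c := by simp

lemma ObjectiveAssumptions.gradient_globalObj (h : ObjectiveAssumptions f L μ) (z : Pt d m) :
    ∇ (globalObj f) z = avg fun i => ∇ (f i) z :=
  (hasGradientAt_average h.differentiable z).gradient

lemma ObjectiveAssumptions.smoothConcave (h : ObjectiveAssumptions f L μ) (hM : 0 < M) :
    SmoothConcave (globalObj f) L μ where
  L_pos := h.L_pos
  mu_pos := h.mu_pos
  differentiable z := (hasGradientAt_average h.differentiable z).differentiableAt
  smooth z z' := by
    rw [h.gradient_globalObj, h.gradient_globalObj, ← avg_sub]
    exact norm_avg_le_of_forall hM fun i => h.smooth i z z'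
  strongConcave x := by
    refine ⟨convex_univ, fun y _ y' _ a b ha hb hab => ?_⟩
    have hM' : (0 : ℝ) < M := by exact_mod_cast hM
    have h1 := Finset.sum_le_sum (s := Finset.univ) fun i _ =>
      (h.strongConcave i x).2 (Set.mem_univ y) (Set.mem_univ y') ha hb hab
    have h2 := mul_le_mul_of_nonneg_left h1 (inv_pos.2 hM').le
    refine le_trans (le_of_eq ?_) h2
    simp only [globalObj, smul_eq_mul, Finset.sum_add_distrib, ← Finset.mul_sum,
      Finset.sum_const, Finset.card_univ, Fintype.card_fin, nsmul_eq_mul]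
    field_simp

variable (h : SmoothConcave (globalObj f) L μ)
include h

lemma globalObj_le_bestResponse (x : EuclideanSpace ℝ (Fin d)) (y : EuclideanSpace ℝ (Fin m)) :
    globalObj f (pair x y) ≤ globalObj f (pair x (bestResponse f x)) :=
  Classical.epsilon_spec (h.exists_max x) y

lemma primal_eq (x : EuclideanSpace ℝ (Fin d)) :
    primal f x = globalObj f (pair x (bestResponse f x)) :=
  le_antisymm (ciSup_le (globalObj_le_bestResponse h x))
    (le_ciSup (f := fun y => globalObj f (pair x y))
      ⟨_, Set.forall_mem_range.2 (globalObj_le_bestResponse h x)⟩ (bestResponse f x))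

lemma norm_bestResponse_sub_le (x x' : EuclideanSpace ℝ (Fin d)) :
    ‖bestResponse f x - bestResponse f x'‖ ≤ L / μ * ‖x - x'‖ := by
  have := h.mul_norm_sub_max_le (globalObj_le_bestResponse h x) (globalObj_le_bestResponse h x')
  rw [div_mul_eq_mul_div, le_div_iff₀ h.mu_pos]
  linarith

/-- With `y' = y*(x + w)`, expand `f(·, y')` at `x`. Then `f(x, y') ≤ Φ(x)`, and replacing `y'` by
`y*(x)` in the gradient costs `L ‖y' - y*(x)‖ ≤ L (L/μ) ‖w‖`. -/
lemma primal_upper (x w : EuclideanSpace ℝ (Fin d)) :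
    primal f (x + w) ≤ primal f x +
      inner ℝ (∇ (globalObj f) (pair x (bestResponse f x))).fst w +
        (L * (L / μ) + L / 2) * ‖w‖ ^ 2 := by
  rw [primal_eq h, primal_eq h]
  set y := bestResponse f x
  set y' := bestResponse f (x + w) with hy'
  have h1 := h.upper_left x w y'
  have h2 := globalObj_le_bestResponse h x y'
  have h3 := h.smooth (pair x y') (pair x y)
  rw [pair_sub_pair, sub_self, norm_pair_zero_left] at h3
  have h4 := norm_bestResponse_sub_le h (x + w) x
  rw [add_sub_cancel_left] at h4
  have h5 : inner ℝ (∇ (globalObj f) (pair x y')).fst w ≤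
      inner ℝ (∇ (globalObj f) (pair x y)).fst w + L * (L / μ) * ‖w‖ ^ 2 := by
    have e : inner ℝ (∇ (globalObj f) (pair x y')).fst w -
        inner ℝ (∇ (globalObj f) (pair x y)).fst w =
        inner ℝ (∇ (globalObj f) (pair x y') - ∇ (globalObj f) (pair x y)).fst w := by
      rw [WithLp.sub_fst, inner_sub_left]
    have h6 := real_inner_le_norm
      (∇ (globalObj f) (pair x y') - ∇ (globalObj f) (pair x y)).fst w
    have h7 : ‖(∇ (globalObj f) (pair x y') - ∇ (globalObj f) (pair x y)).fst‖ ≤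
        L * (L / μ * ‖w‖) :=
      (norm_fst_le _).trans (h3.trans (mul_le_mul_of_nonneg_left h4 h.L_pos.le))
    have h8 := mul_le_mul_of_nonneg_right h7 (norm_nonneg w)
    nlinarith
  change globalObj f (pair x y') ≤ globalObj f (pair x y) at h2
  linarith

/-- Keeping `y*(x)` fixed already gives the bound with `L/2`; the larger constant matches
`primal_upper`. -/
lemma primal_lower (x w : EuclideanSpace ℝ (Fin d)) :
    primal f x + inner ℝ (∇ (globalObj f) (pair x (bestResponse f x))).fst w -
        (L * (L / μ) + L / 2) * ‖w‖ ^ 2 ≤ primal f (x + w) := by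
  rw [primal_eq h, primal_eq h]
  have h1 := h.lower_left x w (bestResponse f x)
  have h2 := globalObj_le_bestResponse h (x + w) (bestResponse f x)
  have hL := h.L_pos
  have hμ := h.mu_pos
  have h3 : 0 ≤ L * (L / μ) * ‖w‖ ^ 2 := by positivity
  linarith

lemma hasGradientAt_primal (x : EuclideanSpace ℝ (Fin d)) :
    HasGradientAt (primal f) (∇ (globalObj f) (pair x (bestResponse f x))).fst x :=
  hasGradientAt_of_quadratic_bounds (primal_upper h x) (primal_lower h x)

lemma differentiable_primal : Differentiable ℝ (primal f) := fun x =>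
  (hasGradientAt_primal h x).differentiableAt

lemma gradient_primal (x : EuclideanSpace ℝ (Fin d)) :
    ∇ (primal f) x = (∇ (globalObj f) (pair x (bestResponse f x))).fst :=
  (hasGradientAt_primal h x).gradient

/-- Serves the square integrability of `∇Φ(x̄)`; the descent rests on `primal_upper`. -/
lemma norm_gradient_primal_sub_le (x x' : EuclideanSpace ℝ (Fin d)) :
    ‖∇ (primal f) x - ∇ (primal f) x'‖ ≤ L * (1 + L / μ) * ‖x - x'‖ := by
  rw [gradient_primal h, gradient_primal h, ← WithLp.sub_fst]
  refine (norm_fst_le _).trans ((h.smooth _ _).trans ?_)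
  rw [mul_assoc]
  refine mul_le_mul_of_nonneg_left ?_ h.L_pos.le
  have e : pair x (bestResponse f x) - pair x' (bestResponse f x') =
      pair (x - x') 0 + pair 0 (bestResponse f x - bestResponse f x') := by
    rw [pair_sub_pair, pair_add_pair, add_zero, zero_add]
  rw [e]
  refine (norm_add_le _ _).trans ?_
  rw [norm_pair_zero_left, norm_pair_zero_right]
  linarith [norm_bestResponse_sub_le h x x']

lemma norm_gradient_primal_sub_sq_le (x : EuclideanSpace ℝ (Fin d))
    (y : EuclideanSpace ℝ (Fin m)) (u : Pt d m) :
    ‖∇ (primal f) x - u.fst‖ ^ 2 ≤ 2 * (L ^ 2 * ‖bestResponse f x - y‖ ^ 2) +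
      2 * ‖u - ∇ (globalObj f) (pair x y)‖ ^ 2 := by
  rw [gradient_primal h]
  have h1 := h.smooth (pair x (bestResponse f x)) (pair x y)
  rw [pair_sub_pair, sub_self, norm_pair_zero_left] at h1
  set G := ∇ (globalObj f) (pair x (bestResponse f x))
  set g := ∇ (globalObj f) (pair x y)
  have h2 : ‖(G - g).fst‖ ^ 2 ≤ L ^ 2 * ‖bestResponse f x - y‖ ^ 2 := by
    rw [← mul_pow]
    exact pow_le_pow_left₀ (norm_nonneg _) ((norm_fst_le _).trans h1) 2
  have h3 : ‖(g - u).fst‖ ^ 2 ≤ ‖u - g‖ ^ 2 := by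
    rw [norm_sub_rev u g]
    exact pow_le_pow_left₀ (norm_nonneg _) (norm_fst_le _) 2
  have e : G.fst - u.fst = (G - g).fst + (g - u).fst := by
    rw [WithLp.sub_fst, WithLp.sub_fst]; abel
  rw [e]
  have := norm_add_sq_le_young (G - g).fst (g - u).fst one_pos
  rw [inv_one] at this
  linarith

/-- Polarisation of `⟨∇Φ, u_x⟩` yields both negative squares. The quadratic remainder uses up half
of that of `u_x`; the other half is kept to absorb later terms. -/
lemma primal_descent {ηx : ℝ} (hη : 0 < ηx) (hη' : ηx * (L * (L / μ) + L / 2) ≤ 1 / 4)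
    (x : EuclideanSpace ℝ (Fin d)) (y : EuclideanSpace ℝ (Fin m)) (u : Pt d m) :
    primal f (x - ηx • u.fst) ≤ primal f x - ηx / 2 * ‖∇ (primal f) x‖ ^ 2 -
      ηx / 4 * ‖u.fst‖ ^ 2 + ηx * (L ^ 2 * ‖bestResponse f x - y‖ ^ 2 +
        ‖u - ∇ (globalObj f) (pair x y)‖ ^ 2) := by
  have h1 := primal_upper h x (-(ηx • u.fst))
  have h2 := norm_gradient_primal_sub_sq_le h x y u
  rw [← gradient_primal h, ← sub_eq_add_neg, inner_neg_right, inner_smul_right, norm_neg,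
    norm_smul, mul_pow, Real.norm_eq_abs, sq_abs] at h1
  rw [norm_sub_sq_real] at h2
  have h3 : (L * (L / μ) + L / 2) * (ηx ^ 2 * ‖u.fst‖ ^ 2) ≤ ηx / 4 * ‖u.fst‖ ^ 2 := by
    have := mul_le_mul_of_nonneg_right hη' (by positivity : 0 ≤ ηx * ‖u.fst‖ ^ 2)
    linarith
  have h4 := mul_le_mul_of_nonneg_left h2 (by positivity : 0 ≤ ηx / 2)
  linarith

/-- One step of inexact gradient ascent in `y` contracts the distance to the best response,
up to the gradient error and the drift of the best response. -/
lemma dual_contraction (hμL : μ ≤ L) {η : ℝ} (hη : 0 < η) (hη' : η * L ≤ 1 / 8)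
    (x x' : EuclideanSpace ℝ (Fin d)) (y : EuclideanSpace ℝ (Fin m)) (u : Pt d m) :
    ‖bestResponse f x' - (y + η • u.snd)‖ ^ 2 ≤
      (1 - η * μ / 4) * ‖bestResponse f x - y‖ ^ 2 -
        η / (2 * L) * ‖(∇ (globalObj f) (pair x y)).snd‖ ^ 2 +
        5 * η / μ * ‖u - ∇ (globalObj f) (pair x y)‖ ^ 2 +
        5 * (L / μ) ^ 2 / (η * μ) * ‖x' - x‖ ^ 2 := by
  have hL := h.L_pos
  have hμ := h.mu_pos
  have h1 := h.inner_gradient_sub_le (globalObj_le_bestResponse h x) y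
  have h2 := norm_bestResponse_sub_le h x' x
  set ys := bestResponse f x
  set ys' := bestResponse f x'
  set g := (∇ (globalObj f) (pair x y)).snd
  set n := (u - ∇ (globalObj f) (pair x y)).snd with hn
  have hun : u.snd = g + n := by rw [hn, WithLp.sub_snd]; abel
  have hne : ‖n‖ ^ 2 ≤ ‖u - ∇ (globalObj f) (pair x y)‖ ^ 2 :=
    pow_le_pow_left₀ (norm_nonneg _) (norm_snd_le _) 2
  set e := ‖u - ∇ (globalObj f) (pair x y)‖ ^ 2
  have hημ : η * μ ≤ 1 / 8 := (mul_le_mul_of_nonneg_left hμL hη.le).trans hη'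
  -- The ascent step with the best response frozen at `x`. The inner product with `g` supplies the
  -- contraction and `-(η/L) ‖g‖²`, of which a quarter pays for the second-order term.
  have hp : ‖ys - y - η • u.snd‖ ^ 2 ≤
      (1 - η * μ / 2) * ‖ys - y‖ ^ 2 - 3 * η / (4 * L) * ‖g‖ ^ 2 + 9 * η / (4 * μ) * e := by
    have a1 : ‖ys - y - η • u.snd‖ ^ 2 =
        ‖ys - y‖ ^ 2 - 2 * η * inner ℝ g (ys - y) - 2 * η * inner ℝ n (ys - y) +
          η ^ 2 * ‖u.snd‖ ^ 2 := by
      rw [norm_sub_sq_real, inner_smul_right, norm_smul, mul_pow, Real.norm_eq_abs, sq_abs,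
        real_inner_comm, hun, inner_add_left]
      ring
    have a2 : ‖u.snd‖ ^ 2 ≤ 2 * ‖g‖ ^ 2 + 2 * ‖n‖ ^ 2 := by
      rw [hun]
      have := norm_add_sq_le_young g n one_pos
      norm_num at this
      linarith
    have a3 : -(2 * inner ℝ n (ys - y)) ≤ μ / 2 * ‖ys - y‖ ^ 2 + 2 / μ * ‖n‖ ^ 2 := by
      have b1 := neg_le_of_abs_le (abs_real_inner_le_norm n (ys - y))
      have b2 : 0 ≤ 2 / μ * (‖n‖ - μ / 2 * ‖ys - y‖) ^ 2 := by positivity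
      have b3 : 2 / μ * (‖n‖ - μ / 2 * ‖ys - y‖) ^ 2 =
          2 / μ * ‖n‖ ^ 2 + μ / 2 * ‖ys - y‖ ^ 2 - 2 * (‖n‖ * ‖ys - y‖) := by
        field_simp; ring
      linarith
    have a4 : 2 * η ^ 2 ≤ η / (4 * L) := by
      rw [le_div_iff₀ (by positivity)]
      nlinarith
    have a5 : 2 * η ^ 2 ≤ η / (4 * μ) := by
      rw [le_div_iff₀ (by positivity)]
      nlinarith
    have c1 := mul_le_mul_of_nonneg_left h1 (by positivity : 0 ≤ 2 * η)
    have c2 := mul_le_mul_of_nonneg_left a2 (by positivity : 0 ≤ η ^ 2)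
    have c3 := mul_le_mul_of_nonneg_left a3 hη.le
    have c4 := mul_le_mul_of_nonneg_right a4 (by positivity : 0 ≤ ‖g‖ ^ 2)
    have c5 := mul_le_mul_of_nonneg_right a5 (by positivity : 0 ≤ ‖n‖ ^ 2)
    have c6 := mul_le_mul_of_nonneg_left hne (by positivity : 0 ≤ 9 * η / (4 * μ))
    have d1 : 2 * η * (‖g‖ ^ 2 / (2 * L) + μ / 2 * ‖ys - y‖ ^ 2) =
        4 * (η / (4 * L) * ‖g‖ ^ 2) + η * μ * ‖ys - y‖ ^ 2 := by
      field_simp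
    have d2 : η * (μ / 2 * ‖ys - y‖ ^ 2 + 2 / μ * ‖n‖ ^ 2) =
        η * μ / 2 * ‖ys - y‖ ^ 2 + 8 * (η / (4 * μ) * ‖n‖ ^ 2) := by
      field_simp; ring
    have d3 : 9 * η / (4 * μ) * ‖n‖ ^ 2 = 9 * (η / (4 * μ) * ‖n‖ ^ 2) := by ring
    have d4 : 3 * η / (4 * L) * ‖g‖ ^ 2 = 3 * (η / (4 * L) * ‖g‖ ^ 2) := by ring
    rw [d1] at c1
    rw [d2] at c3
    rw [d3] at c6
    rw [a1, d4]
    linarith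
  -- Moving the best response from `x` to `x'` by Young with this parameter spends half of the
  -- contraction `1 - η μ / 2`.
  have hβ : 0 < η * μ / 4 := by positivity
  have hy := norm_add_sq_le_young (ys - y - η • u.snd) (ys' - ys) hβ
  have e1 : ys - y - η • u.snd + (ys' - ys) = ys' - (y + η • u.snd) := by abel
  rw [e1] at hy
  have hdr : (1 + (η * μ / 4)⁻¹) * ‖ys' - ys‖ ^ 2 ≤
      5 * (L / μ) ^ 2 / (η * μ) * ‖x' - x‖ ^ 2 := by
    have i1 : 1 + (η * μ / 4)⁻¹ ≤ 5 / (η * μ) := by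
      rw [inv_div, le_div_iff₀ (by positivity), add_mul, div_mul_cancel₀ _ (by positivity)]
      linarith
    have i2 : ‖ys' - ys‖ ^ 2 ≤ (L / μ) ^ 2 * ‖x' - x‖ ^ 2 := by
      rw [← mul_pow]
      exact pow_le_pow_left₀ (norm_nonneg _) h2 2
    calc _ ≤ 5 / (η * μ) * ((L / μ) ^ 2 * ‖x' - x‖ ^ 2) := by gcongr
      _ = _ := by ring
  have hmain := mul_le_mul_of_nonneg_left hp (by positivity : 0 ≤ 1 + η * μ / 4)
  have he0 : 0 ≤ η / μ * e := by positivity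
  have hg0 : 0 ≤ η / L * ‖g‖ ^ 2 := by positivity
  have m1 : (1 + η * μ / 4) * ((1 - η * μ / 2) * ‖ys - y‖ ^ 2 - 3 * η / (4 * L) * ‖g‖ ^ 2 +
      9 * η / (4 * μ) * e) = (1 + η * μ / 4) * (1 - η * μ / 2) * ‖ys - y‖ ^ 2 -
        (1 + η * μ / 4) * (3 / 4) * (η / L * ‖g‖ ^ 2) +
          (1 + η * μ / 4) * (9 / 4) * (η / μ * e) := by
    field_simp
  have m2 : (1 + η * μ / 4) * (1 - η * μ / 2) * ‖ys - y‖ ^ 2 ≤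
      (1 - η * μ / 4) * ‖ys - y‖ ^ 2 := by
    refine mul_le_mul_of_nonneg_right ?_ (by positivity)
    nlinarith [sq_nonneg (η * μ)]
  have m3 : 1 / 2 * (η / L * ‖g‖ ^ 2) ≤ (1 + η * μ / 4) * (3 / 4) * (η / L * ‖g‖ ^ 2) := by
    refine mul_le_mul_of_nonneg_right ?_ hg0
    nlinarith
  have m4 : (1 + η * μ / 4) * (9 / 4) * (η / μ * e) ≤ 5 * (η / μ * e) := by
    refine mul_le_mul_of_nonneg_right ?_ he0
    linarith
  have m5 : η / (2 * L) * ‖g‖ ^ 2 = 1 / 2 * (η / L * ‖g‖ ^ 2) := by field_simp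
  have m6 : 5 * η / μ * e = 5 * (η / μ * e) := by ring
  rw [m1] at hmain
  rw [m5, m6]
  linarith

end Objective

/-! ### Summation of scalar recursions -/

section Recursions

/-- Summation of a linear recursion with contraction factor `1 - θ`. -/
lemma mul_sum_le_of_contraction {a c : ℕ → ℝ} {θ : ℝ} (hθ : θ ≤ 1) (ha : ∀ t, 0 ≤ a t)
    (h : ∀ t, a (t + 1) ≤ (1 - θ) * a t + c t) (T : ℕ) :
    θ * ∑ t ∈ Finset.range (T + 1), a t ≤ a 0 + ∑ t ∈ Finset.range T, c t := by
  have h1 := Finset.sum_le_sum (s := Finset.range T) fun t _ => h t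
  rw [Finset.sum_add_distrib, ← Finset.mul_sum] at h1
  have h2 := Finset.sum_range_succ' a T
  have h3 := Finset.sum_range_succ a T
  have h4 := mul_nonneg (sub_nonneg.2 hθ) (ha T)
  rw [h3] at h2
  rw [h3]
  linarith

lemma sum_add_sum_le_of_descent {a b c : ℕ → ℝ} (h : ∀ t, a (t + 1) + b t ≤ a t + c t) (T : ℕ) :
    a T + ∑ t ∈ Finset.range T, b t ≤ a 0 + ∑ t ∈ Finset.range T, c t := by
  induction T with
  | zero => simp
  | succ T ih =>
    rw [Finset.sum_range_succ, Finset.sum_range_succ]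
    linarith [h T]

/-- The excess `w T - a` persists until the next reset, so the potential charges it once for each
later term before that reset. An increment is thus counted at most `q` times. The reset takes place
in the step after a multiple of `q`, whence the value `0` if `T % q = 0`. -/
lemma sum_le_of_restart_aux {w z : ℕ → ℝ} {a β : ℝ} {q : ℕ} (hq : 1 ≤ q) (hβ : 0 ≤ β)
    (hz : ∀ t, 0 ≤ z t) (hw : ∀ t, a ≤ w t) (h0 : w 0 ≤ a)
    (hr : ∀ t, t % q = 0 → w (t + 1) ≤ a)
    (hn : ∀ t, t % q ≠ 0 → w (t + 1) ≤ w t + β * z t) (T : ℕ) :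
    ∑ t ∈ Finset.range (T + 1), w t + (if T % q = 0 then 0 else (q : ℝ) - (T % q : ℕ)) * (w T - a) ≤
      (T + 1) * a + q * β * ∑ t ∈ Finset.range T, z t := by
  induction T with
  | zero => simpa using h0
  | succ T ih =>
    rw [Finset.sum_range_succ, Finset.sum_range_succ (f := z)]
    have hlt := Nat.mod_lt T hq
    have hq' : (1 : ℝ) ≤ q := by exact_mod_cast hq
    have hzT := mul_nonneg hβ (hz T)
    by_cases hT : T % q = 0
    · have h1 := hr T hT
      have h2 : w (T + 1) - a = 0 := by linarith [hw (T + 1)]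
      rw [if_pos hT] at ih
      rw [h2, mul_zero]
      have h3 : 0 ≤ q * (β * z T) := by positivity
      push_cast
      linarith
    · have h1 := hn T hT
      rw [if_neg hT] at ih
      have hle : (T % q : ℕ) + (1 : ℝ) ≤ q := by exact_mod_cast hlt
      -- The number of remaining terms drops by one, also at the end of a period, where both sides
      -- are `0`.
      have hc : (if (T + 1) % q = 0 then (0 : ℝ) else (q : ℝ) - ((T + 1) % q : ℕ)) =
          q - (T % q : ℕ) - 1 := by
        by_cases hs : T % q + 1 = q
        · have : (T + 1) % q = 0 := by
            rw [← Nat.mod_add_mod, hs, Nat.mod_self]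
          rw [if_pos this]
          have : ((T % q : ℕ) : ℝ) + 1 = q := by exact_mod_cast hs
          linarith
        · have : (T + 1) % q = T % q + 1 := by
            rw [← Nat.mod_add_mod, Nat.mod_eq_of_lt (by omega)]
          rw [this, if_neg (by omega)]
          push_cast
          ring
      rw [hc]
      have h4 : (q - (T % q : ℕ)) * (w (T + 1) - a) ≤
          ((q : ℝ) - (T % q : ℕ)) * (w T - a + β * z T) :=
        mul_le_mul_of_nonneg_left (by linarith) (by linarith)
      have h5 : ((T % q : ℕ) : ℝ) * (β * z T) ≥ 0 := by positivity
      push_cast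
      nlinarith

/-- Total variance of a recursive estimator that is restarted every `q` steps. -/
lemma sum_le_of_restart {w z : ℕ → ℝ} {a β : ℝ} {q : ℕ} (hq : 1 ≤ q) (hβ : 0 ≤ β)
    (hz : ∀ t, 0 ≤ z t) (h0 : w 0 ≤ a) (hr : ∀ t, t % q = 0 → w (t + 1) ≤ a)
    (hn : ∀ t, t % q ≠ 0 → w (t + 1) ≤ w t + β * z t) (T : ℕ) :
    ∑ t ∈ Finset.range (T + 1), w t ≤ (T + 1) * a + q * β * ∑ t ∈ Finset.range T, z t := by
  -- Truncation from below by `a` makes the potential nonnegative, so it can be dropped at the end.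
  have h := sum_le_of_restart_aux (w := fun t => max (w t) a) hq hβ hz (fun t => le_max_right _ _)
    (max_le h0 le_rfl) (fun t ht => max_le (hr t ht) le_rfl)
    (fun t ht => max_le ((hn t ht).trans (by gcongr; exact le_max_left _ _))
      (le_add_of_le_of_nonneg (le_max_right _ _) (mul_nonneg hβ (hz t)))) T
  have h1 : ∑ t ∈ Finset.range (T + 1), w t ≤ ∑ t ∈ Finset.range (T + 1), max (w t) a :=
    Finset.sum_le_sum fun t _ => le_max_left _ _
  have hlt := Nat.mod_lt T hq
  have h2 : 0 ≤ (if T % q = 0 then 0 else (q : ℝ) - (T % q : ℕ)) * (max (w T) a - a) := by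
    refine mul_nonneg ?_ (sub_nonneg.2 (le_max_right _ _))
    split_ifs
    · exact le_rfl
    · exact sub_nonneg.2 (by exact_mod_cast hlt.le)
  linarith

end Recursions

/-! ### Summed bounds along a path -/

section Pathwise

variable {L μ κ η ηx : ℝ}

/-- Summed form of the contraction of `δ_t = ‖y*(x̄^t) - ȳ^t‖²`. -/
lemma dual_sum_bounds {δ gy e vx : ℕ → ℝ} (hL : 0 < L) (hμ : 0 < μ) (hκ : κ = L / μ)
    (hκ1 : 1 ≤ κ) (hη : 0 < η) (hηx : 0 < ηx) (hηx' : ηx ≤ 1 / 20 * (η / κ ^ 2))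
    (hδ : ∀ t, 0 ≤ δ t) (hgy : ∀ t, 0 ≤ gy t) (hvx : ∀ t, 0 ≤ vx t)
    (h : ∀ t, δ (t + 1) ≤ (1 - η * μ / 4) * δ t - η / (2 * L) * gy t + 5 * η / μ * e t +
      5 * κ ^ 2 / (η * μ) * (ηx ^ 2 * vx t)) (T : ℕ) :
    L ^ 2 * ∑ t ∈ Finset.range T, δ t ≤ 4 * (L * κ * δ 0 / η) +
        20 * κ ^ 2 * ∑ t ∈ Finset.range T, e t + 1 / 20 * ∑ t ∈ Finset.range T, vx t ∧
    ∑ t ∈ Finset.range T, gy t ≤ 2 * (L * δ 0 / η) + 10 * κ * ∑ t ∈ Finset.range T, e t +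
      1 / 40 / κ * ∑ t ∈ Finset.range T, vx t := by
  have hs := sum_add_sum_le_of_descent (a := δ)
    (b := fun t => η * μ / 4 * δ t + η / (2 * L) * gy t)
    (c := fun t => 5 * η / μ * e t + 5 * κ ^ 2 / (η * μ) * (ηx ^ 2 * vx t))
    (fun t => by linarith [h t]) T
  simp only [Finset.sum_add_distrib, ← Finset.mul_sum] at hs
  have d0 : 0 ≤ ∑ t ∈ Finset.range T, δ t := Finset.sum_nonneg fun t _ => hδ t
  have g0 : 0 ≤ ∑ t ∈ Finset.range T, gy t := Finset.sum_nonneg fun t _ => hgy t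
  have v0 : 0 ≤ ∑ t ∈ Finset.range T, vx t := Finset.sum_nonneg fun t _ => hvx t
  have dT := hδ T
  set sδ := ∑ t ∈ Finset.range T, δ t
  set sg := ∑ t ∈ Finset.range T, gy t
  set se := ∑ t ∈ Finset.range T, e t
  set sv := ∑ t ∈ Finset.range T, vx t
  have hLκ : L = κ * μ := by rw [hκ]; field_simp
  have hκ0 : 0 < κ := by linarith
  -- The ratio `ηx / η ≤ 1 / (20 κ²)` makes the drift so small that `L² ∑ δ` receives only `1/20 ∑
  -- vx`.
  have hx2 : ηx ^ 2 ≤ 1 / 400 * (η ^ 2 / κ ^ 4) := by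
    have := pow_le_pow_left₀ hηx.le hηx' 2
    calc _ ≤ _ := this
      _ = _ := by field_simp; norm_num
  have hv2 : 5 * κ ^ 2 / (η * μ) * (ηx ^ 2 * sv) ≤ 1 / 80 * (η / (μ * κ ^ 2)) * sv := by
    calc _ ≤ 5 * κ ^ 2 / (η * μ) * (1 / 400 * (η ^ 2 / κ ^ 4) * sv) := by gcongr
      _ = _ := by field_simp; ring
  have b1 : η * μ / 4 * sδ ≤ δ 0 + (5 * η / μ * se + 1 / 80 * (η / (μ * κ ^ 2)) * sv) := by
    have : 0 ≤ η / (2 * L) * sg := by positivity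
    linarith
  have b2 : η / (2 * L) * sg ≤ δ 0 + (5 * η / μ * se + 1 / 80 * (η / (μ * κ ^ 2)) * sv) := by
    have : 0 ≤ η * μ / 4 * sδ := by positivity
    linarith
  constructor
  · have := mul_le_mul_of_nonneg_left b1 (by positivity : 0 ≤ 4 * L ^ 2 / (η * μ))
    have e1 : 4 * L ^ 2 / (η * μ) * (η * μ / 4 * sδ) = L ^ 2 * sδ := by field_simp
    have e2 : 4 * L ^ 2 / (η * μ) * (δ 0 + (5 * η / μ * se + 1 / 80 * (η / (μ * κ ^ 2)) * sv)) =
        4 * (L * κ * δ 0 / η) + 20 * κ ^ 2 * se + 1 / 20 * sv := by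
      rw [hLκ]; field_simp; ring
    rwa [e1, e2] at this
  · have := mul_le_mul_of_nonneg_left b2 (by positivity : 0 ≤ 2 * L / η)
    have e1 : 2 * L / η * (η / (2 * L) * sg) = sg := by field_simp
    have e2 : 2 * L / η * (δ 0 + (5 * η / μ * se + 1 / 80 * (η / (μ * κ ^ 2)) * sv)) =
        2 * (L * δ 0 / η) + 10 * κ * se + 1 / 40 / κ * sv := by
      rw [hLκ]; field_simp; ring
    rwa [e1, e2] at this

/-- Of the `1/4 ∑ vx` in the descent, the drift in `L² ∑ δ` takes `1/20`; doubling the remaining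
`1/5` gives `2/5`. The error coefficient is `2 (20 κ² + 1) ≤ 42 κ²`. -/
lemma primal_sum_bound {φ gp δ e vx : ℕ → ℝ} (hκ1 : 1 ≤ κ)
    (hηx : 0 < ηx) {Δ D : ℝ} (he : ∀ t, 0 ≤ e t) (hvx : ∀ t, 0 ≤ vx t)
    (h : ∀ t, φ (t + 1) ≤ φ t - ηx / 2 * gp t - ηx / 4 * vx t + ηx * (L ^ 2 * δ t + e t))
    (hφ : ∀ t, φ 0 - φ t ≤ Δ) (T : ℕ)
    (hδ : L ^ 2 * ∑ t ∈ Finset.range T, δ t ≤ 4 * D +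
        20 * κ ^ 2 * ∑ t ∈ Finset.range T, e t + 1 / 20 * ∑ t ∈ Finset.range T, vx t) :
    ∑ t ∈ Finset.range T, gp t + 2 / 5 * ∑ t ∈ Finset.range T, vx t ≤
      2 * (Δ / ηx) + 8 * D + 42 * κ ^ 2 * ∑ t ∈ Finset.range T, e t := by
  have hs := sum_add_sum_le_of_descent (a := φ)
    (b := fun t => ηx / 2 * gp t + ηx / 4 * vx t)
    (c := fun t => ηx * L ^ 2 * δ t + ηx * e t) (fun t => by linarith [h t]) T
  simp only [Finset.sum_add_distrib, ← Finset.mul_sum] at hs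
  have e0 : 0 ≤ ∑ t ∈ Finset.range T, e t := Finset.sum_nonneg fun t _ => he t
  have v0 : 0 ≤ ∑ t ∈ Finset.range T, vx t := Finset.sum_nonneg fun t _ => hvx t
  have hT := hφ T
  set sδ := ∑ t ∈ Finset.range T, δ t
  set sg := ∑ t ∈ Finset.range T, gp t
  set se := ∑ t ∈ Finset.range T, e t
  set sv := ∑ t ∈ Finset.range T, vx t
  have h1 : ηx * (sg / 2 + sv / 4) ≤ ηx * (Δ / ηx + L ^ 2 * sδ + se) := by
    have : ηx * (Δ / ηx) = Δ := by field_simp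
    nlinarith
  have h2 := le_of_mul_le_mul_left h1 hηx
  have h3 : se ≤ κ ^ 2 * se := le_mul_of_one_le_left e0 (by nlinarith)
  linarith

end Pathwise

/-! ### Closing the loop between consensus, variance and gradient errors -/

section Expected

/-- Bound on the expected sum `se` of the gradient errors. Here `sz`, `sd`, `sV`, `sr`, `szd` are
the expected sums of the consensus errors of the iterates and the trackers, of the increments of
the estimates, of the variances and of the increments of the iterates, and `Q` is the weighted sum
of the squared average directions. -/
lemma error_sum_le_of_consensus {L η θ m Λ N Q cz cd sz sd sV sr szd se : ℝ}
    (hL : 0 < L) (hη : 0 < η) (hθ : 0 < θ) (hθ1 : θ ≤ 1) (hηθ : η * L ≤ 1 / 100 * θ ^ 2)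
    (hm : 0 < m) (hN : 0 ≤ N) (hΛ : 0 ≤ Λ) (hcz : cz ≤ Λ) (hcd : cd ≤ L ^ 2 * Λ)
    (hQ0 : 0 ≤ Q) (hszd0 : 0 ≤ szd)
    (hsz : θ * sz ≤ cz + 2 * η ^ 2 / θ * sd) (hsd : θ * sd ≤ cd + 2 / θ * sV)
    (hsV : sV ≤ 6 * sr + 3 * L ^ 2 * szd) (hsr : sr ≤ m * N + L ^ 2 * szd)
    (hszd : szd ≤ 4 * sz + m * Q) (hse : se ≤ 2 / m * (sr + L ^ 2 * sz)) :
    se ≤ 12 * N + 20 * (L ^ 2 * Λ / (θ * m)) + 12 * (L ^ 2 * Q) := by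
  have hηL0 : 0 < η * L := by positivity
  obtain ⟨B, hB⟩ : ∃ B, B = 6 * (m * N) + 9 * L ^ 2 * szd := ⟨_, rfl⟩
  have hsVB : sV ≤ B := by linarith
  have hB0 : 0 ≤ B := by rw [hB]; positivity
  have a1 : sd ≤ L ^ 2 * Λ / θ + 2 / θ ^ 2 * B := by
    have h1 : θ * sd ≤ θ * (L ^ 2 * Λ / θ + 2 / θ ^ 2 * B) := by
      have e : θ * (L ^ 2 * Λ / θ + 2 / θ ^ 2 * B) = L ^ 2 * Λ + 2 / θ * B := by field_simp
      rw [e]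
      have := mul_le_mul_of_nonneg_left hsVB (by positivity : 0 ≤ 2 / θ)
      linarith
    exact le_of_mul_le_mul_left h1 hθ
  have a2 : θ * sz ≤ Λ + 2 * η ^ 2 / θ * (L ^ 2 * Λ / θ + 2 / θ ^ 2 * B) := by
    have := mul_le_mul_of_nonneg_left a1 (by positivity : 0 ≤ 2 * η ^ 2 / θ)
    linarith
  -- The increments reach `sz` through two contractions, each contributing `θ⁻²`. The condition `η L
  -- ≤ θ² / 100` makes the total factor at most `10⁻⁴`.
  have a3 : L ^ 2 * sz ≤ L ^ 2 * Λ / θ + 2 * (((η * L) ^ 2 / θ ^ 2) * (L ^ 2 * Λ / θ)) +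
      4 * (((η * L) ^ 2 / θ ^ 4) * B) := by
    have := mul_le_mul_of_nonneg_left a2 (by positivity : 0 ≤ L ^ 2 / θ)
    have e1 : L ^ 2 / θ * (θ * sz) = L ^ 2 * sz := by field_simp
    rw [e1] at this
    refine this.trans (le_of_eq ?_)
    field_simp
    ring
  have hηθ2 : (η * L) ^ 2 ≤ 1 / 10000 * θ ^ 4 := by
    calc _ ≤ (1 / 100 * θ ^ 2) ^ 2 := pow_le_pow_left₀ hηL0.le hηθ 2
      _ = _ := by ring
  have b1 : (η * L) ^ 2 / θ ^ 4 ≤ 1 / 10000 := by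
    rwa [div_le_iff₀ (by positivity)]
  have b2 : (η * L) ^ 2 / θ ^ 2 ≤ 1 / 10000 := by
    rw [div_le_iff₀ (by positivity)]
    have : θ ^ 4 ≤ θ ^ 2 := pow_le_pow_of_le_one hθ.le hθ1 (by norm_num)
    linarith
  have hLΛ : 0 ≤ L ^ 2 * Λ / θ := by positivity
  have c1 := mul_le_mul_of_nonneg_right b2 hLΛ
  have c2 := mul_le_mul_of_nonneg_right b1 hB0
  have c3 := mul_le_mul_of_nonneg_left hszd (by positivity : 0 ≤ L ^ 2)
  have hmN : 0 ≤ m * N := by positivity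
  have hmQ : 0 ≤ L ^ 2 * (m * Q) := by positivity
  -- Since `szd ≤ 4 sz + m Q`, the right side of `a3` contains `sz` again, with coefficient `4 · 36
  -- · 10⁻⁴` in front of `L² sz`, which is absorbed on the left.
  have hsz1 : L ^ 2 * sz ≤ 2 * (L ^ 2 * Λ / θ) + m * N + L ^ 2 * (m * Q) := by
    clear hηθ hηθ2 b1 b2 a1 a2 hsz hsd
    linarith
  have h1 : sr + L ^ 2 * sz ≤ 6 * (m * N) + 10 * (L ^ 2 * Λ / θ) + 6 * (L ^ 2 * (m * Q)) := by
    clear hηθ hηθ2 b1 b2 a1 a2 hsz hsd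
    linarith
  have h2 := mul_le_mul_of_nonneg_left h1 (by positivity : 0 ≤ 2 / m)
  refine (hse.trans h2).trans (le_of_eq ?_)
  field_simp
  ring

/-- The errors drive `∇_y f`, hence the motion of the average, hence the errors again, with gain of
order `κ (η L)²`. After absorption and multiplication by `42 κ²`, the remaining `svx` and `δ₀` terms
carry `κ² (η L)² ≤ 10⁻⁴`. -/
lemma error_sum_bound {L κ η ηx lam N se svx svy sgy δ₀ : ℝ}
    (hL : 0 < L) (hκ1 : 1 ≤ κ) (hη : 0 < η) (hηx : 0 < ηx) (hηx' : ηx ≤ 1 / 20 * (η / κ ^ 2))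
    (hηκ : η * L ≤ 1 / 100 / κ) (hN : 0 ≤ N) (hδ₀ : 0 ≤ δ₀)
    (hse0 : 0 ≤ se) (hsvx0 : 0 ≤ svx)
    (hse : se ≤ 12 * N + 20 * lam + 12 * (L ^ 2 * (ηx ^ 2 * svx + η ^ 2 * svy)))
    (hsvy : svy ≤ 2 * sgy + 2 * se)
    (hsgy : sgy ≤ 2 * (L * δ₀ / η) + 10 * κ * se + 1 / 40 / κ * svx) :
    42 * κ ^ 2 * se ≤ 588 * (κ ^ 2 * N) + 924 * (κ ^ 2 * lam) +
      L * κ * δ₀ / η + 2 / 5 * svx := by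
  have hκ0 : 0 < κ := by linarith
  have hηL0 : 0 < η * L := by positivity
  obtain ⟨s, hs⟩ : ∃ s, s = (η * L) ^ 2 := ⟨_, rfl⟩
  obtain ⟨D, hD⟩ : ∃ D, D = L * δ₀ / η := ⟨_, rfl⟩
  have hs0 : 0 ≤ s := by rw [hs]; positivity
  have hD0 : 0 ≤ D := by rw [hD]; positivity
  have f1 : κ ^ 2 * s ≤ 1 / 10000 := by
    have h1 := pow_le_pow_left₀ hηL0.le hηκ 2
    have h2 := mul_le_mul_of_nonneg_left h1 (by positivity : 0 ≤ κ ^ 2)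
    rw [hs]
    refine h2.trans (le_of_eq ?_)
    field_simp
    norm_num
  have f2 : κ * s ≤ 1 / 10000 :=
    (mul_le_mul_of_nonneg_right (by nlinarith) hs0).trans f1
  have f3 : s ≤ 1 / 10000 := (le_mul_of_one_le_left hs0 hκ1).trans f2
  have hηx2 : L ^ 2 * ηx ^ 2 ≤ 1 / 400 * s := by
    have h1 : ηx ≤ 1 / 20 * η := by
      refine hηx'.trans ?_
      have : η / κ ^ 2 ≤ η := div_le_self hη.le (one_le_pow₀ hκ1)
      linarith
    have h2 := pow_le_pow_left₀ hηx.le h1 2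
    have h3 := mul_le_mul_of_nonneg_left h2 (by positivity : 0 ≤ L ^ 2)
    refine h3.trans (le_of_eq ?_)
    rw [hs]
    ring
  have hQ : L ^ 2 * (ηx ^ 2 * svx + η ^ 2 * svy) ≤ s * svx + 4 * (s * D) + 1 / 400 * se := by
    have c1 := mul_le_mul_of_nonneg_right hηx2 hsvx0
    have c2 : svy ≤ 4 * D + 20 * κ * se + 1 / 20 * svx + 2 * se := by
      have : 1 / 40 / κ * svx ≤ 1 / 40 * svx :=
        mul_le_mul_of_nonneg_right (div_le_self (by norm_num) hκ1) hsvx0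
      rw [hD]
      linarith
    have c3 := mul_le_mul_of_nonneg_left c2 hs0
    have e1 : L ^ 2 * (ηx ^ 2 * svx + η ^ 2 * svy) = L ^ 2 * ηx ^ 2 * svx + s * svy := by
      rw [hs]; ring
    have c4 := mul_le_mul_of_nonneg_right f2 hse0
    have c5 := mul_le_mul_of_nonneg_right f3 hse0
    have c6 : 0 ≤ s * svx := by positivity
    rw [e1]
    linarith
  have p2 : 0 ≤ s * svx := by positivity
  have p3 : 0 ≤ s * D := by positivity
  have hse2 : se ≤ 14 * N + 22 * lam + 14 * (s * svx) + 56 * (s * D) := by linarith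
  have hfin := mul_le_mul_of_nonneg_left hse2 (by positivity : 0 ≤ 42 * κ ^ 2)
  have g1 := mul_le_mul_of_nonneg_right f1 hsvx0
  have g2 := mul_le_mul_of_nonneg_right f1 hD0
  have g3 : D ≤ L * κ * δ₀ / η := by
    rw [hD]
    refine div_le_div_of_nonneg_right ?_ hη.le
    have := le_mul_of_one_le_right (mul_nonneg hL.le hδ₀) hκ1
    linarith
  have e1 : 42 * κ ^ 2 * (14 * N + 22 * lam + 14 * (s * svx) + 56 * (s * D)) =
      588 * (κ ^ 2 * N) + 924 * (κ ^ 2 * lam) + 588 * (κ ^ 2 * s * svx) +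
        2352 * (κ ^ 2 * s * D) := by ring
  rw [e1] at hfin
  linarith

end Expected

/-! ### Second moments of conditionally centred sums -/

section Estimation

variable {Ω Ξ E : Type*} [NormedAddCommGroup E]

lemma integrable_norm_sq_of_memLp {_ : MeasurableSpace Ω} {ν : Measure Ω} {u : Ω → E}
    (hu : MemLp u 2 ν) : Integrable (fun ω => ‖u ω‖ ^ 2) ν :=
  (memLp_two_iff_integrable_sq_norm hu.1).1 hu

variable [InnerProductSpace ℝ E]

lemma integrable_inner_of_memLp {_ : MeasurableSpace Ω} {ν : Measure Ω} {u v : Ω → E}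
    (hu : MemLp u 2 ν) (hv : MemLp v 2 ν) : Integrable (fun ω => inner ℝ (u ω) (v ω)) ν := by
  have h1 := (memLp_two_iff_integrable_sq_norm hu.1).1 hu
  have h2 := (memLp_two_iff_integrable_sq_norm hv.1).1 hv
  refine (h1.add h2).mono' (hu.1.inner hv.1) (Filter.Eventually.of_forall fun ω => ?_)
  have := norm_inner_le_norm (𝕜 := ℝ) (u ω) (v ω)
  simp only [Pi.add_apply]
  nlinarith [sq_nonneg (‖u ω‖ - ‖v ω‖), sq_nonneg (‖u ω‖ + ‖v ω‖)]

/-- Transfers mean-squared smoothness to the centred gradient differences. -/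
lemma integral_norm_sub_integral_sq_le [CompleteSpace E] {_ : MeasurableSpace Ω} {ν : Measure Ω}
    [IsProbabilityMeasure ν] {u : Ω → E} (hu : MemLp u 2 ν) :
    ∫ ω, ‖u ω - ∫ ω', u ω' ∂ν‖ ^ 2 ∂ν ≤ ∫ ω, ‖u ω‖ ^ 2 ∂ν := by
  set c := ∫ ω', u ω' ∂ν
  have hi : Integrable u ν := hu.integrable (by norm_num)
  have h1 := integrable_norm_sq_of_memLp hu
  have h2 : Integrable (fun ω => inner ℝ c (u ω)) ν := hi.const_inner c
  have h3 : Integrable (fun ω => ‖u ω‖ ^ 2 - 2 * inner ℝ c (u ω)) ν := h1.sub (h2.const_mul 2)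
  have e : ∀ ω, ‖u ω - c‖ ^ 2 = ‖u ω‖ ^ 2 - 2 * inner ℝ c (u ω) + ‖c‖ ^ 2 := fun ω => by
    rw [norm_sub_sq_real, real_inner_comm]
  simp only [e]
  rw [integral_add h3 (integrable_const _), integral_sub h1 (h2.const_mul 2),
    integral_const_mul, integral_inner hi]
  simp only [integral_const, probReal_univ, smul_eq_mul, one_mul]
  rw [show (∫ ω, u ω ∂ν) = c from rfl, real_inner_self_eq_norm_sq]
  nlinarith [sq_nonneg ‖c‖]

variable [CompleteSpace E] [MeasurableSpace E] [BorelSpace E] [SecondCountableTopology E]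

/-- On a product space, a perturbation that is conditionally centred given the first coordinate
adds its conditional variance to the second moment. -/
lemma integral_norm_add_sq_le_prod {α : Type*} [MeasurableSpace α] [MeasurableSpace Ξ]
    {ν : Measure α} {P : Measure Ξ} [IsProbabilityMeasure ν] [IsProbabilityMeasure P]
    {A : α → E} {h : α → Ξ → E} {c : α → ℝ} (hA : MemLp A 2 ν)
    (hh : Measurable (Function.uncurry h)) (hh2 : ∀ u, MemLp (h u) 2 P)
    (h0 : ∀ u, ∫ s, h u s ∂P = 0) (hc : ∀ u, ∫ s, ‖h u s‖ ^ 2 ∂P ≤ c u) (hci : Integrable c ν) :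
    MemLp (Function.uncurry h) 2 (ν.prod P) ∧
    ∫ p, ‖A p.1 + h p.1 p.2‖ ^ 2 ∂(ν.prod P) ≤ ∫ u, ‖A u‖ ^ 2 ∂ν + ∫ u, c u ∂ν := by
  have hhs : AEStronglyMeasurable (Function.uncurry h) (ν.prod P) := hh.aestronglyMeasurable
  have hsq : StronglyMeasurable (Function.uncurry fun u s => ‖h u s‖ ^ 2) :=
    (hh.norm.pow_const 2).stronglyMeasurable
  -- Square integrability on the product is not assumed; it follows from the integrable conditional
  -- bound `c`.
  have hcond : Integrable (fun u => ∫ s, ‖h u s‖ ^ 2 ∂P) ν := by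
    refine hci.mono' hsq.integral_prod_right.aestronglyMeasurable
      (Filter.Eventually.of_forall fun u => ?_)
    rw [Real.norm_of_nonneg (integral_nonneg fun s => by positivity)]
    exact hc u
  have hint : Integrable (fun p : α × Ξ => ‖Function.uncurry h p‖ ^ 2) (ν.prod P) := by
    rw [integrable_prod_iff (by exact hsq.aestronglyMeasurable)]
    refine ⟨Filter.Eventually.of_forall fun u => integrable_norm_sq_of_memLp (hh2 u), ?_⟩
    simpa using hcond
  have hmem : MemLp (Function.uncurry h) 2 (ν.prod P) :=
    (memLp_two_iff_integrable_sq_norm hhs).2 hint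
  have hA' : MemLp (fun p : α × Ξ => A p.1) 2 (ν.prod P) :=
    hA.comp_measurePreserving measurePreserving_fst
  have hinner := integrable_inner_of_memLp hA' hmem
  have hA2 := integrable_norm_sq_of_memLp hA'
  have hsum : Integrable (fun p : α × Ξ =>
      ‖A p.1‖ ^ 2 + 2 * inner ℝ (A p.1) (Function.uncurry h p)) (ν.prod P) :=
    hA2.add (hinner.const_mul 2)
  refine ⟨hmem, ?_⟩
  have e : ∀ p : α × Ξ, ‖A p.1 + h p.1 p.2‖ ^ 2 =
      ‖A p.1‖ ^ 2 + 2 * inner ℝ (A p.1) (Function.uncurry h p) + ‖Function.uncurry h p‖ ^ 2 :=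
    fun p => norm_add_sq_real _ _
  simp only [e]
  rw [integral_add hsum hint, integral_add hA2 (hinner.const_mul 2),
    integral_const_mul, integral_prod _ hinner, integral_prod _ hint, integral_prod _ hA2]
  -- The cross term vanishes already after integration over the fresh sample.
  have z : ∀ u, ∫ s, inner ℝ (A u) (Function.uncurry h (u, s)) ∂P = 0 := fun u => by
    rw [show (fun s => inner ℝ (A u) (Function.uncurry h (u, s))) = fun s => inner ℝ (A u) (h u s)
      from rfl, integral_inner ((hh2 u).integrable (by norm_num)), h0, inner_zero_right]
  simp only [z, integral_zero, integral_const, probReal_univ, one_smul, mul_zero, add_zero]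
  exact add_le_add le_rfl (integral_mono hcond hci hc)

/-- A sample that is independent of the past, inserted in a conditionally centred function. -/
lemma integral_norm_add_sq_le_of_indep {β : Type*} [MeasurableSpace β] [MeasurableSpace Ξ]
    {𝓖 mΩ : MeasurableSpace Ω} {Pr : Measure Ω} {P : Measure Ξ}
    [IsProbabilityMeasure Pr] (h𝓖 : 𝓖 ≤ mΩ)
    {X : Ω → Ξ} (hX : MeasurePreserving X Pr P)
    (hind : Indep 𝓖 (MeasurableSpace.comap X inferInstance) Pr)
    {A : Ω → E} {z : Ω → β} (hAm : Measurable[𝓖] A) (hzm : Measurable[𝓖] z) (hA : MemLp A 2 Pr)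
    {h : β → Ξ → E} {c : β → ℝ}
    (hh : Measurable (Function.uncurry h)) (hh2 : ∀ u, MemLp (h u) 2 P)
    (h0 : ∀ u, ∫ s, h u s ∂P = 0) (hc : ∀ u, ∫ s, ‖h u s‖ ^ 2 ∂P ≤ c u) (hcm : Measurable c)
    (hci : Integrable (fun ω => c (z ω)) Pr) :
    MemLp (fun ω => h (z ω) (X ω)) 2 Pr ∧
    ∫ ω, ‖A ω + h (z ω) (X ω)‖ ^ 2 ∂Pr ≤ ∫ ω, ‖A ω‖ ^ 2 ∂Pr + ∫ ω, c (z ω) ∂Pr := by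
  -- All of the past that enters; by independence, the joint law of `U` and `X` is the product of
  -- their laws.
  let U : Ω → E × β := fun ω => (A ω, z ω)
  have hU𝓖 : Measurable[𝓖] U := hAm.prodMk hzm
  have hU : Measurable U := hU𝓖.mono h𝓖 le_rfl
  have hUX : U ⟂ᵢ[Pr] X := by
    rw [IndepFun_iff_Indep]
    exact indep_of_indep_of_le_left hind hU𝓖.comap_le
  have hP : IsProbabilityMeasure P := by
    rw [← hX.map_eq]; exact Measure.isProbabilityMeasure_map hX.measurable.aemeasurable
  have hν : IsProbabilityMeasure (Pr.map U) := Measure.isProbabilityMeasure_map hU.aemeasurable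
  have hmp : MeasurePreserving (fun ω => (U ω, X ω)) Pr ((Pr.map U).prod P) := by
    refine ⟨hU.prodMk hX.measurable, ?_⟩
    rw [(indepFun_iff_map_prod_eq_prod_map_map hU.aemeasurable hX.measurable.aemeasurable).1 hUX,
      hX.map_eq]
  have hfst : MemLp (Prod.fst : E × β → E) 2 (Pr.map U) :=
    (memLp_map_measure_iff measurable_fst.aestronglyMeasurable hU.aemeasurable).2 hA
  have hcU : Integrable (fun u : E × β => c u.2) (Pr.map U) :=
    (integrable_map_measure (hcm.comp measurable_snd).aestronglyMeasurable hU.aemeasurable).2 hci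
  have hhm : Measurable (Function.uncurry fun (u : E × β) s => h u.2 s) :=
    hh.comp ((measurable_snd.comp measurable_fst).prodMk measurable_snd)
  obtain ⟨r1, r2⟩ := integral_norm_add_sq_le_prod (ν := Pr.map U) (P := P) (A := Prod.fst)
    (h := fun u s => h u.2 s) (c := fun u => c u.2) hfst hhm (fun u => hh2 u.2)
    (fun u => h0 u.2) (fun u => hc u.2) hcU
  refine ⟨r1.comp_measurePreserving hmp, ?_⟩
  have j1 : ∫ p : (E × β) × Ξ, ‖p.1.1 + h p.1.2 p.2‖ ^ 2 ∂((Pr.map U).prod P) =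
      ∫ ω, ‖A ω + h (z ω) (X ω)‖ ^ 2 ∂Pr := by
    rw [← hmp.map_eq]
    exact integral_map hmp.measurable.aemeasurable
      (((measurable_fst.comp measurable_fst).add hhm).norm.pow_const 2).aestronglyMeasurable
  have j2 : ∫ u : E × β, ‖u.1‖ ^ 2 ∂(Pr.map U) = ∫ ω, ‖A ω‖ ^ 2 ∂Pr :=
    integral_map hU.aemeasurable (measurable_fst.norm.pow_const 2).aestronglyMeasurable
  have j3 : ∫ u : E × β, c u.2 ∂(Pr.map U) = ∫ ω, c (z ω) ∂Pr :=
    integral_map hU.aemeasurable (hcm.comp measurable_snd).aestronglyMeasurable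
  rw [j1, j2, j3] at r2
  exact r2

/-- Averages over a mini-batch of fresh samples: the second moment of a martingale-like sum. -/
lemma integral_norm_add_batch_sq_le {β : Type*} [MeasurableSpace β] [MeasurableSpace Ξ]
    {mΩ : MeasurableSpace Ω} {Pr : Measure Ω} {P : Measure Ξ}
    [IsProbabilityMeasure Pr] {𝓖 : ℕ → MeasurableSpace Ω} (h𝓖 : ∀ k, 𝓖 k ≤ mΩ)
    (hmono : Monotone 𝓖) {X : ℕ → Ω → Ξ} (hX : ∀ k, MeasurePreserving (X k) Pr P)
    (hXm : ∀ k, Measurable[𝓖 (k + 1)] (X k))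
    (hind : ∀ k, Indep (𝓖 k) (MeasurableSpace.comap (X k) inferInstance) Pr)
    {A : Ω → E} {z : Ω → β} (hAm : Measurable[𝓖 0] A) (hzm : Measurable[𝓖 0] z)
    (hA : MemLp A 2 Pr) {h : β → Ξ → E} {c : β → ℝ}
    (hh : Measurable (Function.uncurry h)) (hh2 : ∀ u, MemLp (h u) 2 P)
    (h0 : ∀ u, ∫ s, h u s ∂P = 0) (hc : ∀ u, ∫ s, ‖h u s‖ ^ 2 ∂P ≤ c u) (hcm : Measurable c)
    (hci : Integrable (fun ω => c (z ω)) Pr) (S : ℝ) (K : ℕ) :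
    Measurable[𝓖 K] (fun ω => A ω + S⁻¹ • ∑ k ∈ Finset.range K, h (z ω) (X k ω)) ∧
    MemLp (fun ω => A ω + S⁻¹ • ∑ k ∈ Finset.range K, h (z ω) (X k ω)) 2 Pr ∧
    ∫ ω, ‖A ω + S⁻¹ • ∑ k ∈ Finset.range K, h (z ω) (X k ω)‖ ^ 2 ∂Pr ≤
      ∫ ω, ‖A ω‖ ^ 2 ∂Pr + K * (S⁻¹ ^ 2 * ∫ ω, c (z ω) ∂Pr) := by
  -- The weight `S⁻¹` is kept apart from the number `K` of terms, so each partial sum can serve as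
  -- the past `A` of the next sample. Its measurability is therefore part of the induction.
  induction K with
  | zero => simpa using ⟨hAm, hA⟩
  | succ K ih =>
    obtain ⟨i1, i2, i3⟩ := ih
    have e : ∀ ω, A ω + S⁻¹ • ∑ k ∈ Finset.range (K + 1), h (z ω) (X k ω) =
        (A ω + S⁻¹ • ∑ k ∈ Finset.range K, h (z ω) (X k ω)) + S⁻¹ • h (z ω) (X K ω) := by
      intro ω
      rw [Finset.sum_range_succ, smul_add, add_assoc]
    have hzK : Measurable[𝓖 K] z := hzm.mono (hmono (Nat.zero_le K)) le_rfl
    have hSh : Measurable (Function.uncurry fun u s => S⁻¹ • h u s) := hh.const_smul S⁻¹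
    obtain ⟨r1, r2⟩ := integral_norm_add_sq_le_of_indep (h𝓖 K) (hX K) (hind K) i1 hzK i2
      (h := fun u s => S⁻¹ • h u s) (c := fun u => S⁻¹ ^ 2 * c u) hSh
      (fun u => (hh2 u).const_smul S⁻¹)
      (fun u => by rw [integral_smul, h0, smul_zero])
      (fun u => by
        simp only [norm_smul, mul_pow, Real.norm_eq_abs, sq_abs]
        rw [integral_const_mul]
        exact mul_le_mul_of_nonneg_left (hc u) (by positivity))
      (hcm.const_mul _) (hci.const_mul _)
    simp only [e]
    refine ⟨?_, i2.add r1, ?_⟩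
    · have m1 := i1.mono (hmono (Nat.le_succ K)) le_rfl
      have m2 : Measurable[𝓖 (K + 1)] fun ω => (z ω, X K ω) :=
        (hzm.mono (hmono (Nat.zero_le _)) le_rfl).prodMk (hXm K)
      exact m1.add (hSh.comp m2)
    · rw [integral_const_mul] at r2
      push_cast
      linarith

end Estimation

/-! ### The filtration generated by the samples -/

section SampleHistory

variable {M : ℕ} {Ω Ξ : Type*} [MeasurableSpace Ξ]

/-- The σ-algebra generated by the samples with index in `S`. -/
@[reducible] def samplesIn (ξ : Fin M → ℕ → ℕ → Ω → Ξ) (S : Set (Fin M × ℕ × ℕ)) : MeasurableSpace Ω :=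
  ⨆ a ∈ S, MeasurableSpace.comap (ξ a.1 a.2.1 a.2.2) inferInstance

/-- The indices of the samples that are drawn before time `T`. -/
def before (M T : ℕ) : Set (Fin M × ℕ × ℕ) := {a | a.2.1 < T}

/-- The indices of the samples before time `T` and of the first `k` samples of agent `i` at
time `T`. -/
def beforeBatch {M : ℕ} (i : Fin M) (T k : ℕ) : Set (Fin M × ℕ × ℕ) :=
  {a | a.2.1 < T ∨ (a.1 = i ∧ a.2.1 = T ∧ a.2.2 < k)}

lemma beforeBatch_zero (i : Fin M) (T : ℕ) : beforeBatch i T 0 = before M T := by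
  ext a; simp [beforeBatch, before]

lemma beforeBatch_mono (i : Fin M) (T : ℕ) : Monotone (beforeBatch i T) := by
  intro k l hkl a ha
  rcases ha with ha | ha
  · exact Or.inl ha
  · exact Or.inr ⟨ha.1, ha.2.1, ha.2.2.trans_le hkl⟩

variable {ξ : Fin M → ℕ → ℕ → Ω → Ξ}

lemma samplesIn_mono {S T : Set (Fin M × ℕ × ℕ)} (h : S ⊆ T) : samplesIn ξ S ≤ samplesIn ξ T :=
  biSup_mono h

lemma measurable_samplesIn {S : Set (Fin M × ℕ × ℕ)} {i : Fin M} {t k : ℕ}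
    (h : (i, t, k) ∈ S) : Measurable[samplesIn ξ S] (ξ i t k) := by
  rw [measurable_iff_comap_le]
  exact le_biSup (fun a : Fin M × ℕ × ℕ =>
    MeasurableSpace.comap (ξ a.1 a.2.1 a.2.2) inferInstance) h

variable [MeasurableSpace Ω] {Pr : Measure Ω} {P : Fin M → Measure Ξ}
  (hξ : SampleAssumptions Pr P ξ)
include hξ

lemma samplesIn_le (S : Set (Fin M × ℕ × ℕ)) : samplesIn ξ S ≤ ‹MeasurableSpace Ω› :=
  iSup₂_le fun a _ => (hξ.law a.1 a.2.1 a.2.2).measurable.comap_le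

lemma indep_samplesIn {S : Set (Fin M × ℕ × ℕ)} {i : Fin M} {t k : ℕ} (h : (i, t, k) ∉ S) :
    Indep (samplesIn ξ S) (MeasurableSpace.comap (ξ i t k) inferInstance) Pr := by
  have h1 := (iIndepFun_iff_iIndep _ _ _).1 hξ.indep
  have h2 := indep_iSup_of_disjoint (fun a => (hξ.law a.1 a.2.1 a.2.2).measurable.comap_le) h1
    (Set.disjoint_singleton_right.2 h)
  simpa [samplesIn] using h2

/-- The mini-batch bound for the fresh samples of agent `i` at time `T`. -/
lemma batch_bound {E β : Type*} [NormedAddCommGroup E] [InnerProductSpace ℝ E] [CompleteSpace E]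
    [MeasurableSpace E] [BorelSpace E] [SecondCountableTopology E] [MeasurableSpace β]
    [IsProbabilityMeasure Pr] (i : Fin M) (T : ℕ)
    {A : Ω → E} {z : Ω → β} (hAm : Measurable[samplesIn ξ (before M T)] A)
    (hzm : Measurable[samplesIn ξ (before M T)] z)
    (hA : MemLp A 2 Pr) {h : β → Ξ → E} {c : β → ℝ}
    (hh : Measurable (Function.uncurry h)) (hh2 : ∀ u, MemLp (h u) 2 (P i))
    (h0 : ∀ u, ∫ s, h u s ∂(P i) = 0) (hc : ∀ u, ∫ s, ‖h u s‖ ^ 2 ∂(P i) ≤ c u)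
    (hcm : Measurable c) (hci : Integrable (fun ω => c (z ω)) Pr) {S : ℕ} (hS : 1 ≤ S) :
    MemLp (fun ω => A ω + (S : ℝ)⁻¹ • ∑ k ∈ Finset.range S, h (z ω) (ξ i T k ω)) 2 Pr ∧
    ∫ ω, ‖A ω + (S : ℝ)⁻¹ • ∑ k ∈ Finset.range S, h (z ω) (ξ i T k ω)‖ ^ 2 ∂Pr ≤
      ∫ ω, ‖A ω‖ ^ 2 ∂Pr + (S : ℝ)⁻¹ * ∫ ω, c (z ω) ∂Pr := by
  -- Within time `T` the samples of agent `i` are revealed one by one. With `K = S` the variance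
  -- factor is `S · S⁻² = S⁻¹`.
  have h3 := integral_norm_add_batch_sq_le (𝓖 := fun k => samplesIn ξ (beforeBatch i T k))
    (fun k => samplesIn_le hξ _) (fun k l hkl => samplesIn_mono (beforeBatch_mono i T hkl))
    (X := fun k => ξ i T k) (fun k => hξ.law i T k)
    (fun k => measurable_samplesIn (Or.inr ⟨rfl, rfl, Nat.lt_succ_self k⟩))
    (fun k => indep_samplesIn hξ (by simp [beforeBatch]))
    (by rwa [beforeBatch_zero]) (by rwa [beforeBatch_zero]) hA hh hh2 h0 hc hcm hci (S : ℝ) S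
  refine ⟨h3.2.1, h3.2.2.trans (le_of_eq ?_)⟩
  have : (S : ℝ) ≠ 0 := by positivity
  field_simp

end SampleHistory

/-! ### Lipschitz images of square integrable maps -/

section Lipschitz

variable {Ω E E' : Type*} [NormedAddCommGroup E] [NormedAddCommGroup E']

lemma continuous_of_norm_sub_le {G : E → E'} {K : ℝ} (h : ∀ z z', ‖G z - G z'‖ ≤ K * ‖z - z'‖) :
    Continuous G :=
  (LipschitzWith.of_dist_le_mul (K := K.toNNReal) fun z z' => by
    rw [dist_eq_norm, dist_eq_norm]
    exact (h z z').trans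
      (mul_le_mul_of_nonneg_right (Real.le_coe_toNNReal K) (norm_nonneg _))).continuous

lemma measurable_of_norm_sub_le [MeasurableSpace E] [BorelSpace E] [MeasurableSpace E']
    [BorelSpace E'] {G : E → E'} {K : ℝ} (h : ∀ z z', ‖G z - G z'‖ ≤ K * ‖z - z'‖) :
    Measurable G :=
  (continuous_of_norm_sub_le h).measurable

/-- The map `G - G 0` is Lipschitz and vanishes at `0`; the constant `G 0` is square integrable
because the measure is finite. -/
lemma memLp_comp_of_norm_sub_le {_ : MeasurableSpace Ω} {Pr : Measure Ω} [IsFiniteMeasure Pr]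
    {G : E → E'} {K : ℝ} (h : ∀ z z', ‖G z - G z'‖ ≤ K * ‖z - z'‖) {u : Ω → E}
    (hu : MemLp u 2 Pr) : MemLp (fun ω => G (u ω)) 2 Pr := by
  have h1 : LipschitzWith K.toNNReal fun z => G z - G 0 :=
    LipschitzWith.of_dist_le_mul fun z z' => by
      rw [dist_eq_norm, dist_eq_norm, sub_sub_sub_cancel_right]
      exact (h z z').trans
        (mul_le_mul_of_nonneg_right (Real.le_coe_toNNReal K) (norm_nonneg _))
  have h2 := (h1.comp_memLp (sub_self _) hu).add (memLp_const (G 0))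
  refine h2.congr_norm h2.1 ?_ |>.ae_eq ?_
  · exact Filter.Eventually.of_forall fun ω => rfl
  · exact Filter.Eventually.of_forall fun ω => by simp

end Lipschitz

/-! ### Measurability and moments of mixed vectors -/

section Mixing

variable {M : ℕ} {Ω E : Type*} [NormedAddCommGroup E] [NormedSpace ℝ E]

lemma memLp_mix {_ : MeasurableSpace Ω} {Pr : Measure Ω} (W : Matrix (Fin M) (Fin M) ℝ)
    {u : Fin M → Ω → E} (hu : ∀ i, MemLp (u i) 2 Pr) (i : Fin M) :
    MemLp (fun ω => mix W (fun j => u j ω) i) 2 Pr :=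
  memLp_finsetSum _ fun j _ => (hu j).const_smul (W i j)

lemma memLp_avg {_ : MeasurableSpace Ω} {Pr : Measure Ω}
    {u : Fin M → Ω → E} (hu : ∀ i, MemLp (u i) 2 Pr) :
    MemLp (fun ω => avg fun j => u j ω) 2 Pr :=
  (memLp_finsetSum _ fun j _ => hu j).const_smul _

lemma measurable_mix {_ : MeasurableSpace Ω} [MeasurableSpace E] [BorelSpace E]
    [SecondCountableTopology E] (W : Matrix (Fin M) (Fin M) ℝ)
    {u : Fin M → Ω → E} (hu : ∀ i, Measurable (u i)) (i : Fin M) :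
    Measurable fun ω => mix W (fun j => u j ω) i :=
  Finset.measurable_fun_sum _ fun j _ => (hu j).const_smul (W i j)

end Mixing

/-! ### The displacement of one step -/

section Directions

variable {d m : ℕ}

/-- The displacement `(-η_x d_x, η_y d_y)` along a direction `(d_x, d_y)`. -/
def move (ηx ηy : ℝ) : Pt d m →ₗ[ℝ] Pt d m where
  toFun u := pair (-(ηx • u.fst)) (ηy • u.snd)
  map_add' u v := by
    rw [WithLp.add_fst, WithLp.add_snd, smul_add, smul_add, neg_add]; rfl
  map_smul' c u := by
    rw [WithLp.smul_fst, WithLp.smul_snd, smul_comm ηx, smul_comm ηy, ← smul_neg]; rfl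

lemma move_apply (ηx ηy : ℝ) (u : Pt d m) :
    move ηx ηy u = pair (-(ηx • u.fst)) (ηy • u.snd) := rfl

lemma norm_move_sq (ηx ηy : ℝ) (u : Pt d m) :
    ‖move ηx ηy u‖ ^ 2 = ηx ^ 2 * ‖u.fst‖ ^ 2 + ηy ^ 2 * ‖u.snd‖ ^ 2 := by
  rw [move_apply, norm_sq_eq_fst_add_snd, pair_fst, pair_snd, norm_neg, norm_smul, norm_smul,
    mul_pow, mul_pow, Real.norm_eq_abs, Real.norm_eq_abs, sq_abs, sq_abs]

lemma norm_move_sub_le {ηx ηy : ℝ} (hx : 0 < ηx) (hxy : ηx ≤ ηy) (u v : Pt d m) :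
    ‖move ηx ηy u - move ηx ηy v‖ ≤ ηy * ‖u - v‖ := by
  rw [← map_sub]
  refine abs_le_of_sq_le_sq' ?_ (by have := hx.trans_le hxy; positivity) |>.2
  rw [norm_move_sq, mul_pow, norm_sq_eq_fst_add_snd (u - v), mul_add]
  gcongr

lemma norm_fst_sub_le (u v : Pt d m) : ‖u.fst - v.fst‖ ≤ 1 * ‖u - v‖ := by
  rw [← WithLp.sub_fst, one_mul]; exact norm_fst_le _

lemma norm_snd_sub_le (u v : Pt d m) : ‖u.snd - v.snd‖ ≤ 1 * ‖u - v‖ := by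
  rw [← WithLp.sub_snd, one_mul]; exact norm_snd_le _

end Directions

/-! ### Errors of mini-batch estimators -/

section Batches

variable {d m : ℕ} {Ξ : Type*}

lemma batchGrad_sub_const (gi : Pt d m → Ξ → Pt d m) {S : ℕ} (hS : 1 ≤ S) (s : ℕ → Ξ)
    (z c : Pt d m) :
    batchGrad gi S s z - c = (S : ℝ)⁻¹ • ∑ k ∈ Finset.range S, (gi z (s k) - c) := by
  have h : (S : ℝ) ≠ 0 := by positivity
  rw [Finset.sum_sub_distrib, Finset.sum_const, Finset.card_range, smul_sub,
    ← Nat.cast_smul_eq_nsmul ℝ, smul_smul, inv_mul_cancel₀ h, one_smul, batchGrad]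

lemma batchGrad_sub_batchGrad (gi : Pt d m → Ξ → Pt d m) {S : ℕ} (hS : 1 ≤ S) (s : ℕ → Ξ)
    (z z' c : Pt d m) :
    batchGrad gi S s z - batchGrad gi S s z' - c =
      (S : ℝ)⁻¹ • ∑ k ∈ Finset.range S, (gi z (s k) - gi z' (s k) - c) := by
  have h : (S : ℝ) ≠ 0 := by positivity
  rw [Finset.sum_sub_distrib, Finset.sum_sub_distrib, Finset.sum_const, Finset.card_range,
    smul_sub, smul_sub, ← Nat.cast_smul_eq_nsmul ℝ, smul_smul, inv_mul_cancel₀ h, one_smul,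
    batchGrad, batchGrad]

variable {M : ℕ} {Ω : Type*} [MeasurableSpace Ξ] {P : Fin M → Measure Ξ}
  {f : Fin M → Pt d m → ℝ} {g : Fin M → Pt d m → Ξ → Pt d m} {L μ σ : ℝ}

lemma measurable_batchGrad (hg : OracleAssumptions f g P L σ) {𝓖 : MeasurableSpace Ω} (i : Fin M)
    (S : ℕ) {z : Ω → Pt d m} {X : ℕ → Ω → Ξ} (hz : Measurable[𝓖] z)
    (hX : ∀ k, Measurable[𝓖] (X k)) :
    Measurable[𝓖] fun ω => batchGrad (g i) S (fun k => X k ω) (z ω) := by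
  have h : Measurable[𝓖] fun ω => ∑ k ∈ Finset.range S, g i (z ω) (X k ω) :=
    Finset.measurable_fun_sum _ fun k _ => (hg.measurable i).comp (hz.prodMk (hX k))
  exact h.const_smul (S : ℝ)⁻¹

variable [MeasurableSpace Ω] {ξ : Fin M → ℕ → ℕ → Ω → Ξ} {Pr : Measure Ω}
  [IsProbabilityMeasure Pr]

lemma SampleAssumptions.isProbabilityMeasure (hξ : SampleAssumptions Pr P ξ) (i : Fin M) :
    IsProbabilityMeasure (P i) := by
  rw [← (hξ.law i 0 0).map_eq]
  exact Measure.isProbabilityMeasure_map (hξ.law i 0 0).measurable.aemeasurable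

variable (hf : ObjectiveAssumptions f L μ) (hg : OracleAssumptions f g P L σ)
  (hξ : SampleAssumptions Pr P ξ)
include hf hg hξ

/-- The error of a fresh mini-batch gradient at a point that depends on the past, shifted by a
constant. -/
lemma fresh_batch_bound_add (i : Fin M) (T : ℕ) {z : Ω → Pt d m}
    (hz : Measurable[samplesIn ξ (before M T)] z) {S : ℕ} (hS : 1 ≤ S) (a : Pt d m) :
    MemLp (fun ω => a + (batchGrad (g i) S (fun k => ξ i T k ω) (z ω) - ∇ (f i) (z ω))) 2 Pr ∧
    ∫ ω, ‖a + (batchGrad (g i) S (fun k => ξ i T k ω) (z ω) - ∇ (f i) (z ω))‖ ^ 2 ∂Pr ≤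
      ‖a‖ ^ 2 + σ ^ 2 / S := by
  have hP := hξ.isProbabilityMeasure i
  have hG : Measurable (∇ (f i)) := measurable_of_norm_sub_le (hf.smooth i)
  have h := batch_bound hξ i T (A := fun _ => a) (z := z)
    (@measurable_const _ _ _ (samplesIn ξ (before M T)) _) hz (memLp_const _)
    (h := fun z s => g i z s - ∇ (f i) z) (c := fun _ => σ ^ 2)
    ((hg.measurable i).sub (hG.comp measurable_fst)) (fun z => (hg.memLp i z).sub (memLp_const _))
    (fun z => by
      rw [integral_sub ((hg.memLp i z).integrable (by norm_num)) (integrable_const _),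
        hg.unbiased, integral_const, probReal_univ, one_smul, sub_self])
    (fun z => hg.variance i z) measurable_const (integrable_const _) hS
  simp only [batchGrad_sub_const _ hS]
  simp only [integral_const, probReal_univ, one_smul] at h
  exact ⟨h.1, h.2.trans (le_of_eq (by ring))⟩

lemma fresh_batch_bound (i : Fin M) (T : ℕ) {z : Ω → Pt d m}
    (hz : Measurable[samplesIn ξ (before M T)] z) {S : ℕ} (hS : 1 ≤ S) :
    MemLp (fun ω => batchGrad (g i) S (fun k => ξ i T k ω) (z ω) - ∇ (f i) (z ω)) 2 Pr ∧
    ∫ ω, ‖batchGrad (g i) S (fun k => ξ i T k ω) (z ω) - ∇ (f i) (z ω)‖ ^ 2 ∂Pr ≤ σ ^ 2 / S := by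
  simpa using fresh_batch_bound_add hf hg hξ i T hz hS 0

/-- The error of a recursive estimate after an update with a fresh mini-batch. -/
lemma recursive_batch_bound (i : Fin M) (T : ℕ) {z z' v : Ω → Pt d m}
    (hz : Measurable[samplesIn ξ (before M T)] z) (hz' : Measurable[samplesIn ξ (before M T)] z')
    (hv : Measurable[samplesIn ξ (before M T)] v)
    (hz2 : MemLp z 2 Pr) (hz'2 : MemLp z' 2 Pr)
    (hv2 : MemLp (fun ω => v ω - ∇ (f i) (z ω)) 2 Pr) {S : ℕ} (hS : 1 ≤ S) :
    MemLp (fun ω => batchGrad (g i) S (fun k => ξ i T k ω) (z' ω) -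
      batchGrad (g i) S (fun k => ξ i T k ω) (z ω) + v ω - ∇ (f i) (z' ω)) 2 Pr ∧
    ∫ ω, ‖batchGrad (g i) S (fun k => ξ i T k ω) (z' ω) -
      batchGrad (g i) S (fun k => ξ i T k ω) (z ω) + v ω - ∇ (f i) (z' ω)‖ ^ 2 ∂Pr ≤
      ∫ ω, ‖v ω - ∇ (f i) (z ω)‖ ^ 2 ∂Pr + L ^ 2 / S * ∫ ω, ‖z' ω - z ω‖ ^ 2 ∂Pr := by
  have hP := hξ.isProbabilityMeasure i
  have hG : Measurable (∇ (f i)) := measurable_of_norm_sub_le (hf.smooth i)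
  have hgd : ∀ u : Pt d m × Pt d m, MemLp (fun s => g i u.1 s - g i u.2 s) 2 (P i) := fun u =>
    (hg.memLp i u.1).sub (hg.memLp i u.2)
  have hmean : ∀ u : Pt d m × Pt d m, ∫ s, (g i u.1 s - g i u.2 s) ∂(P i) =
      ∇ (f i) u.1 - ∇ (f i) u.2 := fun u => by
    rw [integral_sub ((hg.memLp i u.1).integrable (by norm_num))
      ((hg.memLp i u.2).integrable (by norm_num)), hg.unbiased, hg.unbiased]
  -- The new error is the old one plus a batch average of gradient differences centred at their
  -- means; the past enters these through the pair `(z', z)`.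
  have h := batch_bound hξ i T (A := fun ω => v ω - ∇ (f i) (z ω)) (z := fun ω => (z' ω, z ω))
    (hv.sub (hG.comp hz)) (hz'.prodMk hz) hv2
    (h := fun u s => g i u.1 s - g i u.2 s - (∇ (f i) u.1 - ∇ (f i) u.2))
    (c := fun u => L ^ 2 * ‖u.1 - u.2‖ ^ 2)
    ((((hg.measurable i).comp ((measurable_fst.comp measurable_fst).prodMk measurable_snd)).sub
      ((hg.measurable i).comp ((measurable_snd.comp measurable_fst).prodMk measurable_snd))).sub
      ((hG.comp (measurable_fst.comp measurable_fst)).sub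
        (hG.comp (measurable_snd.comp measurable_fst))))
    (fun u => (hgd u).sub (memLp_const _))
    (fun u => by
      rw [integral_sub ((hgd u).integrable (by norm_num)) (integrable_const _),
        hmean, integral_const, probReal_univ, one_smul, sub_self])
    (fun u => by
      rw [← hmean u]
      exact (integral_norm_sub_integral_sq_le (hgd u)).trans (hg.meanSquaredSmooth i u.1 u.2))
    (((measurable_fst.sub measurable_snd).norm.pow_const 2).const_mul _)
    ((integrable_norm_sq_of_memLp (hz'2.sub hz2)).const_mul _) hS
  have e : ∀ ω, batchGrad (g i) S (fun k => ξ i T k ω) (z' ω) -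
      batchGrad (g i) S (fun k => ξ i T k ω) (z ω) + v ω - ∇ (f i) (z' ω) =
      v ω - ∇ (f i) (z ω) + (S : ℝ)⁻¹ • ∑ k ∈ Finset.range S,
        (g i (z' ω) (ξ i T k ω) - g i (z ω) (ξ i T k ω) - (∇ (f i) (z' ω) - ∇ (f i) (z ω))) := by
    intro ω
    rw [← batchGrad_sub_batchGrad _ hS (fun k => ξ i T k ω)]
    abel
  simp only [e]
  refine ⟨h.1, h.2.trans (le_of_eq ?_)⟩
  rw [integral_const_mul]
  ring

end Batches

/-! ### Averages along the run -/

section Run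

variable {d m M : ℕ} {Ξ : Type*} {g : Fin M → Pt d m → Ξ → Pt d m}
  {W : Matrix (Fin M) (Fin M) ℝ} {p : Params} {z₀ : Fin M → Pt d m}
  {D₀ : (Fin M → Pt d m) → (Fin M → Pt d m)} {s : Fin M → ℕ → ℕ → Ξ}

lemma run_succ_z (t : ℕ) (i : Fin M) : (run g W p z₀ D₀ s (t + 1)).z i =
    mix W (run g W p z₀ D₀ s t).z i + move p.ηx p.ηy ((run g W p z₀ D₀ s t).dir i) := by
  rw [move_apply]
  change pair _ _ = _
  rw [sub_eq_add_neg]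
  rfl

lemma run_succ_v (t : ℕ) (i : Fin M) : (run g W p z₀ D₀ s (t + 1)).v i =
    if t % p.q = 0 then batchGrad (g i) p.S₁ (s i (t + 1)) ((run g W p z₀ D₀ s (t + 1)).z i)
    else batchGrad (g i) p.S₂ (s i (t + 1)) ((run g W p z₀ D₀ s (t + 1)).z i) -
      batchGrad (g i) p.S₂ (s i (t + 1)) ((run g W p z₀ D₀ s t).z i) +
        (run g W p z₀ D₀ s t).v i := rfl

lemma run_succ_dir (t : ℕ) : (run g W p z₀ D₀ s (t + 1)).dir =
    mix W fun i => (run g W p z₀ D₀ s t).dir i + (run g W p z₀ D₀ s (t + 1)).v i -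
      (run g W p z₀ D₀ s t).v i := rfl

/-- The invariant of gradient tracking: mixing preserves averages, and the added increments of `v`
telescope. -/
lemma avg_dir (hW : W ∈ doublyStochastic ℝ (Fin M)) (hD : ∀ v, avg (D₀ v) = avg v) (t : ℕ) :
    avg (run g W p z₀ D₀ s t).dir = avg (run g W p z₀ D₀ s t).v := by
  induction t with
  | zero => exact hD _
  | succ t ih =>
    rw [run_succ_dir, avg_mix hW, avg_sub, avg_add, ih]
    simp

lemma avg_z_succ (hW : W ∈ doublyStochastic ℝ (Fin M)) (hD : ∀ v, avg (D₀ v) = avg v) (t : ℕ) :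
    avg (run g W p z₀ D₀ s (t + 1)).z =
      avg (run g W p z₀ D₀ s t).z + move p.ηx p.ηy (avg (run g W p z₀ D₀ s t).v) := by
  have e : (run g W p z₀ D₀ s (t + 1)).z = fun i =>
    mix W (run g W p z₀ D₀ s t).z i + move p.ηx p.ηy ((run g W p z₀ D₀ s t).dir i) :=
    funext fun i => run_succ_z t i
  rw [e, avg_add, avg_mix hW, ← avg_dir hW hD]
  congr 1
  simp only [avg, map_smul, map_sum]

end Run

/-! ### Measurability, moments and variance along the run -/

section RunMoments

variable {d m M : ℕ} {Ω Ξ : Type*} [MeasurableSpace Ξ] {P : Fin M → Measure Ξ}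
  {f : Fin M → Pt d m → ℝ} {g : Fin M → Pt d m → Ξ → Pt d m} {L μ σ : ℝ}

/-- The state at time `t` of the run on the random samples `ξ`. -/
noncomputable abbrev runAt (g : Fin M → Pt d m → Ξ → Pt d m) (W : Matrix (Fin M) (Fin M) ℝ) (p : Params)
    (z₀ : Fin M → Pt d m) (D₀ : (Fin M → Pt d m) → (Fin M → Pt d m))
    (ξ : Fin M → ℕ → ℕ → Ω → Ξ) (t : ℕ) (ω : Ω) : State d m M :=
  run g W p z₀ D₀ (fun i t k => ξ i t k ω) t

/-- The squared error of the gradient estimates of all agents. -/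
noncomputable def estError (f : Fin M → Pt d m → ℝ) (S : State d m M) : ℝ :=
  ∑ i, ‖S.v i - ∇ (f i) (S.z i)‖ ^ 2

variable (W : Matrix (Fin M) (Fin M) ℝ) (p : Params)
    (z₀ : Fin M → Pt d m) {D₀ : (Fin M → Pt d m) → (Fin M → Pt d m)}
    {ξ : Fin M → ℕ → ℕ → Ω → Ξ}

lemma measurable_sample_before {i : Fin M} {t T : ℕ} (h : t < T) (k : ℕ) :
    Measurable[samplesIn ξ (before M T)] (ξ i t k) :=
  measurable_samplesIn (show (i, t, k).2.1 < T from h)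

lemma before_subset_succ (T : ℕ) : before M T ⊆ before M (T + 1) := fun _ ha =>
  Nat.lt_succ_of_lt ha

lemma measurable_state_family {n : ℕ} {E : Type*} [MeasurableSpace E] {𝓖 : MeasurableSpace Ω}
    {D : (Fin n → E) → (Fin n → E)} (hD : Measurable D) {u : Fin n → Ω → E}
    (hu : ∀ i, Measurable[𝓖] (u i)) (i : Fin n) :
    Measurable[𝓖] fun ω => D (fun j => u j ω) i :=
  (measurable_pi_apply i).comp (hD.comp (measurable_pi_lambda _ hu))

variable (hf : ObjectiveAssumptions f L μ) (hg : OracleAssumptions f g P L σ)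

lemma measurable_move {ηx ηy : ℝ} (hx : 0 < ηx) (hxy : ηx ≤ ηy) :
    Measurable (move (d := d) (m := m) ηx ηy) :=
  measurable_of_norm_sub_le (norm_move_sub_le hx hxy)

include hg

/-- The iterates at time `t` do not depend on the samples of time `t`, whereas the estimates and
trackers do. Hence the samples of time `t + 1` are fresh for both gradient arguments, at times `t`
and `t + 1`. -/
lemma measurable_run (hD : Measurable D₀) (hx : 0 < p.ηx) (hxy : p.ηx ≤ p.ηy) (t : ℕ) :
    (∀ i, Measurable[samplesIn ξ (before M t)] fun ω => (runAt g W p z₀ D₀ ξ t ω).z i) ∧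
    (∀ i, Measurable[samplesIn ξ (before M (t + 1))] fun ω => (runAt g W p z₀ D₀ ξ t ω).v i) ∧
    (∀ i, Measurable[samplesIn ξ (before M (t + 1))]
      fun ω => (runAt g W p z₀ D₀ ξ t ω).dir i) := by
  induction t with
  | zero =>
    have hv : ∀ i, Measurable[samplesIn ξ (before M 1)]
        fun ω => (runAt g W p z₀ D₀ ξ 0 ω).v i := fun i =>
      measurable_batchGrad hg i p.S₁ (@measurable_const _ _ _ (samplesIn ξ (before M 1)) (z₀ i))
        fun k => measurable_sample_before Nat.zero_lt_one k
    exact ⟨fun i => @measurable_const _ _ _ (samplesIn ξ (before M 0)) (z₀ i), hv,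
      measurable_state_family hD hv⟩
  | succ t ih =>
    obtain ⟨i1, i2, i3⟩ := ih
    have l1 := samplesIn_mono (ξ := ξ) (before_subset_succ (M := M) t)
    have l2 := samplesIn_mono (ξ := ξ) (before_subset_succ (M := M) (t + 1))
    have hz : ∀ i, Measurable[samplesIn ξ (before M (t + 1))]
        fun ω => (runAt g W p z₀ D₀ ξ (t + 1) ω).z i := by
      intro i
      have h1 : Measurable[samplesIn ξ (before M (t + 1))]
          fun ω => mix W (fun j => (runAt g W p z₀ D₀ ξ t ω).z j) i :=
        measurable_mix W (fun j => (i1 j).mono l1 le_rfl) i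
      have h2 := h1.add ((measurable_move hx hxy).comp (i3 i))
      have e : (fun ω => (runAt g W p z₀ D₀ ξ (t + 1) ω).z i) = _ :=
        funext fun ω => run_succ_z t i
      rw [e]
      exact h2
    have hv : ∀ i, Measurable[samplesIn ξ (before M (t + 1 + 1))]
        fun ω => (runAt g W p z₀ D₀ ξ (t + 1) ω).v i := by
      intro i
      have hX : ∀ k, Measurable[samplesIn ξ (before M (t + 1 + 1))] (ξ i (t + 1) k) :=
        fun k => measurable_sample_before (Nat.lt_succ_self _) k
      have e : (fun ω => (runAt g W p z₀ D₀ ξ (t + 1) ω).v i) = _ :=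
        funext fun ω => run_succ_v t i
      rw [e]
      have hz' := (hz i).mono l2 le_rfl
      by_cases ht : t % p.q = 0
      · simp only [if_pos ht]
        exact measurable_batchGrad hg i p.S₁ hz' hX
      · simp only [if_neg ht]
        have m1 := measurable_batchGrad hg i p.S₂ hz' hX
        have m2 := measurable_batchGrad hg i p.S₂ ((i1 i).mono (l1.trans l2) le_rfl) hX
        exact (m1.sub m2).add ((i2 i).mono l2 le_rfl)
    refine ⟨hz, hv, fun i => ?_⟩
    have e : (fun ω => (runAt g W p z₀ D₀ ξ (t + 1) ω).dir i) = _ :=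
      funext fun ω => congrFun (run_succ_dir t) i
    rw [e]
    exact measurable_mix W (fun j => (((i3 j).mono l2 le_rfl).add (hv j)).sub
      ((i2 j).mono l2 le_rfl)) i

variable [MeasurableSpace Ω] {Pr : Measure Ω} [IsProbabilityMeasure Pr]
  (hξ : SampleAssumptions Pr P ξ)
  (hD : Measurable D₀) (hx : 0 < p.ηx) (hxy : p.ηx ≤ p.ηy)
  (hD2 : ∀ i, MemLp (fun ω => (initState g p z₀ D₀ fun j k => ξ j 0 k ω).dir i) 2 Pr)
  (hS₁ : 1 ≤ p.S₁) (hS₂ : 1 ≤ p.S₂)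
include hf hξ

lemma memLp_initial_error (hS₁ : 1 ≤ p.S₁) (i : Fin M) :
    MemLp (fun ω => (runAt g W p z₀ D₀ ξ 0 ω).v i - ∇ (f i) (z₀ i)) 2 Pr ∧
    ∫ ω, ‖(runAt g W p z₀ D₀ ξ 0 ω).v i - ∇ (f i) (z₀ i)‖ ^ 2 ∂Pr ≤ σ ^ 2 / p.S₁ :=
  fresh_batch_bound hf hg hξ i 0 (z := fun _ => z₀ i)
    (@measurable_const _ _ _ (samplesIn ξ (before M 0)) _) hS₁

include hD hx hxy

lemma memLp_restart_error (hS₁ : 1 ≤ p.S₁) {t : ℕ} (ht : t % p.q = 0) (i : Fin M) :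
    MemLp (fun ω => (runAt g W p z₀ D₀ ξ (t + 1) ω).v i -
      ∇ (f i) ((runAt g W p z₀ D₀ ξ (t + 1) ω).z i)) 2 Pr ∧
    ∫ ω, ‖(runAt g W p z₀ D₀ ξ (t + 1) ω).v i -
      ∇ (f i) ((runAt g W p z₀ D₀ ξ (t + 1) ω).z i)‖ ^ 2 ∂Pr ≤ σ ^ 2 / p.S₁ := by
  have h := fresh_batch_bound hf hg hξ i (t + 1)
    ((measurable_run W p z₀ hg (ξ := ξ) hD hx hxy (t + 1)).1 i) hS₁
  simp only [runAt, run_succ_v, if_pos ht]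
  exact h

lemma memLp_update_error (hS₂ : 1 ≤ p.S₂) {t : ℕ} (ht : t % p.q ≠ 0) (i : Fin M)
    (hz : MemLp (fun ω => (runAt g W p z₀ D₀ ξ t ω).z i) 2 Pr)
    (hz' : MemLp (fun ω => (runAt g W p z₀ D₀ ξ (t + 1) ω).z i) 2 Pr)
    (hv : MemLp (fun ω => (runAt g W p z₀ D₀ ξ t ω).v i -
      ∇ (f i) ((runAt g W p z₀ D₀ ξ t ω).z i)) 2 Pr) :
    MemLp (fun ω => (runAt g W p z₀ D₀ ξ (t + 1) ω).v i -
      ∇ (f i) ((runAt g W p z₀ D₀ ξ (t + 1) ω).z i)) 2 Pr ∧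
    ∫ ω, ‖(runAt g W p z₀ D₀ ξ (t + 1) ω).v i -
      ∇ (f i) ((runAt g W p z₀ D₀ ξ (t + 1) ω).z i)‖ ^ 2 ∂Pr ≤
      ∫ ω, ‖(runAt g W p z₀ D₀ ξ t ω).v i - ∇ (f i) ((runAt g W p z₀ D₀ ξ t ω).z i)‖ ^ 2 ∂Pr +
      L ^ 2 / p.S₂ * ∫ ω, ‖(runAt g W p z₀ D₀ ξ (t + 1) ω).z i -
        (runAt g W p z₀ D₀ ξ t ω).z i‖ ^ 2 ∂Pr := by
  obtain ⟨m1, m2, -⟩ := measurable_run W p z₀ hg (ξ := ξ) hD hx hxy t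
  have h := recursive_batch_bound hf hg hξ i (t + 1)
    ((m1 i).mono (samplesIn_mono (before_subset_succ t)) le_rfl)
    ((measurable_run W p z₀ hg (ξ := ξ) hD hx hxy (t + 1)).1 i) (m2 i) hz hz' hv hS₂
  have e : ∀ ω, (runAt g W p z₀ D₀ ξ (t + 1) ω).v i =
      batchGrad (g i) p.S₂ (fun k => ξ i (t + 1) k ω) ((runAt g W p z₀ D₀ ξ (t + 1) ω).z i) -
      batchGrad (g i) p.S₂ (fun k => ξ i (t + 1) k ω) ((runAt g W p z₀ D₀ ξ t ω).z i) +
        (runAt g W p z₀ D₀ ξ t ω).v i := fun ω => (run_succ_v t i).trans (if_neg ht)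
  simp only [e]
  exact h

include hD2 hS₁ hS₂

lemma memLp_run (t : ℕ) :
    (∀ i, MemLp (fun ω => (runAt g W p z₀ D₀ ξ t ω).z i) 2 Pr) ∧
    (∀ i, MemLp (fun ω => (runAt g W p z₀ D₀ ξ t ω).v i -
      ∇ (f i) ((runAt g W p z₀ D₀ ξ t ω).z i)) 2 Pr) ∧
    (∀ i, MemLp (fun ω => (runAt g W p z₀ D₀ ξ t ω).dir i) 2 Pr) := by
  -- The induction controls the error of `v` rather than `v`; the latter is recovered by adding the
  -- Lipschitz gradient at `z`.
  have hv : ∀ {t : ℕ} {i : Fin M}, MemLp (fun ω => (runAt g W p z₀ D₀ ξ t ω).z i) 2 Pr →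
      MemLp (fun ω => (runAt g W p z₀ D₀ ξ t ω).v i -
        ∇ (f i) ((runAt g W p z₀ D₀ ξ t ω).z i)) 2 Pr →
      MemLp (fun ω => (runAt g W p z₀ D₀ ξ t ω).v i) 2 Pr := by
    intro t i h1 h2
    have h3 := h2.add (memLp_comp_of_norm_sub_le (hf.smooth i) h1)
    refine h3.ae_eq (Filter.Eventually.of_forall fun ω => ?_)
    simp
  induction t with
  | zero =>
    exact ⟨fun i => memLp_const _, fun i => (memLp_initial_error W p z₀ hf hg hξ hS₁ i).1, hD2⟩
  | succ t ih =>
    obtain ⟨i1, i2, i3⟩ := ih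
    have hz : ∀ i, MemLp (fun ω => (runAt g W p z₀ D₀ ξ (t + 1) ω).z i) 2 Pr := by
      intro i
      have e : (fun ω => (runAt g W p z₀ D₀ ξ (t + 1) ω).z i) = _ :=
        funext fun ω => run_succ_z t i
      rw [e]
      exact (memLp_mix W i1 i).add (memLp_comp_of_norm_sub_le (norm_move_sub_le hx hxy) (i3 i))
    have he : ∀ i, MemLp (fun ω => (runAt g W p z₀ D₀ ξ (t + 1) ω).v i -
        ∇ (f i) ((runAt g W p z₀ D₀ ξ (t + 1) ω).z i)) 2 Pr := by
      intro i
      by_cases ht : t % p.q = 0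
      · exact (memLp_restart_error W p z₀ hf hg hξ hD hx hxy hS₁ ht i).1
      · exact (memLp_update_error W p z₀ hf hg hξ hD hx hxy hS₂ ht i (i1 i) (hz i) (i2 i)).1
    refine ⟨hz, he, fun i => ?_⟩
    have e : (fun ω => (runAt g W p z₀ D₀ ξ (t + 1) ω).dir i) = _ :=
      funext fun ω => congrFun (run_succ_dir t) i
    rw [e]
    exact memLp_mix W (fun j => ((i3 j).add (hv (hz j) (he j))).sub (hv (i1 j) (i2 j))) i

end RunMoments

/-! ### One-step inequalities along a path -/

section PathwiseRun

variable {d m M : ℕ} {Ξ : Type*} {f : Fin M → Pt d m → ℝ} {g : Fin M → Pt d m → Ξ → Pt d m}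
  {W : Matrix (Fin M) (Fin M) ℝ} {p : Params} {z₀ : Fin M → Pt d m}
  {D₀ : (Fin M → Pt d m) → (Fin M → Pt d m)} {s : Fin M → ℕ → ℕ → Ξ} {L μ : ℝ}

lemma consensusError_move_le {ηx ηy : ℝ} (hx : 0 < ηx) (hxy : ηx ≤ ηy) (u : Fin M → Pt d m) :
    consensusError (fun i => move ηx ηy (u i)) ≤ ηy ^ 2 * consensusError u := by
  have e : avg (fun i => move ηx ηy (u i)) = move ηx ηy (avg u) := by
    simp only [avg, map_smul, map_sum]
  unfold consensusError
  rw [e, Finset.mul_sum]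
  refine Finset.sum_le_sum fun i _ => ?_
  rw [← mul_pow]
  exact pow_le_pow_left₀ (norm_nonneg _) (norm_move_sub_le hx hxy _ _) 2

lemma consensusError_z_succ_le (hM : 0 < M) (hW : W ∈ doublyStochastic ℝ (Fin M))
    (hρ : rho W < 1) (hx : 0 < p.ηx) (hxy : p.ηx ≤ p.ηy) (t : ℕ) :
    consensusError (run g W p z₀ D₀ s (t + 1)).z ≤
      rho W * consensusError (run g W p z₀ D₀ s t).z +
        2 * p.ηy ^ 2 / (1 - rho W) * consensusError (run g W p z₀ D₀ s t).dir := by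
  have e : (run g W p z₀ D₀ s (t + 1)).z = fun i =>
    mix W (run g W p z₀ D₀ s t).z i + move p.ηx p.ηy ((run g W p z₀ D₀ s t).dir i) :=
    funext fun i => run_succ_z t i
  rw [e]
  have h1 := consensusError_mix_add_le hM hW hρ (run g W p z₀ D₀ s t).z
    fun i => move p.ηx p.ηy ((run g W p z₀ D₀ s t).dir i)
  have h2 := consensusError_move_le hx hxy (run g W p z₀ D₀ s t).dir
  have h3 : 0 ≤ 2 / (1 - rho W) := by
    have : 0 < 1 - rho W := by linarith
    positivity
  have h4 := mul_le_mul_of_nonneg_left h2 h3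
  have e2 : 2 * p.ηy ^ 2 / (1 - rho W) * consensusError (run g W p z₀ D₀ s t).dir =
    2 / (1 - rho W) * (p.ηy ^ 2 * consensusError (run g W p z₀ D₀ s t).dir) := by ring
  rw [e2]
  linarith

lemma consensusError_dir_succ_le (hM : 0 < M) (hW : W ∈ doublyStochastic ℝ (Fin M))
    (hρ : rho W < 1) (t : ℕ) :
    consensusError (run g W p z₀ D₀ s (t + 1)).dir ≤
      rho W * consensusError (run g W p z₀ D₀ s t).dir + 2 / (1 - rho W) *
        ∑ i, ‖(run g W p z₀ D₀ s (t + 1)).v i - (run g W p z₀ D₀ s t).v i‖ ^ 2 := by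
  rw [run_succ_dir]
  simp only [add_sub_assoc]
  exact consensusError_mix_of_add_le hM hW hρ _ _

lemma sum_norm_z_sub_sq_le (hM : 0 < M) (hW : W ∈ doublyStochastic ℝ (Fin M))
    (hD : ∀ v, avg (D₀ v) = avg v) (t : ℕ) :
    ∑ i, ‖(run g W p z₀ D₀ s (t + 1)).z i - (run g W p z₀ D₀ s t).z i‖ ^ 2 ≤
      2 * consensusError (run g W p z₀ D₀ s (t + 1)).z +
        2 * consensusError (run g W p z₀ D₀ s t).z +
        M * p.ηx ^ 2 * ‖(avg (run g W p z₀ D₀ s t).v).fst‖ ^ 2 +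
        M * p.ηy ^ 2 * ‖(avg (run g W p z₀ D₀ s t).v).snd‖ ^ 2 := by
  have h := sum_norm_sub_sq_le hM (run g W p z₀ D₀ s (t + 1)).z (run g W p z₀ D₀ s t).z
  rw [avg_z_succ hW hD, add_sub_cancel_left, norm_move_sq] at h
  linarith

lemma norm_add_add_sq_le {E : Type*} [NormedAddCommGroup E] [InnerProductSpace ℝ E] (a b c : E) :
    ‖a + b + c‖ ^ 2 ≤ 3 * (‖a‖ ^ 2 + ‖b‖ ^ 2 + ‖c‖ ^ 2) := by
  have h1 := norm_add₃_le (a := a) (b := b) (c := c)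
  have h2 := pow_le_pow_left₀ (norm_nonneg _) h1 2
  nlinarith [sq_nonneg (‖a‖ - ‖b‖), sq_nonneg (‖b‖ - ‖c‖), sq_nonneg (‖a‖ - ‖c‖)]

/-- The increment of `v` splits into the new error, the change of the gradient and minus the old
error. The two states need not be consecutive. -/
lemma sum_norm_v_sub_sq_le (hf : ObjectiveAssumptions f L μ) (S S' : State d m M) :
    ∑ i, ‖S'.v i - S.v i‖ ^ 2 ≤
      3 * estError f S' + 3 * L ^ 2 * ∑ i, ‖S'.z i - S.z i‖ ^ 2 + 3 * estError f S := by
  unfold estError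
  rw [Finset.mul_sum, Finset.mul_sum, Finset.mul_sum, ← Finset.sum_add_distrib,
    ← Finset.sum_add_distrib]
  refine Finset.sum_le_sum fun i _ => ?_
  have h1 := norm_add_add_sq_le (S'.v i - ∇ (f i) (S'.z i)) (∇ (f i) (S'.z i) - ∇ (f i) (S.z i))
    (∇ (f i) (S.z i) - S.v i)
  have e : S'.v i - ∇ (f i) (S'.z i) + (∇ (f i) (S'.z i) - ∇ (f i) (S.z i)) +
    (∇ (f i) (S.z i) - S.v i) = S'.v i - S.v i := by abel
  rw [e, norm_sub_rev (∇ (f i) (S.z i)) (S.v i)] at h1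
  have h2 := pow_le_pow_left₀ (norm_nonneg _) (hf.smooth i (S'.z i) (S.z i)) 2
  rw [mul_pow] at h2
  linarith

/-- Jensen over the agents, then each local error is split at the local gradient `∇ f_i (z_i)`. -/
lemma norm_avg_v_sub_gradient_sq_le (hM : 0 < M) (hf : ObjectiveAssumptions f L μ)
    (S : State d m M) :
    ‖avg S.v - ∇ (globalObj f) (avg S.z)‖ ^ 2 ≤
      2 / M * estError f S + 2 / M * L ^ 2 * consensusError S.z := by
  have h1 := norm_avg_sq_le hM fun i => S.v i - ∇ (f i) (avg S.z)
  rw [avg_sub, ← hf.gradient_globalObj] at h1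
  have h2 : ∑ i, ‖S.v i - ∇ (f i) (avg S.z)‖ ^ 2 ≤
      2 * estError f S + 2 * (L ^ 2 * consensusError S.z) := by
    unfold estError consensusError
    rw [Finset.mul_sum, Finset.mul_sum, Finset.mul_sum, ← Finset.sum_add_distrib]
    refine Finset.sum_le_sum fun i _ => ?_
    have h3 := norm_add_sq_le_young (S.v i - ∇ (f i) (S.z i))
      (∇ (f i) (S.z i) - ∇ (f i) (avg S.z)) one_pos
    rw [sub_add_sub_cancel, inv_one] at h3
    have h4 := pow_le_pow_left₀ (norm_nonneg _) (hf.smooth i (S.z i) (avg S.z)) 2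
    rw [mul_pow] at h4
    linarith
  have h3 := mul_le_mul_of_nonneg_left h2 (by positivity : (0 : ℝ) ≤ (M : ℝ)⁻¹)
  refine (h1.trans h3).trans (le_of_eq ?_)
  ring

lemma norm_avg_v_snd_sq_le (S : State d m M) :
    ‖(avg S.v).snd‖ ^ 2 ≤ 2 * ‖(∇ (globalObj f) (avg S.z)).snd‖ ^ 2 +
      2 * ‖avg S.v - ∇ (globalObj f) (avg S.z)‖ ^ 2 := by
  have h := norm_add_sq_le_young (∇ (globalObj f) (avg S.z)).snd
    (avg S.v - ∇ (globalObj f) (avg S.z)).snd one_pos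
  have e : (∇ (globalObj f) (avg S.z)).snd + (avg S.v - ∇ (globalObj f) (avg S.z)).snd =
    (avg S.v).snd := by rw [WithLp.sub_snd]; abel
  rw [e, inv_one] at h
  have h2 := pow_le_pow_left₀ (norm_nonneg _)
    (norm_snd_le (avg S.v - ∇ (globalObj f) (avg S.z))) 2
  linarith

lemma avg_z_fst_succ (hW : W ∈ doublyStochastic ℝ (Fin M)) (hD : ∀ v, avg (D₀ v) = avg v)
    (t : ℕ) : (avg (run g W p z₀ D₀ s (t + 1)).z).fst =
      (avg (run g W p z₀ D₀ s t).z).fst - p.ηx • (avg (run g W p z₀ D₀ s t).v).fst := by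
  rw [avg_z_succ hW hD, WithLp.add_fst, move_apply, pair_fst, sub_eq_add_neg]

lemma avg_z_snd_succ (hW : W ∈ doublyStochastic ℝ (Fin M)) (hD : ∀ v, avg (D₀ v) = avg v)
    (t : ℕ) : (avg (run g W p z₀ D₀ s (t + 1)).z).snd =
      (avg (run g W p z₀ D₀ s t).z).snd + p.ηy • (avg (run g W p z₀ D₀ s t).v).snd := by
  rw [avg_z_succ hW hD, WithLp.add_snd, move_apply, pair_snd]

/-- Along every path, the gradient norms of the primal function and of `f` in `y` are controlled
by the initial gaps and by the errors of the averaged estimates. -/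
lemma pathwise_bounds (hM : 0 < M) (hm : 0 < m) (hf : ObjectiveAssumptions f L μ)
    (hW : W ∈ doublyStochastic ℝ (Fin M)) (hD : ∀ v, avg (D₀ v) = avg v)
    (hη : 0 < p.ηy) (hηL : p.ηy * L ≤ 1 / 100 / (L / μ)) (hx : 0 < p.ηx)
    (hx' : p.ηx ≤ 1 / 20 * (p.ηy / (L / μ) ^ 2)) (T : ℕ) :
    (∑ t ∈ Finset.range T, ‖∇ (primal f) (avg (run g W p z₀ D₀ s t).z).fst‖ ^ 2 +
        2 / 5 * ∑ t ∈ Finset.range T, ‖(avg (run g W p z₀ D₀ s t).v).fst‖ ^ 2 ≤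
      2 * (primalGap f z₀ / p.ηx) + 8 * (L * (L / μ) * dualGap f z₀ / p.ηy) +
        42 * (L / μ) ^ 2 * ∑ t ∈ Finset.range T, ‖avg (run g W p z₀ D₀ s t).v -
          ∇ (globalObj f) (avg (run g W p z₀ D₀ s t).z)‖ ^ 2) ∧
    ∑ t ∈ Finset.range T, ‖(∇ (globalObj f) (avg (run g W p z₀ D₀ s t).z)).snd‖ ^ 2 ≤
      2 * (L * dualGap f z₀ / p.ηy) +
        10 * (L / μ) * ∑ t ∈ Finset.range T, ‖avg (run g W p z₀ D₀ s t).v -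
          ∇ (globalObj f) (avg (run g W p z₀ D₀ s t).z)‖ ^ 2 +
        1 / 40 / (L / μ) * ∑ t ∈ Finset.range T, ‖(avg (run g W p z₀ D₀ s t).v).fst‖ ^ 2 := by
  have hF := hf.smoothConcave hM
  have hL := hf.L_pos
  have hμ := hf.mu_pos
  have hμL := hF.mu_le_L hm
  have hκ1 : 1 ≤ L / μ := by rwa [le_div_iff₀ hμ, one_mul]
  have hηL1 : p.ηy * L ≤ 1 / 100 := hηL.trans (div_le_self (by norm_num) hκ1)
  have hpair : ∀ z : Pt d m, pair z.fst z.snd = z := fun z => rfl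
  have hdual : ∀ t, ‖bestResponse f (avg (run g W p z₀ D₀ s (t + 1)).z).fst -
      (avg (run g W p z₀ D₀ s (t + 1)).z).snd‖ ^ 2 ≤
      (1 - p.ηy * μ / 4) * ‖bestResponse f (avg (run g W p z₀ D₀ s t).z).fst -
        (avg (run g W p z₀ D₀ s t).z).snd‖ ^ 2 -
      p.ηy / (2 * L) * ‖(∇ (globalObj f) (avg (run g W p z₀ D₀ s t).z)).snd‖ ^ 2 +
      5 * p.ηy / μ * ‖avg (run g W p z₀ D₀ s t).v -
          ∇ (globalObj f) (avg (run g W p z₀ D₀ s t).z)‖ ^ 2 +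
      5 * (L / μ) ^ 2 / (p.ηy * μ) *
        (p.ηx ^ 2 * ‖(avg (run g W p z₀ D₀ s t).v).fst‖ ^ 2) := by
    intro t
    have h := dual_contraction hF hμL hη (by linarith) (avg (run g W p z₀ D₀ s t).z).fst
      (avg (run g W p z₀ D₀ s (t + 1)).z).fst (avg (run g W p z₀ D₀ s t).z).snd
      (avg (run g W p z₀ D₀ s t).v)
    rw [← avg_z_snd_succ hW hD, hpair] at h
    refine h.trans (le_of_eq ?_)
    have e : ‖(avg (run g W p z₀ D₀ s (t + 1)).z).fst - (avg (run g W p z₀ D₀ s t).z).fst‖ ^ 2 =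
        p.ηx ^ 2 * ‖(avg (run g W p z₀ D₀ s t).v).fst‖ ^ 2 := by
      rw [avg_z_fst_succ hW hD, sub_sub_cancel_left, norm_neg, norm_smul, mul_pow,
        Real.norm_eq_abs, sq_abs]
    rw [e]
  -- As `κ ≥ 1`, the smoothness constant of `Φ` is at most `2 L κ²`, and `ηx κ² ≤ ηy / 20` reduces
  -- the claim to `ηy L / 10 ≤ 1/4`.
  have hsmall : p.ηx * (L * (L / μ) + L / 2) ≤ 1 / 4 := by
    have h1 : L * (L / μ) + L / 2 ≤ 2 * L * (L / μ) ^ 2 := by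
      have h2 : L / μ ≤ (L / μ) ^ 2 := by nlinarith
      have h3 := mul_le_mul_of_nonneg_left h2 hL.le
      have h4 := mul_le_mul_of_nonneg_left (hκ1.trans h2) hL.le
      linarith
    have h5 := mul_le_mul hx' h1 (by positivity) (by positivity)
    have e : 1 / 20 * (p.ηy / (L / μ) ^ 2) * (2 * L * (L / μ) ^ 2) = 1 / 10 * (p.ηy * L) := by
      field_simp
      norm_num
    rw [e] at h5
    linarith
  have hprimal : ∀ t, primal f (avg (run g W p z₀ D₀ s (t + 1)).z).fst ≤
      primal f (avg (run g W p z₀ D₀ s t).z).fst -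
      p.ηx / 2 * ‖∇ (primal f) (avg (run g W p z₀ D₀ s t).z).fst‖ ^ 2 -
      p.ηx / 4 * ‖(avg (run g W p z₀ D₀ s t).v).fst‖ ^ 2 +
      p.ηx * (L ^ 2 * ‖bestResponse f (avg (run g W p z₀ D₀ s t).z).fst -
        (avg (run g W p z₀ D₀ s t).z).snd‖ ^ 2 + ‖avg (run g W p z₀ D₀ s t).v -
          ∇ (globalObj f) (avg (run g W p z₀ D₀ s t).z)‖ ^ 2) := by
    intro t
    have h := primal_descent hF hx hsmall (avg (run g W p z₀ D₀ s t).z).fst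
      (avg (run g W p z₀ D₀ s t).z).snd (avg (run g W p z₀ D₀ s t).v)
    rwa [← avg_z_fst_succ hW hD, hpair] at h
  obtain ⟨b1, b2⟩ := dual_sum_bounds (η := p.ηy) (ηx := p.ηx)
    (δ := fun t => ‖bestResponse f (avg (run g W p z₀ D₀ s t).z).fst -
      (avg (run g W p z₀ D₀ s t).z).snd‖ ^ 2)
    (gy := fun t => ‖(∇ (globalObj f) (avg (run g W p z₀ D₀ s t).z)).snd‖ ^ 2)
    (e := fun t => ‖avg (run g W p z₀ D₀ s t).v -
      ∇ (globalObj f) (avg (run g W p z₀ D₀ s t).z)‖ ^ 2)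
    (vx := fun t => ‖(avg (run g W p z₀ D₀ s t).v).fst‖ ^ 2)
    hL hμ rfl hκ1 hη hx hx' (fun t => by positivity) (fun t => by positivity)
    (fun t => by positivity) hdual T
  refine ⟨?_, b2⟩
  exact primal_sum_bound
    (φ := fun t => primal f (avg (run g W p z₀ D₀ s t).z).fst)
    (gp := fun t => ‖∇ (primal f) (avg (run g W p z₀ D₀ s t).z).fst‖ ^ 2)
    (vx := fun t => ‖(avg (run g W p z₀ D₀ s t).v).fst‖ ^ 2)
    (Δ := primalGap f z₀) hκ1 hx
    (fun t => by positivity) (fun t => by positivity) hprimal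
    (fun t => sub_le_sub_left (ciInf_le hf.primal_bddBelow _) _) T b1

end PathwiseRun

/-! ### Passing linear inequalities to expectations -/

section Integrals

variable {Ω : Type*} [MeasurableSpace Ω] {Pr : Measure Ω}

lemma integral_le_lincomb {n : ℕ} {X : Ω → ℝ} {Y : Fin n → Ω → ℝ} {a : Fin n → ℝ}
    (hX : Integrable X Pr) (hY : ∀ i, Integrable (Y i) Pr) (h : ∀ ω, X ω ≤ ∑ i, a i * Y i ω) :
    ∫ ω, X ω ∂Pr ≤ ∑ i, a i * ∫ ω, Y i ω ∂Pr := by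
  have hi : ∀ i ∈ Finset.univ, Integrable (fun ω => a i * Y i ω) Pr := fun i _ =>
    (hY i).const_mul (a i)
  calc _ ≤ ∫ ω, ∑ i, a i * Y i ω ∂Pr := integral_mono hX (integrable_finsetSum _ hi) h
    _ = _ := by simp only [integral_finsetSum _ hi, integral_const_mul]

lemma integral_le_two {X Y Z : Ω → ℝ} {a b : ℝ} (hX : Integrable X Pr) (hY : Integrable Y Pr)
    (hZ : Integrable Z Pr) (h : ∀ ω, X ω ≤ a * Y ω + b * Z ω) :
    ∫ ω, X ω ∂Pr ≤ a * ∫ ω, Y ω ∂Pr + b * ∫ ω, Z ω ∂Pr := by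
  have := integral_le_lincomb (Y := ![Y, Z]) (a := ![a, b]) hX
    (by intro i; fin_cases i <;> assumption) (by simpa [Fin.sum_univ_succ] using h)
  simpa [Fin.sum_univ_succ] using this

lemma integral_le_three {X Y Z U : Ω → ℝ} {a b c : ℝ} (hX : Integrable X Pr)
    (hY : Integrable Y Pr) (hZ : Integrable Z Pr) (hU : Integrable U Pr)
    (h : ∀ ω, X ω ≤ a * Y ω + b * Z ω + c * U ω) :
    ∫ ω, X ω ∂Pr ≤ a * ∫ ω, Y ω ∂Pr + b * ∫ ω, Z ω ∂Pr + c * ∫ ω, U ω ∂Pr := by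
  have := integral_le_lincomb (Y := ![Y, Z, U]) (a := ![a, b, c]) hX
    (by intro i; fin_cases i <;> assumption)
    (by simpa [Fin.sum_univ_succ, add_assoc] using h)
  simpa [Fin.sum_univ_succ, add_assoc] using this

lemma integral_le_four {X Y Z U V : Ω → ℝ} {a b c e : ℝ} (hX : Integrable X Pr)
    (hY : Integrable Y Pr) (hZ : Integrable Z Pr) (hU : Integrable U Pr) (hV : Integrable V Pr)
    (h : ∀ ω, X ω ≤ a * Y ω + b * Z ω + c * U ω + e * V ω) :
    ∫ ω, X ω ∂Pr ≤ a * ∫ ω, Y ω ∂Pr + b * ∫ ω, Z ω ∂Pr + c * ∫ ω, U ω ∂Pr + e * ∫ ω, V ω ∂Pr := by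
  have := integral_le_lincomb (Y := ![Y, Z, U, V]) (a := ![a, b, c, e]) hX
    (by intro i; fin_cases i <;> assumption)
    (by simpa [Fin.sum_univ_succ, add_assoc] using h)
  simpa [Fin.sum_univ_succ, add_assoc] using this

variable {M : ℕ} {E : Type*} [NormedAddCommGroup E]

lemma integrable_sum_norm_sq {u : Fin M → Ω → E} (hu : ∀ i, MemLp (u i) 2 Pr) :
    Integrable (fun ω => ∑ i, ‖u i ω‖ ^ 2) Pr :=
  integrable_finsetSum _ fun i _ => integrable_norm_sq_of_memLp (hu i)

variable [InnerProductSpace ℝ E]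

lemma integrable_consensusError {u : Fin M → Ω → E} (hu : ∀ i, MemLp (u i) 2 Pr) :
    Integrable (fun ω => consensusError fun i => u i ω) Pr :=
  integrable_sum_norm_sq fun i => (hu i).sub (memLp_avg hu)

end Integrals

/-! ### Expected error of the variance-reduced estimates -/

section Main

variable {d m M : ℕ} {Ω Ξ : Type*} [MeasurableSpace Ξ] {P : Fin M → Measure Ξ}
  {f : Fin M → Pt d m → ℝ} {g : Fin M → Pt d m → Ξ → Pt d m} {L μ σ : ℝ}
  {W : Matrix (Fin M) (Fin M) ℝ} {p : Params}
  {z₀ : Fin M → Pt d m} {D₀ : (Fin M → Pt d m) → (Fin M → Pt d m)}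
  {ξ : Fin M → ℕ → ℕ → Ω → Ξ}
  [MeasurableSpace Ω] {Pr : Measure Ω} [IsProbabilityMeasure Pr]
  (hf : ObjectiveAssumptions f L μ) (hg : OracleAssumptions f g P L σ)
  (hξ : SampleAssumptions Pr P ξ)
  (hD : Measurable D₀) (hx : 0 < p.ηx) (hxy : p.ηx ≤ p.ηy)
  (hD2 : ∀ i, MemLp (fun ω => (initState g p z₀ D₀ fun j k => ξ j 0 k ω).dir i) 2 Pr)
  (hS₁ : 1 ≤ p.S₁) (hS₂ : 1 ≤ p.S₂)
include hf hg hξ hD hx hxy hD2 hS₁ hS₂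

lemma memLp_run_z (t : ℕ) (i : Fin M) :
    MemLp (fun ω => (runAt g W p z₀ D₀ ξ t ω).z i) 2 Pr :=
  (memLp_run W p z₀ hf hg hξ hD hx hxy hD2 hS₁ hS₂ t).1 i

lemma memLp_run_error (t : ℕ) (i : Fin M) :
    MemLp (fun ω => (runAt g W p z₀ D₀ ξ t ω).v i -
      ∇ (f i) ((runAt g W p z₀ D₀ ξ t ω).z i)) 2 Pr :=
  (memLp_run W p z₀ hf hg hξ hD hx hxy hD2 hS₁ hS₂ t).2.1 i

lemma memLp_run_dir (t : ℕ) (i : Fin M) :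
    MemLp (fun ω => (runAt g W p z₀ D₀ ξ t ω).dir i) 2 Pr :=
  (memLp_run W p z₀ hf hg hξ hD hx hxy hD2 hS₁ hS₂ t).2.2 i

lemma memLp_run_v (t : ℕ) (i : Fin M) :
    MemLp (fun ω => (runAt g W p z₀ D₀ ξ t ω).v i) 2 Pr := by
  have h3 := (memLp_run_error (W := W) hf hg hξ hD hx hxy hD2 hS₁ hS₂ t i).add
    (memLp_comp_of_norm_sub_le (hf.smooth i)
      (memLp_run_z (W := W) hf hg hξ hD hx hxy hD2 hS₁ hS₂ t i))
  refine h3.ae_eq (Filter.Eventually.of_forall fun ω => ?_)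
  simp

lemma integrable_run_estError (t : ℕ) :
    Integrable (fun ω => estError f (runAt g W p z₀ D₀ ξ t ω)) Pr :=
  integrable_sum_norm_sq fun i => memLp_run_error hf hg hξ hD hx hxy hD2 hS₁ hS₂ t i

lemma memLp_avg_z (t : ℕ) : MemLp (fun ω => avg (runAt g W p z₀ D₀ ξ t ω).z) 2 Pr :=
  memLp_avg fun i => memLp_run_z hf hg hξ hD hx hxy hD2 hS₁ hS₂ t i

lemma memLp_avg_v (t : ℕ) : MemLp (fun ω => avg (runAt g W p z₀ D₀ ξ t ω).v) 2 Pr :=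
  memLp_avg fun i => memLp_run_v hf hg hξ hD hx hxy hD2 hS₁ hS₂ t i

lemma memLp_gradient_primal (hM : 0 < M) (t : ℕ) :
    MemLp (fun ω => ∇ (primal f) (avg (runAt g W p z₀ D₀ ξ t ω).z).fst) 2 Pr :=
  memLp_comp_of_norm_sub_le (norm_gradient_primal_sub_le (hf.smoothConcave hM))
    (memLp_comp_of_norm_sub_le norm_fst_sub_le
      (memLp_avg_z (W := W) hf hg hξ hD hx hxy hD2 hS₁ hS₂ t))

lemma memLp_gradient_globalObj (hM : 0 < M) (t : ℕ) :
    MemLp (fun ω => ∇ (globalObj f) (avg (runAt g W p z₀ D₀ ξ t ω).z)) 2 Pr :=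
  memLp_comp_of_norm_sub_le (hf.smoothConcave hM).smooth
    (memLp_avg_z (W := W) hf hg hξ hD hx hxy hD2 hS₁ hS₂ t)

/-- Total expected error of the variance-reduced estimates. -/
lemma sum_integral_estError_le (hq : 1 ≤ p.q) (hqS : p.q ≤ p.S₂) (n : ℕ) :
    ∑ t ∈ Finset.range (n + 1), ∫ ω, estError f (runAt g W p z₀ D₀ ξ t ω) ∂Pr ≤
      (n + 1) * (M * (σ ^ 2 / p.S₁)) + L ^ 2 * ∑ t ∈ Finset.range n,
        ∫ ω, ∑ i, ‖(runAt g W p z₀ D₀ ξ (t + 1) ω).z i -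
          (runAt g W p z₀ D₀ ξ t ω).z i‖ ^ 2 ∂Pr := by
  have hmem := memLp_run_error (W := W) hf hg hξ hD hx hxy hD2 hS₁ hS₂
  have hz := memLp_run_z (W := W) hf hg hξ hD hx hxy hD2 hS₁ hS₂
  have hsum : ∀ t, ∫ ω, estError f (runAt g W p z₀ D₀ ξ t ω) ∂Pr =
      ∑ i, ∫ ω, ‖(runAt g W p z₀ D₀ ξ t ω).v i -
        ∇ (f i) ((runAt g W p z₀ D₀ ξ t ω).z i)‖ ^ 2 ∂Pr := fun t =>
    integral_finsetSum _ fun i _ => integrable_norm_sq_of_memLp (hmem t i)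
  have hzd : ∀ t, ∫ ω, ∑ i, ‖(runAt g W p z₀ D₀ ξ (t + 1) ω).z i -
      (runAt g W p z₀ D₀ ξ t ω).z i‖ ^ 2 ∂Pr =
      ∑ i, ∫ ω, ‖(runAt g W p z₀ D₀ ξ (t + 1) ω).z i -
        (runAt g W p z₀ D₀ ξ t ω).z i‖ ^ 2 ∂Pr := fun t =>
    integral_finsetSum _ fun i _ => integrable_norm_sq_of_memLp ((hz (t + 1) i).sub (hz t i))
  have hconst : ∀ a : Fin M → ℝ, (∀ i, a i ≤ σ ^ 2 / p.S₁) →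
      ∑ i, a i ≤ M * (σ ^ 2 / p.S₁) := fun a ha => by
    refine (Finset.sum_le_sum fun i _ => ha i).trans (le_of_eq ?_)
    simp
  have h := sum_le_of_restart (w := fun t => ∫ ω, estError f (runAt g W p z₀ D₀ ξ t ω) ∂Pr)
    (z := fun t => ∫ ω, ∑ i, ‖(runAt g W p z₀ D₀ ξ (t + 1) ω).z i -
          (runAt g W p z₀ D₀ ξ t ω).z i‖ ^ 2 ∂Pr) (a := M * (σ ^ 2 / p.S₁)) (β := L ^ 2 / p.S₂)
    hq (by positivity) (fun t => integral_nonneg fun ω => Finset.sum_nonneg fun i _ => by positivity)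
    (by
      rw [hsum]
      exact hconst _ fun i => (memLp_initial_error W p z₀ hf hg hξ hS₁ i).2)
    (fun t ht => by
      rw [hsum]
      exact hconst _ fun i => (memLp_restart_error W p z₀ hf hg hξ hD hx hxy hS₁ ht i).2)
    (fun t ht => by
      rw [hsum, hsum, hzd, Finset.mul_sum, ← Finset.sum_add_distrib]
      exact Finset.sum_le_sum fun i _ => (memLp_update_error W p z₀ hf hg hξ hD hx hxy hS₂ ht i
        (hz t i) (hz (t + 1) i) (hmem t i)).2) n
  -- Each increment is counted up to `q` times with variance factor `L² / S₂`; `q ≤ S₂` leaves `L²`.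
  refine h.trans (add_le_add le_rfl (mul_le_mul_of_nonneg_right ?_
    (Finset.sum_nonneg fun t _ => integral_nonneg fun ω => Finset.sum_nonneg fun i _ => by
      positivity)))
  have hS : (0 : ℝ) < p.S₂ := by exact_mod_cast hS₂
  rw [mul_div_assoc', div_le_iff₀ hS, mul_comm]
  exact mul_le_mul_of_nonneg_left (by exact_mod_cast hqS) (by positivity)

end Main

/-- Solving the coupled recursions for the expected consensus errors `cz`, `cd`, increments `dv`,
`zd`, variances `vr` and gradient errors `er` for the sum of the latter. -/
lemma error_sum_le_of_recursions {L κ η ηx ρ m Λ N δ₀ : ℝ} {cz cd dv zd vr er vx vy gy : ℕ → ℝ}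
    {n : ℕ} (hL : 0 < L) (hκ1 : 1 ≤ κ) (hη : 0 < η) (hηx : 0 < ηx)
    (hηx' : ηx ≤ 1 / 20 * (η / κ ^ 2)) (hρ0 : 0 ≤ ρ) (hρ1 : ρ < 1)
    (hηθ : η * L ≤ 1 / 100 * (1 - ρ) ^ 2) (hηκ : η * L ≤ 1 / 100 / κ)
    (hm : 0 < m) (hN : 0 ≤ N) (hδ₀ : 0 ≤ δ₀) (hΛ : 0 ≤ Λ)
    (cz0 : ∀ t, 0 ≤ cz t) (cd0 : ∀ t, 0 ≤ cd t) (zd0 : ∀ t, 0 ≤ zd t) (vr0 : ∀ t, 0 ≤ vr t)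
    (er0 : ∀ t, 0 ≤ er t) (vx0 : ∀ t, 0 ≤ vx t) (vy0 : ∀ t, 0 ≤ vy t)
    (hcz0 : cz 0 ≤ Λ) (hcd0 : cd 0 ≤ L ^ 2 * Λ)
    (hcz : ∀ t, cz (t + 1) ≤ ρ * cz t + 2 * η ^ 2 / (1 - ρ) * cd t)
    (hcd : ∀ t, cd (t + 1) ≤ ρ * cd t + 2 / (1 - ρ) * dv t)
    (hdv : ∀ t, dv t ≤ 3 * vr (t + 1) + 3 * L ^ 2 * zd t + 3 * vr t)
    (hvr : ∑ t ∈ Finset.range (n + 1), vr t ≤ m * N + L ^ 2 * ∑ t ∈ Finset.range n, zd t)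
    (hzd : ∀ t, zd t ≤ 2 * cz (t + 1) + 2 * cz t + m * ηx ^ 2 * vx t + m * η ^ 2 * vy t)
    (her : ∀ t, er t ≤ 2 / m * vr t + 2 / m * L ^ 2 * cz t)
    (hvy : ∀ t, vy t ≤ 2 * gy t + 2 * er t)
    (hgy : ∑ t ∈ Finset.range (n + 1), gy t ≤ 2 * (L * δ₀ / η) +
      10 * κ * ∑ t ∈ Finset.range (n + 1), er t +
        1 / 40 / κ * ∑ t ∈ Finset.range (n + 1), vx t) :
    42 * κ ^ 2 * ∑ t ∈ Finset.range (n + 1), er t ≤ 588 * (κ ^ 2 * N) +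
      924 * (κ ^ 2 * (L ^ 2 * Λ / ((1 - ρ) * m))) + L * κ * δ₀ / η +
        2 / 5 * ∑ t ∈ Finset.range (n + 1), vx t := by
  have hθ : 0 < 1 - ρ := by linarith
  have hnn : ∀ {a : ℕ → ℝ} (_ : ∀ t, 0 ≤ a t) (k : ℕ), 0 ≤ ∑ t ∈ Finset.range k, a t :=
    fun h k => Finset.sum_nonneg fun t _ => h t
  -- Increments over `n` steps involve the times `0, …, n`. Both the plain and the shifted sums of
  -- length `n` are dominated by the sum of length `n + 1`.
  have hsucc : ∀ {a : ℕ → ℝ} (_ : ∀ t, 0 ≤ a t),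
      ∑ t ∈ Finset.range n, a t ≤ ∑ t ∈ Finset.range (n + 1), a t := fun h => by
    rw [Finset.sum_range_succ]; linarith [h n]
  have hshift : ∀ {a : ℕ → ℝ} (_ : ∀ t, 0 ≤ a t),
      ∑ t ∈ Finset.range n, a (t + 1) ≤ ∑ t ∈ Finset.range (n + 1), a t := fun h => by
    rw [Finset.sum_range_succ']; linarith [h 0]
  have s1 := mul_sum_le_of_contraction (a := cz) (c := fun t => 2 * η ^ 2 / (1 - ρ) * cd t)
    (θ := 1 - ρ) (by linarith) cz0 (fun t => by linarith [hcz t]) n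
  have s2 := mul_sum_le_of_contraction (a := cd) (c := fun t => 2 / (1 - ρ) * dv t)
    (θ := 1 - ρ) (by linarith) cd0 (fun t => by linarith [hcd t]) n
  rw [← Finset.mul_sum] at s1 s2
  have s1' := mul_le_mul_of_nonneg_left (hsucc cd0) (by positivity : 0 ≤ 2 * η ^ 2 / (1 - ρ))
  have s3 := Finset.sum_le_sum (s := Finset.range n) fun t _ => hdv t
  simp only [Finset.sum_add_distrib, ← Finset.mul_sum] at s3
  have s4 := Finset.sum_le_sum (s := Finset.range n) fun t _ => hzd t
  simp only [Finset.sum_add_distrib, ← Finset.mul_sum] at s4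
  have s5 := Finset.sum_le_sum (s := Finset.range (n + 1)) fun t _ => her t
  simp only [Finset.sum_add_distrib, ← Finset.mul_sum] at s5
  have s6 := Finset.sum_le_sum (s := Finset.range (n + 1)) fun t _ => hvy t
  simp only [Finset.sum_add_distrib, ← Finset.mul_sum] at s6
  have r1 := hsucc vr0
  have r2 := hshift vr0
  have r3 := hsucc cz0
  have r4 := hshift cz0
  have r5 := mul_le_mul_of_nonneg_left (hsucc vx0) (by positivity : 0 ≤ m * ηx ^ 2)
  have r6 := mul_le_mul_of_nonneg_left (hsucc vy0) (by positivity : 0 ≤ m * η ^ 2)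
  have hse := error_sum_le_of_consensus (L := L) (η := η) (θ := 1 - ρ) (m := m) (Λ := Λ) (N := N)
    (Q := ηx ^ 2 * ∑ t ∈ Finset.range (n + 1), vx t + η ^ 2 * ∑ t ∈ Finset.range (n + 1), vy t)
    (cz := cz 0) (cd := cd 0) (sz := ∑ t ∈ Finset.range (n + 1), cz t)
    (sd := ∑ t ∈ Finset.range (n + 1), cd t) (sV := ∑ t ∈ Finset.range n, dv t)
    (sr := ∑ t ∈ Finset.range (n + 1), vr t) (szd := ∑ t ∈ Finset.range n, zd t)
    (se := ∑ t ∈ Finset.range (n + 1), er t)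
    hL hη hθ (by linarith) hηθ hm hN hΛ hcz0 hcd0
    (by have := hnn vx0 (n + 1); have := hnn vy0 (n + 1); positivity) (hnn zd0 n)
    (by linarith) s2 (by linarith) hvr (by linarith) (by linarith)
  exact error_sum_bound hL hκ1 hη hηx hηx' hηκ hN hδ₀ (hnn er0 _) (hnn vx0 _) hse s6 hgy

/-! ### The expected sum of squared gradient norms -/

section Main

variable {d m M : ℕ} {Ω Ξ : Type*} [MeasurableSpace Ξ] {P : Fin M → Measure Ξ}
  {f : Fin M → Pt d m → ℝ} {g : Fin M → Pt d m → Ξ → Pt d m} {L μ σ : ℝ}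
  {W : Matrix (Fin M) (Fin M) ℝ} {p : Params}
  {z₀ : Fin M → Pt d m} {D₀ : (Fin M → Pt d m) → (Fin M → Pt d m)}
  {ξ : Fin M → ℕ → ℕ → Ω → Ξ}
  [MeasurableSpace Ω] {Pr : Measure Ω} [IsProbabilityMeasure Pr]

/-- The total expected squared gradient norm of the primal function along the averaged iterates. -/
lemma sum_integral_gradient_primal_le (hM : 0 < M) (hm : 0 < m)
    (hf : ObjectiveAssumptions f L μ) (hg : OracleAssumptions f g P L σ)
    (hξ : SampleAssumptions Pr P ξ) (hW : W ∈ doublyStochastic ℝ (Fin M)) (hρ : rho W < 1)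
    (hD : Measurable D₀) (hDavg : ∀ v, avg (D₀ v) = avg v)
    (hD2 : ∀ i, MemLp (fun ω => (initState g p z₀ D₀ fun j k => ξ j 0 k ω).dir i) 2 Pr)
    (hη : 0 < p.ηy) (hηθ : p.ηy * L ≤ 1 / 100 * (1 - rho W) ^ 2)
    (hηκ : p.ηy * L ≤ 1 / 100 / (L / μ)) (hx : 0 < p.ηx)
    (hx' : p.ηx ≤ 1 / 20 * (p.ηy / (L / μ) ^ 2))
    (hS₁ : 1 ≤ p.S₁) (hq : 1 ≤ p.q) (hqS : p.q ≤ p.S₂) (n : ℕ) :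
    ∑ t ∈ Finset.range (n + 1),
        ∫ ω, ‖∇ (primal f) (avg (runAt g W p z₀ D₀ ξ t ω).z).fst‖ ^ 2 ∂Pr ≤
      2 * (primalGap f z₀ / p.ηx) + 9 * (L * (L / μ) * dualGap f z₀ / p.ηy) +
      924 * (L ^ 2 * (L / μ) ^ 2 * initConsensus Pr g p L z₀ D₀ ξ / ((1 - rho W) * M)) +
      588 * ((L / μ) ^ 2 * ((n + 1) * (σ ^ 2 / p.S₁))) := by
  have hF := hf.smoothConcave hM
  have hL := hf.L_pos
  have hμ := hf.mu_pos
  have hκ1 : 1 ≤ L / μ := by rw [le_div_iff₀ hμ, one_mul]; exact hF.mu_le_L hm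
  have hxy : p.ηx ≤ p.ηy := by
    refine hx'.trans ?_
    have : p.ηy / (L / μ) ^ 2 ≤ p.ηy := div_le_self hη.le (one_le_pow₀ hκ1)
    linarith
  have hS₂ : 1 ≤ p.S₂ := hq.trans hqS
  have hM' : (0 : ℝ) < M := by exact_mod_cast hM
  have mz := memLp_run_z (W := W) hf hg hξ hD hx hxy hD2 hS₁ hS₂
  have mv := memLp_run_v (W := W) hf hg hξ hD hx hxy hD2 hS₁ hS₂
  have md := memLp_run_dir (W := W) hf hg hξ hD hx hxy hD2 hS₁ hS₂
  have maz := memLp_avg_z (W := W) hf hg hξ hD hx hxy hD2 hS₁ hS₂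
  have mav := memLp_avg_v (W := W) hf hg hξ hD hx hxy hD2 hS₁ hS₂
  have mgF := memLp_gradient_globalObj (W := W) hf hg hξ hD hx hxy hD2 hS₁ hS₂ hM
  have icz : ∀ t, Integrable (fun ω => consensusError (runAt g W p z₀ D₀ ξ t ω).z) Pr :=
    fun t => integrable_consensusError (mz t)
  have icd : ∀ t, Integrable (fun ω => consensusError (runAt g W p z₀ D₀ ξ t ω).dir) Pr :=
    fun t => integrable_consensusError (md t)
  have idv : ∀ t, Integrable (fun ω => ∑ i, ‖(runAt g W p z₀ D₀ ξ (t + 1) ω).v i -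
      (runAt g W p z₀ D₀ ξ t ω).v i‖ ^ 2) Pr :=
    fun t => integrable_sum_norm_sq fun i => (mv (t + 1) i).sub (mv t i)
  have izd : ∀ t, Integrable (fun ω => ∑ i, ‖(runAt g W p z₀ D₀ ξ (t + 1) ω).z i -
      (runAt g W p z₀ D₀ ξ t ω).z i‖ ^ 2) Pr :=
    fun t => integrable_sum_norm_sq fun i => (mz (t + 1) i).sub (mz t i)
  have ivr := integrable_run_estError (W := W) hf hg hξ hD hx hxy hD2 hS₁ hS₂
  have ier : ∀ t, Integrable (fun ω => ‖avg (runAt g W p z₀ D₀ ξ t ω).v -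
      ∇ (globalObj f) (avg (runAt g W p z₀ D₀ ξ t ω).z)‖ ^ 2) Pr :=
    fun t => integrable_norm_sq_of_memLp ((mav t).sub (mgF t))
  have ivx : ∀ t, Integrable (fun ω => ‖(avg (runAt g W p z₀ D₀ ξ t ω).v).fst‖ ^ 2) Pr :=
    fun t => integrable_norm_sq_of_memLp (memLp_comp_of_norm_sub_le norm_fst_sub_le (mav t))
  have ivy : ∀ t, Integrable (fun ω => ‖(avg (runAt g W p z₀ D₀ ξ t ω).v).snd‖ ^ 2) Pr :=
    fun t => integrable_norm_sq_of_memLp (memLp_comp_of_norm_sub_le norm_snd_sub_le (mav t))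
  have igy : ∀ t, Integrable (fun ω =>
      ‖(∇ (globalObj f) (avg (runAt g W p z₀ D₀ ξ t ω).z)).snd‖ ^ 2) Pr :=
    fun t => integrable_norm_sq_of_memLp (memLp_comp_of_norm_sub_le norm_snd_sub_le (mgF t))
  have igp : ∀ t, Integrable (fun ω =>
      ‖∇ (primal f) (avg (runAt g W p z₀ D₀ ξ t ω).z).fst‖ ^ 2) Pr :=
    fun t => integrable_norm_sq_of_memLp
      (memLp_gradient_primal hf hg hξ hD hx hxy hD2 hS₁ hS₂ hM t)
  have hpath := fun ω => pathwise_bounds (g := g) (s := fun i t k => ξ i t k ω) hM hm hf hW hDavg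
    hη hηκ hx hx' (z₀ := z₀) (n + 1)
  have hsumI : ∀ {X : ℕ → Ω → ℝ}, (∀ t, Integrable (X t) Pr) →
      Integrable (fun ω => ∑ t ∈ Finset.range (n + 1), X t ω) Pr := fun h =>
    integrable_finsetSum _ fun t _ => h t
  have hsumE : ∀ {X : ℕ → Ω → ℝ}, (∀ t, Integrable (X t) Pr) →
      ∫ ω, ∑ t ∈ Finset.range (n + 1), X t ω ∂Pr = ∑ t ∈ Finset.range (n + 1), ∫ ω, X t ω ∂Pr :=
    fun h => integral_finsetSum _ fun t _ => h t
  -- The deterministic initial gaps enter the linear combinations below as multiples of the constant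
  -- function `1`.
  have hone : ∫ _ : Ω, (1 : ℝ) ∂Pr = 1 := by simp
  have hgp := integral_le_three (Pr := Pr)
    (a := 2 * (primalGap f z₀ / p.ηx) + 8 * (L * (L / μ) * dualGap f z₀ / p.ηy)) (b := -(2 / 5))
    (c := 42 * (L / μ) ^ 2)
    (hsumI igp) (integrable_const (1 : ℝ)) (hsumI ivx) (hsumI ier)
    (fun ω => by have := (hpath ω).1; simp only [runAt]; linarith)
  have hgy := integral_le_three (Pr := Pr)
    (a := 2 * (L * dualGap f z₀ / p.ηy)) (b := 10 * (L / μ))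
    (c := 1 / 40 / (L / μ))
    (hsumI igy) (integrable_const (1 : ℝ)) (hsumI ier) (hsumI ivx)
    (fun ω => by have := (hpath ω).2; simp only [runAt]; linarith)
  rw [hsumE igp, hsumE ivx, hsumE ier, hone] at hgp
  rw [hsumE igy, hsumE ivx, hsumE ier, hone] at hgy
  have hcz0 : ∫ ω, consensusError (runAt g W p z₀ D₀ ξ 0 ω).z ∂Pr ≤
      initConsensus Pr g p L z₀ D₀ ξ := by
    have e : ∫ ω, consensusError (runAt g W p z₀ D₀ ξ 0 ω).z ∂Pr = consensusError z₀ := by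
      have : ∀ ω, (runAt g W p z₀ D₀ ξ 0 ω).z = z₀ := fun ω => rfl
      simp only [this, integral_const, probReal_univ, one_smul]
    rw [e]
    exact le_max_left _ _
  have hcd0 : ∫ ω, consensusError (runAt g W p z₀ D₀ ξ 0 ω).dir ∂Pr ≤
      L ^ 2 * initConsensus Pr g p L z₀ D₀ ξ := by
    rw [← div_le_iff₀' (by positivity)]
    exact le_max_right _ _
  have hΛ : 0 ≤ initConsensus Pr g p L z₀ D₀ ξ :=
    (consensusError_nonneg z₀).trans (le_max_left _ _)
  have hvr := sum_integral_estError_le (W := W) hf hg hξ hD hx hxy hD2 hS₁ hS₂ hq hqS n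
  have hmain := error_sum_le_of_recursions (L := L) (κ := L / μ) (η := p.ηy) (ηx := p.ηx)
    (ρ := rho W) (m := M) (Λ := initConsensus Pr g p L z₀ D₀ ξ)
    (N := (n + 1) * (σ ^ 2 / p.S₁)) (δ₀ := dualGap f z₀) (n := n)
    (cz := fun t => ∫ ω, consensusError (runAt g W p z₀ D₀ ξ t ω).z ∂Pr)
    (cd := fun t => ∫ ω, consensusError (runAt g W p z₀ D₀ ξ t ω).dir ∂Pr)
    (dv := fun t => ∫ ω, ∑ i, ‖(runAt g W p z₀ D₀ ξ (t + 1) ω).v i -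
      (runAt g W p z₀ D₀ ξ t ω).v i‖ ^ 2 ∂Pr)
    (zd := fun t => ∫ ω, ∑ i, ‖(runAt g W p z₀ D₀ ξ (t + 1) ω).z i -
      (runAt g W p z₀ D₀ ξ t ω).z i‖ ^ 2 ∂Pr)
    (vr := fun t => ∫ ω, estError f (runAt g W p z₀ D₀ ξ t ω) ∂Pr)
    (er := fun t => ∫ ω, ‖avg (runAt g W p z₀ D₀ ξ t ω).v -
      ∇ (globalObj f) (avg (runAt g W p z₀ D₀ ξ t ω).z)‖ ^ 2 ∂Pr)
    (vx := fun t => ∫ ω, ‖(avg (runAt g W p z₀ D₀ ξ t ω).v).fst‖ ^ 2 ∂Pr)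
    (vy := fun t => ∫ ω, ‖(avg (runAt g W p z₀ D₀ ξ t ω).v).snd‖ ^ 2 ∂Pr)
    (gy := fun t => ∫ ω, ‖(∇ (globalObj f) (avg (runAt g W p z₀ D₀ ξ t ω).z)).snd‖ ^ 2 ∂Pr)
    hL hκ1 hη hx hx' (norm_nonneg _) hρ hηθ hηκ hM' (by positivity) (sq_nonneg _) hΛ
    (fun t => integral_nonneg fun ω => consensusError_nonneg _)
    (fun t => integral_nonneg fun ω => consensusError_nonneg _)
    (fun t => integral_nonneg fun ω => Finset.sum_nonneg fun i _ => by positivity)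
    (fun t => integral_nonneg fun ω => Finset.sum_nonneg fun i _ => by positivity)
    (fun t => integral_nonneg fun ω => by positivity)
    (fun t => integral_nonneg fun ω => by positivity)
    (fun t => integral_nonneg fun ω => by positivity) hcz0 hcd0
    (fun t => integral_le_two (icz (t + 1)) (icz t) (icd t) fun ω =>
      consensusError_z_succ_le hM hW hρ hx hxy t)
    (fun t => integral_le_two (icd (t + 1)) (icd t) (idv t) fun ω =>
      consensusError_dir_succ_le hM hW hρ t)
    (fun t => integral_le_three (idv t) (ivr (t + 1)) (izd t) (ivr t) fun ω =>
      sum_norm_v_sub_sq_le hf (runAt g W p z₀ D₀ ξ t ω) (runAt g W p z₀ D₀ ξ (t + 1) ω))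
    (by refine hvr.trans (le_of_eq ?_); ring)
    (fun t => integral_le_four (izd t) (icz (t + 1)) (icz t) (ivx t) (ivy t) fun ω =>
      sum_norm_z_sub_sq_le hM hW hDavg t)
    (fun t => integral_le_two (ier t) (ivr t) (icz t) fun ω =>
      norm_avg_v_sub_gradient_sq_le hM hf _)
    (fun t => integral_le_two (ivy t) (igy t) (ier t) fun ω => norm_avg_v_snd_sq_le _)
    (by linarith)
  have e1 : (L / μ) ^ 2 * (L ^ 2 * initConsensus Pr g p L z₀ D₀ ξ / ((1 - rho W) * M)) =
    L ^ 2 * (L / μ) ^ 2 * initConsensus Pr g p L z₀ D₀ ξ / ((1 - rho W) * M) := by ring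
  rw [e1] at hmain
  -- The `2/5 ∑ E ‖v̄_x‖²` in `hmain` cancels the negative term in `hgp`; the coefficient `9` of the
  -- dual gap is `8 + 1`.
  linarith

end Main

/-! ### Counting iterations and samples -/

section Complexity

lemma sum_range_ite_mod_eq {q : ℕ} (hq : 1 ≤ q) (T : ℕ) :
    ∑ t ∈ Finset.range T, (if t % q = 0 then 1 else 0) = (T + q - 1) / q := by
  induction T with
  | zero =>
    rw [Finset.sum_range_zero, eq_comm, Nat.div_eq_zero_iff]
    omega
  | succ T ih =>
    rw [Finset.sum_range_succ, ih]
    have e : T + 1 + q - 1 = (T + q - 1) + 1 := by omega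
    rw [e, Nat.succ_div]
    have e2 : T + q - 1 + 1 = T + q := by omega
    have h : q ∣ T + q - 1 + 1 ↔ T % q = 0 := by
      rw [e2, Nat.dvd_iff_mod_eq_zero, Nat.add_mod_right]
    simp only [h]

lemma oracleCalls_le (p : Params) (hq : 1 ≤ p.q) (T : ℕ) :
    (oracleCalls p T : ℝ) ≤ ((T : ℝ) / p.q + 2) * p.S₁ + 2 * T * p.S₂ := by
  have hq' : (0 : ℝ) < p.q := by exact_mod_cast hq
  have h1 : ∑ t ∈ Finset.range T, (if t % p.q = 0 then p.S₁ else 2 * p.S₂) ≤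
      (T + p.q - 1) / p.q * p.S₁ + T * (2 * p.S₂) := by
    rw [← sum_range_ite_mod_eq hq, Finset.sum_mul]
    have e : T * (2 * p.S₂) = ∑ _t ∈ Finset.range T, 2 * p.S₂ := by simp
    rw [e, ← Finset.sum_add_distrib]
    refine Finset.sum_le_sum fun t _ => ?_
    split_ifs <;> omega
  have h2 : (((T + p.q - 1) / p.q : ℕ) : ℝ) ≤ (T : ℝ) / p.q + 1 := by
    refine Nat.cast_div_le.trans ?_
    rw [div_add_one hq'.ne']
    refine div_le_div_of_nonneg_right ?_ hq'.le
    exact_mod_cast Nat.sub_le _ _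
  have h3 : (oracleCalls p T : ℝ) ≤
      p.S₁ + ((((T + p.q - 1) / p.q : ℕ) : ℝ) * p.S₁ + T * (2 * p.S₂)) := by
    unfold oracleCalls
    exact_mod_cast Nat.add_le_add_left h1 p.S₁
  have h4 := mul_le_mul_of_nonneg_right h2 (Nat.cast_nonneg p.S₁)
  linarith

/-- Deliberately the same right side as in `oracleCalls_le`, so that `sample_complexity_bound`
covers both counts. -/
lemma sampleCount_le (p : Params) (T : ℕ) :
    (sampleCount p T : ℝ) ≤ ((T : ℝ) / p.q + 2) * p.S₁ + 2 * T * p.S₂ := by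
  have h1 : (⌈(T : ℝ) / p.q⌉₊ : ℝ) ≤ (T : ℝ) / p.q + 2 := by
    have := Nat.ceil_lt_add_one (by positivity : 0 ≤ (T : ℝ) / p.q)
    linarith
  have h2 := mul_le_mul_of_nonneg_right h1 (Nat.cast_nonneg p.S₁)
  have h3 : (0 : ℝ) ≤ (T : ℝ) * p.S₂ := by positivity
  unfold sampleCount
  push_cast
  linarith

/-- Here `x = κ σ`. Both `S₁ / q` and `S₂` are at most `b² s / ε`, so `T` iterations cost a multiple
of `s A / ε³`. The initial and rounding terms `2 S₁` are of order `s² / ε² ≤ s² / ε³`, whence `s (s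
+ A)`. -/
lemma sample_complexity_bound {b ε x K A s S₁ S₂ q T : ℝ} (hb : 1 ≤ b) (hε : 0 < ε) (hε1 : ε ≤ 1)
    (hx : 0 ≤ x) (hK : 0 ≤ K) (hA : 0 ≤ A) (hs : s = max 1 x) (hq : 1 ≤ q) (hT0 : 0 ≤ T)
    (hS₁ : S₁ ≤ b * max 1 (x ^ 2 / ε ^ 2)) (hqx : x / ε ≤ b * q)
    (hq' : q ≤ b * max 1 (x / ε)) (hS₂ : S₂ ≤ b * q) (hT : T ≤ K * A / ε ^ 2) :
    (T / q + 2) * S₁ + 2 * T * S₂ ≤ (3 * b ^ 2 * K + 2 * b) * (s * (s + A)) / ε ^ 3 := by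
  have hs1 : 1 ≤ s := by rw [hs]; exact le_max_left _ _
  have hsx : x ≤ s := by rw [hs]; exact le_max_right _ _
  have hb0 : 0 < b := by linarith
  have hq0 : 0 < q := by linarith
  have hs0 : 0 < s := by linarith
  have hsε : 1 ≤ s / ε := by rw [le_div_iff₀ hε]; linarith
  have hxε : x / ε ≤ s / ε := div_le_div_of_nonneg_right hsx hε.le
  have hxε0 : 0 ≤ x / ε := by positivity
  have e1 : x ^ 2 / ε ^ 2 = (x / ε) ^ 2 := by rw [div_pow]
  rw [e1] at hS₁
  have a1 : S₁ ≤ b * (s / ε) ^ 2 := by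
    refine hS₁.trans (mul_le_mul_of_nonneg_left (max_le ?_ ?_) hb0.le)
    · exact one_le_pow₀ hsε
    · exact pow_le_pow_left₀ hxε0 hxε 2
  have a2 : S₁ / q ≤ b ^ 2 * (s / ε) := by
    rw [div_le_iff₀ hq0]
    refine hS₁.trans ?_
    have : max 1 ((x / ε) ^ 2) ≤ b * (s / ε) * q := by
      refine max_le ?_ ?_
      · have h1 : 1 ≤ b * (s / ε) := one_le_mul_of_one_le_of_one_le hb hsε
        exact one_le_mul_of_one_le_of_one_le h1 hq
      · have := mul_le_mul hxε hqx hxε0 (by positivity)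
        rw [sq]
        linarith
    have := mul_le_mul_of_nonneg_left this hb0.le
    linarith
  have a3 : S₂ ≤ b ^ 2 * (s / ε) := by
    have h1 : max 1 (x / ε) ≤ s / ε := max_le hsε hxε
    have h2 := mul_le_mul_of_nonneg_left (hq'.trans (mul_le_mul_of_nonneg_left h1 hb0.le)) hb0.le
    linarith
  have c1 := mul_le_mul_of_nonneg_left a2 hT0
  have c2 := mul_le_mul_of_nonneg_left a3 hT0
  have c3 := mul_le_mul_of_nonneg_right hT (by positivity : 0 ≤ 3 * (b ^ 2 * (s / ε)))
  have e2 : T / q * S₁ = T * (S₁ / q) := by ring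
  have h1 : (T / q + 2) * S₁ + 2 * T * S₂ ≤
      K * A / ε ^ 2 * (3 * (b ^ 2 * (s / ε))) + 2 * (b * (s / ε) ^ 2) := by
    rw [add_mul, e2]
    linarith
  refine h1.trans ?_
  have e3 : K * A / ε ^ 2 * (3 * (b ^ 2 * (s / ε))) = 3 * b ^ 2 * K * (s * A) / ε ^ 3 := by
    field_simp
  have h2 : 2 * (b * (s / ε) ^ 2) ≤ 2 * b * s ^ 2 / ε ^ 3 := by
    have e4 : 2 * (b * (s / ε) ^ 2) = 2 * b * s ^ 2 / ε ^ 2 := by field_simp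
    rw [e4]
    exact div_le_div_of_nonneg_left (by positivity) (by positivity)
      (pow_le_pow_of_le_one hε.le hε1 (by norm_num))
  rw [e3]
  have h3 : 3 * b ^ 2 * K * (s * A) / ε ^ 3 + 2 * b * s ^ 2 / ε ^ 3 ≤
      (3 * b ^ 2 * K + 2 * b) * (s * (s + A)) / ε ^ 3 := by
    rw [← add_div]
    refine div_le_div_of_nonneg_right ?_ (by positivity)
    have p1 : 0 ≤ b ^ 2 * K * s ^ 2 := by positivity
    have p2 : 0 ≤ b * (s * A) := by positivity
    linarith
  linarith

/-- Tightness gives `1/ηx ≤ b² L κ² / r` and `1/ηy ≤ b² L / r`. The `+1` from the ceiling is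
absorbed by the summand `1` in `A`, as `ε ≤ 1`. -/
lemma iteration_complexity_bound {b C L κ r ηx ηy ε Δ δ w A : ℝ} (hb : 1 ≤ b) (hC : 0 ≤ C)
    (hL : 0 < L) (hκ : 0 < κ) (hr : 0 < r) (hηx : 0 < ηx) (hηy : 0 < ηy) (hε : 0 < ε)
    (hε1 : ε ≤ 1) (hΔ : 0 ≤ Δ) (hδ : 0 ≤ δ) (hw : 0 ≤ w) (h1 : r / L ≤ b * ηy)
    (h2 : ηy / κ ^ 2 ≤ b * ηx)
    (hA : A = 1 + max (L * κ ^ 2 * Δ / r) (max (L ^ 2 * κ * δ / r) w)) :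
    1 ≤ A ∧ (⌈C * max (Δ / ηx) (max (L * κ * δ / ηy) w) / ε ^ 2⌉₊ : ℝ) ≤
      (C * b ^ 2 + 1) * A / ε ^ 2 := by
  have hb0 : 0 < b := by linarith
  have hb2 : 1 ≤ b ^ 2 := one_le_pow₀ hb
  set m' := max (L * κ ^ 2 * Δ / r) (max (L ^ 2 * κ * δ / r) w) with hm'
  have hm0 : 0 ≤ m' := (hw.trans (le_max_right _ _)).trans (le_max_right _ _)
  have g1 : Δ / ηx ≤ b ^ 2 * m' := by
    have k1 : r ≤ b ^ 2 * (L * κ ^ 2) * ηx := by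
      rw [div_le_iff₀ hL] at h1
      rw [div_le_iff₀ (by positivity)] at h2
      have := mul_le_mul_of_nonneg_left h2 (by positivity : 0 ≤ b * L)
      linarith
    have k2 : Δ / ηx ≤ b ^ 2 * (L * κ ^ 2 * Δ / r) := by
      rw [div_le_iff₀ hηx]
      have e : b ^ 2 * (L * κ ^ 2 * Δ / r) * ηx = b ^ 2 * (L * κ ^ 2) * ηx * Δ / r := by ring
      rw [e, le_div_iff₀ hr, mul_comm Δ]
      exact mul_le_mul_of_nonneg_right k1 hΔ
    exact k2.trans (mul_le_mul_of_nonneg_left (le_max_left _ _) (by positivity))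
  have g2 : L * κ * δ / ηy ≤ b ^ 2 * m' := by
    have k1 : r ≤ b ^ 2 * L * ηy := by
      rw [div_le_iff₀ hL] at h1
      have : b * ηy * L ≤ b ^ 2 * (ηy * L) := by
        have := mul_le_mul_of_nonneg_right (by nlinarith : b ≤ b ^ 2)
          (by positivity : 0 ≤ ηy * L)
        linarith
      linarith
    have k2 : L * κ * δ / ηy ≤ b ^ 2 * (L ^ 2 * κ * δ / r) := by
      rw [div_le_iff₀ hηy]
      have e : b ^ 2 * (L ^ 2 * κ * δ / r) * ηy = b ^ 2 * L * ηy * (L * κ * δ) / r := by ring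
      rw [e, le_div_iff₀ hr, mul_comm (L * κ * δ)]
      exact mul_le_mul_of_nonneg_right k1 (by positivity)
    exact k2.trans (mul_le_mul_of_nonneg_left
      ((le_max_left _ _).trans (le_max_right _ _)) (by positivity))
  have g3 : w ≤ b ^ 2 * m' :=
    (le_mul_of_one_le_left hw hb2).trans (mul_le_mul_of_nonneg_left
      ((le_max_right _ _).trans (le_max_right _ _)) (by positivity))
  have g4 : max (Δ / ηx) (max (L * κ * δ / ηy) w) ≤ b ^ 2 * m' := max_le g1 (max_le g2 g3)
  have hpos : 0 ≤ max (Δ / ηx) (max (L * κ * δ / ηy) w) :=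
    (hw.trans (le_max_right _ _)).trans (le_max_right _ _)
  refine ⟨by rw [hA]; linarith, ?_⟩
  have hceil := (Nat.ceil_lt_add_one (by positivity :
    0 ≤ C * max (Δ / ηx) (max (L * κ * δ / ηy) w) / ε ^ 2)).le
  refine hceil.trans ?_
  have k1 := mul_le_mul_of_nonneg_left g4 hC
  rw [le_div_iff₀ (by positivity), add_mul, div_mul_cancel₀ _ (by positivity), one_mul, hA]
  have k2 : ε ^ 2 ≤ 1 := pow_le_one₀ hε.le hε1
  have k3 : 0 ≤ C * b ^ 2 := by positivity
  linarith

end Complexity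

/-! ### The initial consensus error of the trackers -/

section InitialTracker

variable {d m M : ℕ} {Ω Ξ : Type*} [MeasurableSpace Ξ] {P : Fin M → Measure Ξ}
  {f : Fin M → Pt d m → ℝ} {g : Fin M → Pt d m → Ξ → Pt d m} {L μ σ : ℝ} {p : Params}
  {z₀ : Fin M → Pt d m} {D₀ : (Fin M → Pt d m) → (Fin M → Pt d m)}
  {ξ : Fin M → ℕ → ℕ → Ω → Ξ}
  [MeasurableSpace Ω] {Pr : Measure Ω} [IsProbabilityMeasure Pr]

/-- The average minimises the sum of squared distances, so it may be replaced by the deterministic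
average `c` of the gradients. Then each agent's sampling noise is centred and adds at most `σ²`. -/
lemma integral_consensusError_initState_le (hM : 0 < M)
    (hf : ObjectiveAssumptions f L μ) (hg : OracleAssumptions f g P L σ)
    (hξ : SampleAssumptions Pr P ξ) (hS₁ : 1 ≤ p.S₁)
    (hD2 : ∀ i, MemLp (fun ω => (initState g p z₀ D₀ fun j k => ξ j 0 k ω).dir i) 2 Pr)
    (hcontr : ∀ v, consensusError (D₀ v) ≤ consensusError v) :
    ∫ ω, consensusError (initState g p z₀ D₀ fun i k => ξ i 0 k ω).dir ∂Pr ≤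
      consensusError (fun i => ∇ (f i) (z₀ i)) + M * σ ^ 2 := by
  set c := avg fun i => ∇ (f i) (z₀ i) with hc
  have hb : ∀ i, MemLp (fun ω => (∇ (f i) (z₀ i) - c) +
      (batchGrad (g i) p.S₁ (fun k => ξ i 0 k ω) (z₀ i) - ∇ (f i) (z₀ i))) 2 Pr ∧
      ∫ ω, ‖(∇ (f i) (z₀ i) - c) +
        (batchGrad (g i) p.S₁ (fun k => ξ i 0 k ω) (z₀ i) - ∇ (f i) (z₀ i))‖ ^ 2 ∂Pr ≤
      ‖∇ (f i) (z₀ i) - c‖ ^ 2 + σ ^ 2 / p.S₁ := fun i =>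
    fresh_batch_bound_add hf hg hξ i 0 (z := fun _ => z₀ i)
      (@measurable_const _ _ _ (samplesIn ξ (before M 0)) _) hS₁ _
  have hle : ∀ ω, consensusError (initState g p z₀ D₀ fun i k => ξ i 0 k ω).dir ≤
      ∑ i, ‖(∇ (f i) (z₀ i) - c) +
        (batchGrad (g i) p.S₁ (fun k => ξ i 0 k ω) (z₀ i) - ∇ (f i) (z₀ i))‖ ^ 2 := by
    intro ω
    refine (hcontr _).trans ((consensusError_le_sum hM _ c).trans (le_of_eq ?_))
    refine Finset.sum_congr rfl fun i _ => ?_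
    congr 2
    abel
  have h1 := integral_mono (integrable_consensusError hD2)
    (integrable_sum_norm_sq fun i => (hb i).1) hle
  refine h1.trans ?_
  rw [integral_finsetSum _ fun i _ => integrable_norm_sq_of_memLp (hb i).1]
  have h2 : ∀ i, ∫ ω, ‖(∇ (f i) (z₀ i) - c) +
        (batchGrad (g i) p.S₁ (fun k => ξ i 0 k ω) (z₀ i) - ∇ (f i) (z₀ i))‖ ^ 2 ∂Pr ≤
      ‖∇ (f i) (z₀ i) - c‖ ^ 2 + σ ^ 2 := fun i =>
    (hb i).2.trans (add_le_add le_rfl (div_le_self (sq_nonneg σ) (by exact_mod_cast hS₁)))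
  refine (Finset.sum_le_sum fun i _ => h2 i).trans (le_of_eq ?_)
  rw [Finset.sum_add_distrib, consensusError, ← hc]
  simp

end InitialTracker

/-! ### From second to first moments -/

section Average

/-- From a bound on the average of second moments to one on the average of first moments. -/
lemma average_le_of_average_sq_le {x y : ℕ → ℝ} {ε : ℝ} (hε : 0 < ε) {T : ℕ}
    (hxy : ∀ t, x t ≤ (y t / ε + ε) / 2)
    (h : (1 / (T : ℝ)) * ∑ t ∈ Finset.range T, y t ≤ ε ^ 2) :
    (1 / (T : ℝ)) * ∑ t ∈ Finset.range T, x t ≤ ε := by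
  have h1 : ∑ t ∈ Finset.range T, x t ≤ ∑ t ∈ Finset.range T, (y t / ε + ε) / 2 :=
    Finset.sum_le_sum fun t _ => hxy t
  have h2 : ∑ t ∈ Finset.range T, (y t / ε + ε) / 2 =
      ((∑ t ∈ Finset.range T, y t) / ε + T * ε) / 2 := by
    rw [← Finset.sum_div, Finset.sum_add_distrib, ← Finset.sum_div]
    simp
  rw [h2] at h1
  have h3 := mul_le_mul_of_nonneg_left h1 (by positivity : 0 ≤ 1 / (T : ℝ))
  refine h3.trans ?_
  -- An inequality, so that `T = 0` is included.
  have h4 : 1 / (T : ℝ) * T ≤ 1 := by rw [one_div]; exact inv_mul_le_one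
  have h5 : (1 / (T : ℝ)) * (∑ t ∈ Finset.range T, y t) / ε ≤ ε := by
    rw [div_le_iff₀ hε]; linarith
  have h6 := mul_le_mul_of_nonneg_right h4 hε.le
  have e : 1 / (T : ℝ) * (((∑ t ∈ Finset.range T, y t) / ε + T * ε) / 2) =
      ((1 / (T : ℝ)) * (∑ t ∈ Finset.range T, y t) / ε + 1 / (T : ℝ) * T * ε) / 2 := by ring
  rw [e]
  linarith

end Average

end DGDAVR

/-! ### The theorem -/

open DGDAVR in
theorem theorem1 :
    ∃ cy cx cS C : ℝ, 0 < cy ∧ 0 < cx ∧ 0 < cS ∧ 0 < C ∧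
    ∀ b : ℝ, 1 ≤ b → ∃ C' : ℝ, 0 < C' ∧
    ∀ (d m M : ℕ), 0 < m → 0 < M →
    ∀ (Ω Ξ : Type*) [MeasurableSpace Ω] [MeasurableSpace Ξ]
      (Pr : Measure Ω) [IsProbabilityMeasure Pr]
      (P : Fin M → Measure Ξ) (ξ : Fin M → ℕ → ℕ → Ω → Ξ)
      (f : Fin M → Pt d m → ℝ) (g : Fin M → Pt d m → Ξ → Pt d m)
      (W : Matrix (Fin M) (Fin M) ℝ)
      (L μ σ ε κ ρ r Δ δ Λ : ℝ) (p : Params)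
      (z₀ : Fin M → Pt d m) (D₀ : (Fin M → Pt d m) → (Fin M → Pt d m)),
    -- the problem, the oracles, the samples and the network
    ObjectiveAssumptions f L μ →
    OracleAssumptions f g P L σ →
    SampleAssumptions Pr P ξ →
    W ∈ doublyStochastic ℝ (Fin M) → ρ = rho W → ρ < 1 →
    -- the initial trackers
    Measurable D₀ → (∀ v, avg (D₀ v) = avg v) →
    (∀ i, MemLp (fun ω => (initState g p z₀ D₀ fun j k => ξ j 0 k ω).dir i) 2 Pr) →
    -- abbreviations
    κ = L / μ → r = min ((1 - ρ) ^ 2) (1 / κ) →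
    Δ = primalGap f z₀ → δ = dualGap f z₀ → Λ = initConsensus Pr g p L z₀ D₀ ξ →
    -- the choice of the parameters
    0 < ε →
    0 < p.ηy → p.ηy ≤ cy * (r / L) →
    0 < p.ηx → p.ηx ≤ cx * (p.ηy / κ ^ 2) →
    1 ≤ p.S₁ → cS * (κ ^ 2 * σ ^ 2 / ε ^ 2) ≤ p.S₁ →
    1 ≤ p.q → p.q ≤ p.S₂ →
    Differentiable ℝ (primal f) ∧
    (∀ t, Integrable
      (fun ω => ‖∇ (primal f) (xbar g W p z₀ D₀ (fun i t k => ξ i t k ω) t)‖ ^ 2) Pr) ∧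
    ∃ Tε : ℕ,
      Tε ≤ ⌈C * max (Δ / p.ηx) (max (L * κ * δ / p.ηy) (L ^ 2 * κ ^ 2 * Λ / ((1 - ρ) * M)))
          / ε ^ 2⌉₊ ∧
      -- the convergence guarantee
      (∀ T : ℕ, Tε ≤ T →
        (1 / (T : ℝ)) * ∑ t ∈ Finset.range T,
            ∫ ω, ‖∇ (primal f) (xbar g W p z₀ D₀ (fun i t k => ξ i t k ω) t)‖ ^ 2 ∂Pr ≤ ε ^ 2 ∧
        (1 / (T : ℝ)) * ∑ t ∈ Finset.range T,
            ∫ ω, ‖∇ (primal f) (xbar g W p z₀ D₀ (fun i t k => ξ i t k ω) t)‖ ∂Pr ≤ ε) ∧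
      -- the communication and oracle complexities
      (ε ≤ 1 →
        r / L ≤ b * p.ηy → p.ηy / κ ^ 2 ≤ b * p.ηx →
        p.S₁ ≤ b * max 1 (κ ^ 2 * σ ^ 2 / ε ^ 2) →
        κ * σ / ε ≤ b * p.q → p.q ≤ b * max 1 (κ * σ / ε) → p.S₂ ≤ b * p.q →
        ∀ A B : ℝ,
          A = 1 + max (L * κ ^ 2 * Δ / r)
            (max (L ^ 2 * κ * δ / r) (L ^ 2 * κ ^ 2 * Λ / ((1 - ρ) * M))) →
          B = max 1 (κ * σ) * (max 1 (κ * σ) + A) →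
          Tε ≤ C' * A / ε ^ 2 ∧
          oracleCalls p Tε ≤ C' * B / ε ^ 3 ∧
          sampleCount p Tε ≤ C' * B / ε ^ 3 ∧
          ((∀ v, consensusError (D₀ v) ≤ consensusError v) →
            Λ ≤ max (consensusError z₀)
              ((consensusError (fun i => ∇ (f i) (z₀ i)) + M * σ ^ 2) / L ^ 2))) := by
  -- Half of `ε²` is reserved for the variance, `1176 = 2 · 588`, and half for the initial terms,
  -- `2000 ≥ 2 · (2 + 9 + 924)`.
  refine ⟨1 / 100, 1 / 20, 1176, 2000, by norm_num, by norm_num, by norm_num, by norm_num, ?_⟩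
  intro b hb
  -- The factor `3 b² K + 2 b` of `sample_complexity_bound`, with `K = 2000 b² + 1` from
  -- `iteration_complexity_bound`.
  refine ⟨3 * b ^ 2 * (2000 * b ^ 2 + 1) + 2 * b, by positivity, ?_⟩
  intro d m M hm hM Ω Ξ _ _ Pr _ P ξ f g W L μ σ ε κ ρ r Δ δ Λ p z₀ D₀ hf hg hξ hW hρ hρ1
    hD hDavg hD2 hκ hr hΔ hδ hΛ hε hηy hηy' hηx hηx' hS₁ hS₁' hq hqS
  have hF := hf.smoothConcave hM
  have hL := hf.L_pos
  have hμ := hf.mu_pos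
  have hκ1 : 1 ≤ κ := by rw [hκ, le_div_iff₀ hμ, one_mul]; exact hF.mu_le_L hm
  have hκ0 : 0 < κ := by linarith
  have hθ : 0 < 1 - ρ := by linarith
  have hM' : (0 : ℝ) < M := by exact_mod_cast hM
  have hr0 : 0 < r := by rw [hr]; exact lt_min (by positivity) (by positivity)
  have hηr : p.ηy * L ≤ 1 / 100 * r := by
    have := mul_le_mul_of_nonneg_right hηy' hL.le
    rwa [mul_assoc, div_mul_cancel₀ _ hL.ne'] at this
  have hηθ : p.ηy * L ≤ 1 / 100 * (1 - ρ) ^ 2 := by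
    have : r ≤ (1 - ρ) ^ 2 := by rw [hr]; exact min_le_left _ _
    linarith
  have hηκ : p.ηy * L ≤ 1 / 100 / κ := by
    have : r ≤ 1 / κ := by rw [hr]; exact min_le_right _ _
    rw [div_eq_mul_one_div (1 / 100) κ]
    linarith
  have hS₂ : 1 ≤ p.S₂ := hq.trans hqS
  have hxy : p.ηx ≤ p.ηy := by
    have : p.ηy / κ ^ 2 ≤ p.ηy := div_le_self hηy.le (one_le_pow₀ hκ1)
    linarith
  have hΔ0 : 0 ≤ Δ := by rw [hΔ]; exact sub_nonneg.2 (ciInf_le hf.primal_bddBelow _)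
  have hδ0 : 0 ≤ δ := by rw [hδ]; exact sq_nonneg _
  have hΛ0 : 0 ≤ Λ := by rw [hΛ]; exact (consensusError_nonneg z₀).trans (le_max_left _ _)
  have hw0 : 0 ≤ L ^ 2 * κ ^ 2 * Λ / ((1 - ρ) * M) := by positivity
  have hgrad : ∀ t, MemLp
      (fun ω => ∇ (primal f) (xbar g W p z₀ D₀ (fun i t k => ξ i t k ω) t)) 2 Pr :=
    memLp_gradient_primal hf hg hξ hD hηx hxy hD2 hS₁ hS₂ hM
  refine ⟨differentiable_primal hF, fun t => integrable_norm_sq_of_memLp (hgrad t), ?_⟩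
  -- `Tε` is the ceiling itself.
  refine ⟨_, le_rfl, ?_, ?_⟩
  · intro T hT
    have hsq : (1 / (T : ℝ)) * ∑ t ∈ Finset.range T,
        ∫ ω, ‖∇ (primal f) (xbar g W p z₀ D₀ (fun i t k => ξ i t k ω) t)‖ ^ 2 ∂Pr ≤ ε ^ 2 := by
      rcases T with _ | n
      · simpa using sq_nonneg ε
      have hmain := sum_integral_gradient_primal_le (W := W) (z₀ := z₀) hM hm hf hg hξ hW
        (hρ ▸ hρ1) hD hDavg hD2 hηy (hρ ▸ hηθ) (hκ ▸ hηκ) hηx (hκ ▸ hηx') hS₁ hq hqS n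
      rw [← hκ, ← hρ, ← hΔ, ← hδ, ← hΛ] at hmain
      have hTc := Nat.ceil_le.1 hT
      rw [div_le_iff₀ (by positivity)] at hTc
      push_cast at hTc ⊢
      set mx := max (Δ / p.ηx) (max (L * κ * δ / p.ηy) (L ^ 2 * κ ^ 2 * Λ / ((1 - ρ) * M)))
      have m1 : Δ / p.ηx ≤ mx := le_max_left _ _
      have m2 : L * κ * δ / p.ηy ≤ mx := (le_max_left _ _).trans (le_max_right _ _)
      have m3 : L ^ 2 * κ ^ 2 * Λ / ((1 - ρ) * M) ≤ mx :=
        (le_max_right _ _).trans (le_max_right _ _)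
      have hmx : 0 ≤ mx := hw0.trans m3
      have hn : (0 : ℝ) < n + 1 := by positivity
      have hvar : κ ^ 2 * ((n + 1) * (σ ^ 2 / p.S₁)) ≤ (n + 1) * (ε ^ 2 / 1176) := by
        have hS : (0 : ℝ) < p.S₁ := by exact_mod_cast hS₁
        have h1 : κ ^ 2 * σ ^ 2 / p.S₁ ≤ ε ^ 2 / 1176 := by
          rw [mul_div_assoc', div_le_iff₀ (by positivity)] at hS₁'
          rw [div_le_div_iff₀ hS (by norm_num)]
          linarith
        have h2 := mul_le_mul_of_nonneg_left h1 hn.le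
        refine le_trans (le_of_eq ?_) h2
        ring
      rw [one_div, inv_mul_le_iff₀ hn]
      refine le_trans hmain ?_
      linarith
    refine ⟨hsq, average_le_of_average_sq_le hε (fun t => ?_) hsq⟩
    have hg2 := integrable_norm_sq_of_memLp (hgrad t)
    -- The inequality `2 a ε ≤ a² + ε²`, divided by `2 ε`.
    have hpt : ∀ ω, ‖∇ (primal f) (xbar g W p z₀ D₀ (fun i t k => ξ i t k ω) t)‖ ≤
        1 / (2 * ε) * ‖∇ (primal f) (xbar g W p z₀ D₀ (fun i t k => ξ i t k ω) t)‖ ^ 2 +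
          ε / 2 * 1 := by
      intro ω
      set a := ‖∇ (primal f) (xbar g W p z₀ D₀ (fun i t k => ξ i t k ω) t)‖
      have e : 1 / (2 * ε) * a ^ 2 + ε / 2 * 1 - a = 1 / (2 * ε) * (a - ε) ^ 2 := by
        field_simp
        ring
      have : 0 ≤ 1 / (2 * ε) * (a - ε) ^ 2 := by positivity
      linarith
    have h := integral_le_two ((hgrad t).integrable (by norm_num)).norm hg2
      (integrable_const (1 : ℝ)) hpt
    refine h.trans (le_of_eq ?_)
    simp only [integral_const, probReal_univ, one_smul]
    field_simp
  · intro hε1 h1 h2 h3 h4 h5 h6 A B hA hB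
    obtain ⟨hA1, hT⟩ := iteration_complexity_bound (C := 2000) hb (by norm_num) hL hκ0 hr0 hηx hηy
      hε hε1 hΔ0 hδ0 hw0 h1 h2 hA
    have hb0 : 0 < b := by linarith
    set T := ⌈2000 * max (Δ / p.ηx) (max (L * κ * δ / p.ηy)
      (L ^ 2 * κ ^ 2 * Λ / ((1 - ρ) * M))) / ε ^ 2⌉₊
    have hσ := hg.sigma_pos
    have hcalls := sample_complexity_bound (x := κ * σ) (S₁ := p.S₁) (S₂ := p.S₂) (q := p.q)
      (T := T) (A := A) hb hε hε1 (by positivity) (by positivity : 0 ≤ 2000 * b ^ 2 + 1)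
      (by linarith) rfl (by exact_mod_cast hq) (Nat.cast_nonneg T) (by rwa [mul_pow]) h4 h5 h6 hT
    rw [← hB] at hcalls
    refine ⟨hT.trans ?_, (oracleCalls_le p hq T).trans hcalls, (sampleCount_le p T).trans hcalls,
      fun hcontr => ?_⟩
    · refine div_le_div_of_nonneg_right (mul_le_mul_of_nonneg_right ?_ (by linarith))
        (by positivity)
      have hb2 : 1 ≤ b ^ 2 := one_le_pow₀ hb
      have := le_mul_of_one_le_left (by positivity : 0 ≤ 2000 * b ^ 2 + 1)
        (by linarith : 1 ≤ 3 * b ^ 2)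
      linarith
    · rw [hΛ]
      refine max_le_max le_rfl (div_le_div_of_nonneg_right ?_ (by positivity))
      exact integral_consensusError_initState_le hM hf hg hξ hS₁ hD2 hcontr
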